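/- **Setting.** Let $n,m,d\ge 1$. Client $i\in[n]$ holds a local dataset $D_i=(d_{i,1},\dots,d_{i,m})$ of points of a data space $\mathcal Z$; write $f_{i,j}(x)=f(x;d_{i,j})$, $f_i=\frac1m\sum_{j=1}^m f_{i,j}$, $f=\frac1n\sum_{i=1}^n f_i$ on $\mathbb R^d$. There are $L,G>0$ such that for every $z\in\mathcal Z$ the function $f(\cdot\,;z)$ is differentiable with $L$-Lipschitz gradient and $\|\nabla f(x;z)\|\le G$ for all $x$. An $\omega$-compression operator ($\omega\ge 0$) is a randomized map $\mathcal C:\mathbb R^d\to\mathbb R^d$ with $\mathbb E[\mathcal C(x)]=x$ and $\mathbb E\|\mathcal C(x)-x\|^2\le\omega\|x\|^2$ for all $x$. **Algorithm (SoteriaFL-SGD)** with initial point $x^0$, stepsize $\eta$, shift stepsize $\gamma$, noise variance $\sigma_p^2$, minibatch size $b\in(0,m]$, run for $T$ rounds. Start with $s_i^0=s^0=0$. In round $t=0,\dots,T-1$ each client $i$ samples a minibatch $\mathcal I$ that contains each $j\in[m]$ independently with probability $b/m$, forms $\tilde g_i^t=\frac1b\sum_{j\in\mathcal I}\nabla f_{i,j}(x^t)$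 and $g_i^t=\tilde g_i^t+\xi_i^t$ with $\xi_i^t\sim\mathcal N(0,\sigma_p^2 I)$, sends $v_i^t=\mathcal C_i^t(g_i^t-s_i^t)$ to the server, where $\mathcal C_i^t$ is an $\omega$-compression operator, and sets $s_i^{t+1}=s_i^t+\gamma v_i^t$. The server sets $x^{t+1}=x^t-\eta\,(s^t+\frac1n\sum_i v_i^t)$ and $s^{t+1}=s^t+\gamma\frac1n\sum_i v_i^t$. All random choices are independent. SoteriaFL-GD is the case $b=m$. **Privacy.** The algorithm is $(\epsilon,\delta)$-LDP if for every client $i$, all datasets of the other clients, all $D_i,D_i'$ that differ in one entry and all measurable sets $S$ of possible values of the collection $\mathcal M$ of all messages $(v_k^t)_{k\in[n],\,0\le t<T}$, $\Pr\{\mathcal M(D_i)\in S\}\le e^{\epsilon}\Pr\{\mathcal M(D_i')\in S\}+\delta$. **Parameters.** Put $$\tau=\frac{(1+\omega)^{3/2}}{n^{1/2}},\quad \beta=\frac{\tau}{2(1+\omega)},\quad \gamma=\sqrt{\frac{1+2\omega}{2(1+\omega)^3}},\quad \Phi_0=f(x^0)-\inf f+\frac{\beta}{Ln}\sum_{i=1}^n\|\nabla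 f_i(x^0)\|^2 .$$ **Statement.** For every $A>0$ there are constants $c,c',C>0$ depending only on $A$ such that the following holds for all data as above, all $\epsilon>0$, $\delta\in(0,1)$, all $T\ge 1$, all $x^0$, all $0<\eta\le\frac{1}{(1+2\tau)L}$, with $\sigma_p^2=c\,\frac{G^2T\log(1/\delta)}{m^2\epsilon^2}$, and with either $b=\min\Big\{\frac{m\epsilon G\sqrt\beta}{\sqrt{(1+\omega)Ld\log(1/\delta)}},\,m\Big\}$ (SoteriaFL-SGD) or $b=m$ (SoteriaFL-GD). 1. If $\epsilon\le A\log(1/\delta)$ and $\epsilon<c'\,b^2T/m^2$, the algorithm is $(\epsilon,\delta)$-LDP. 2. If $f$ is bounded below and the number of rounds is $$T=r\cdot\frac{\sqrt{nL}\,m\epsilon}{G\sqrt{(1+\omega)d\log(1/\delta)}}\,(1+\sqrt\tau)$$ with $r>0$ (the constant hidden in $T=O(\cdot)$), then all $\mathbb E\|\nabla f(x^t)\|^2$, $t<T$, are finite and $$\frac1T\sum_{t=0}^{T-1}\mathbb E\|\nabla f(x^t)\|^2\le C\Big(1+r+\frac{\Phi_0}{r}\Big)\cdot\frac{1}{\eta(1+2\tau)L}\cdot\frac{G\sqrt{(1+\omega)Ld\log(1/\delta)}}{\sqrt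 n\,m\epsilon}\,(1+\sqrt\tau).$$ In particular, for $\eta=\frac1{(1+2\tau)L}$, $r$ of constant order and $\Phi_0$ regarded as a constant, the right-hand side is $O\Big(\frac{G\sqrt{(1+\omega)Ld\log(1/\delta)}}{\sqrt n\,m\epsilon}(1+\sqrt\tau)\Big)$. -/

import Mathlib

open MeasureTheory ProbabilityTheory

universe u v

noncomputable section

namespace SoteriaFL

/-- The parameter space `ℝ^d` with the Euclidean norm. -/
abbrev Vec (d : ℕ) : Type := EuclideanSpace ℝ (Fin d)

/-! ### The optimization problem

`Z` is the data space and `loss z x` is the loss `f(x; z)` of the model `x` on the sample `z`.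
A local dataset is a function `Fin m → Z`; a distributed dataset is a function
`D : Fin n → Fin m → Z`, with `f_{i,j} = loss (D i j)`. -/

/-- The local objective `f_i(x) = (1/m) ∑_j f(x; d_{i,j})` of a client with local dataset `Di`. -/
def clientObjective {d m : ℕ} {Z : Type u} (loss : Z → Vec d → ℝ) (Di : Fin m → Z)
    (x : Vec d) : ℝ :=
  (1 / (m : ℝ)) * ∑ j, loss (Di j) x

/-- The global objective `f(x) = (1/n) ∑_i f_i(x)`. -/
def objective {d n m : ℕ} {Z : Type u} (loss : Z → Vec d → ℝ) (D : Fin n → Fin m → Z)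
    (x : Vec d) : ℝ :=
  (1 / (n : ℝ)) * ∑ i, clientObjective loss (D i) x

/-- `g` is `L`-smooth: differentiable, with `L`-Lipschitz gradient. -/
def IsSmooth {d : ℕ} (L : ℝ) (g : Vec d → ℝ) : Prop :=
  Differentiable ℝ g ∧ ∀ x y, ‖gradient g x - gradient g y‖ ≤ L * ‖x - y‖

/-- The gradient of `g` is bounded by `G`. -/
def HasBoundedGradient {d : ℕ} (G : ℝ) (g : Vec d → ℝ) : Prop :=
  ∀ x, ‖gradient g x‖ ≤ G

/-! ### Compression operators -/

/-- The randomized map `x ↦ K r x`, with `r` drawn from `ν`, is an `ω`-compression operator: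
it is unbiased and `E‖K(x) - x‖² ≤ ω ‖x‖²`. The second moment is a Lebesgue integral, so that the
bound includes its finiteness (and the integrability of `K(x)`). -/
structure IsCompressionOperator {d : ℕ} {U : Type v} [MeasurableSpace U] (ν : Measure U)
    (K : U → Vec d → Vec d) (ω : ℝ) : Prop where
  measurable : Measurable (Function.uncurry K)
  unbiased : ∀ x, ∫ r, K r x ∂ν = x
  variance : ∀ x, ∫⁻ r, ENNReal.ofReal (‖K r x - x‖ ^ 2) ∂ν ≤ ENNReal.ofReal (ω * ‖x‖ ^ 2)

/-! ### Local differential privacy -/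

/-- Two local datasets are neighbors if they differ by (at most) one entry. -/
def Neighbors {m : ℕ} {Z : Type u} (D D' : Fin m → Z) : Prop :=
  ∃ j, ∀ k, k ≠ j → D k = D' k

/-- A randomized mechanism, given by the law of its output for each local dataset, is
`(ε, δ)`-locally differentially private. -/
def IsLDP {m : ℕ} {Z : Type u} {R : Type*} [MeasurableSpace R] (M : (Fin m → Z) → Measure R)
    (ε δ : ℝ) : Prop :=
  ∀ D D' : Fin m → Z, Neighbors D D' → ∀ S : Set R, MeasurableSet S →
    M D S ≤ ENNReal.ofReal (Real.exp ε) * M D' S + ENNReal.ofReal δ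

/-! ### The algorithm -/

/-- The input parameters: initial point, stepsize, shift stepsize, standard deviation `σ_p` of
the privacy noise, and minibatch size `b`. -/
structure Params (d : ℕ) where
  x₀ : Vec d
  η : ℝ
  γ : ℝ
  σ : ℝ
  b : ℝ

/-- The state at the beginning of a round: the model `x^t`, the references `s_i^t` of the
clients, and the reference `s^t` of the server. -/
structure State (d n : ℕ) where
  x : Vec d
  shift : Fin n → Vec d
  serverShift : Vec d

/-- The random choices of one client in one round: the minibatch (as an indicator function on the
local samples), the Gaussian perturbation, and the randomness of the compression operator. -/
abbrev Seed (m d : ℕ) (U : Type v) : Type v := (Fin m → Bool) × Vec d × U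

/-- The local SGD estimator `(1/b) ∑_{j ∈ I} ∇f_{i,j}(x)`. -/
def localGradient {d m : ℕ} {Z : Type u} (loss : Z → Vec d → ℝ) (b : ℝ) (Di : Fin m → Z)
    (I : Fin m → Bool) (x : Vec d) : Vec d :=
  (1 / b) • ∑ j, if I j then gradient (loss (Di j)) x else 0

/-- The message `v_i^t = C_i^t(g̃_i^t + ξ_i^t - s_i^t)` that a client with local dataset `Di`,
reference `s` and compression operator `K` sends to the server when the model is `x`. -/
def message {d m : ℕ} {Z : Type u} {U : Type v} (loss : Z → Vec d → ℝ) (b : ℝ)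
    (K : U → Vec d → Vec d) (Di : Fin m → Z) (x s : Vec d) (r : Seed m d U) : Vec d :=
  K r.2.2 (localGradient loss b Di r.1 x + r.2.1 - s)

/-- The updates of the model and of the references, given the messages `v_i^t`. -/
def update {d n : ℕ} (P : Params d) (S : State d n) (v : Fin n → Vec d) : State d n where
  x := S.x - P.η • (S.serverShift + (1 / (n : ℝ)) • ∑ i, v i)
  shift := fun i => S.shift i + P.γ • v i
  serverShift := S.serverShift + P.γ • ((1 / (n : ℝ)) • ∑ i, v i)

/-- The state at the beginning of round `t` as a function of the random choices
(`ρ t i` belongs to client `i` in round `t`); `K t i` is the compression operator of client `i` in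
round `t`. -/
def state {d n m : ℕ} {Z : Type u} {U : Type v} (loss : Z → Vec d → ℝ) (P : Params d)
    (K : ℕ → Fin n → U → Vec d → Vec d) (D : Fin n → Fin m → Z)
    (ρ : ℕ → Fin n → Seed m d U) : ℕ → State d n
  | 0 => ⟨P.x₀, fun _ => 0, 0⟩
  | t + 1 =>
    let S := state loss P K D ρ t
    update P S fun i => message loss P.b (K t i) (D i) S.x (S.shift i) (ρ t i)

/-- All the messages `v_i^t` sent in the `T` rounds `t = 0, …, T - 1`. -/
def transcript {d n m : ℕ} {Z : Type u} {U : Type v} (loss : Z → Vec d → ℝ) (P : Params d)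
    (K : ℕ → Fin n → U → Vec d → Vec d) (T : ℕ) (D : Fin n → Fin m → Z)
    (ρ : ℕ → Fin n → Seed m d U) : Fin T → Fin n → Vec d :=
  fun t i =>
    message loss P.b (K t i) (D i) (state loss P K D ρ t).x ((state loss P K D ρ t).shift i) (ρ t i)

/-- The law of the minibatch: every local sample is included independently with
probability `b / m`. -/
def minibatchLaw (m : ℕ) (b : ℝ) : Measure (Fin m → Bool) :=
  Measure.pi fun _ =>
    ENNReal.ofReal (b / m) • Measure.dirac true + ENNReal.ofReal (1 - b / m) • Measure.dirac false

/-- The Gaussian law `N(0, σ² I)` on `ℝ^d`. -/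
def gaussianNoise (d : ℕ) (σ : ℝ) : Measure (Vec d) :=
  (stdGaussian (Vec d)).map fun z => σ • z

/-- The joint law of all random choices: minibatches, perturbations and the randomness of the
compression operators are independent, and independent across clients and rounds. -/
def seedLaw {d n : ℕ} (m : ℕ) {U : Type v} [MeasurableSpace U] (P : Params d)
    (ν : ℕ → Fin n → Measure U) : Measure (ℕ → Fin n → Seed m d U) :=
  Measure.infinitePi fun t => Measure.pi fun i =>
    (minibatchLaw m P.b).prod ((gaussianNoise d P.σ).prod (ν t i))

/-- The law of everything that is sent to the server in `T` rounds (the models `x^t` and the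
references are functions of these messages). -/
def transcriptLaw {d n m : ℕ} {Z : Type u} {U : Type v} [MeasurableSpace U]
    (loss : Z → Vec d → ℝ) (P : Params d) (ν : ℕ → Fin n → Measure U)
    (K : ℕ → Fin n → U → Vec d → Vec d) (T : ℕ) (D : Fin n → Fin m → Z) :
    Measure (Fin T → Fin n → Vec d) :=
  (seedLaw m P ν).map (transcript loss P K T D)

/-- The algorithm run for `T` rounds is `(ε, δ)`-LDP: for every client `i` and whatever the data of
the other clients, the mechanism that maps the local dataset of client `i` to all the messages
of all the clients is `(ε, δ)`-LDP. -/
def AlgorithmIsLDP {d n : ℕ} (m : ℕ) {Z : Type u} {U : Type v} [MeasurableSpace U]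
    (loss : Z → Vec d → ℝ) (P : Params d) (ν : ℕ → Fin n → Measure U)
    (K : ℕ → Fin n → U → Vec d → Vec d) (T : ℕ) (ε δ : ℝ) : Prop :=
  ∀ (i : Fin n) (D : Fin n → Fin m → Z),
    IsLDP (fun Di : Fin m → Z => transcriptLaw loss P ν K T (Function.update D i Di)) ε δ

/-- The squared gradient norm `‖∇f(x^t)‖²`, as a random variable. -/
def gradNormSq {d n m : ℕ} {Z : Type u} {U : Type v} (loss : Z → Vec d → ℝ) (P : Params d)
    (K : ℕ → Fin n → U → Vec d → Vec d) (D : Fin n → Fin m → Z) (t : ℕ)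
    (ρ : ℕ → Fin n → Seed m d U) : ℝ :=
  ‖gradient (objective loss D) (state loss P K D ρ t).x‖ ^ 2

/-! ### The quantities in the statement -/

/-- `τ = (1+ω)^{3/2} / n^{1/2}`. -/
def tau (ω : ℝ) (n : ℕ) : ℝ := (1 + ω) ^ (3 / 2 : ℝ) / √(n : ℝ)

/-- `β = τ / (2(1+ω))`. -/
def beta (ω : ℝ) (n : ℕ) : ℝ := tau ω n / (2 * (1 + ω))

/-- The shift stepsize `√((1+2ω) / (2(1+ω)³))`. -/
def shiftStepsize (ω : ℝ) : ℝ := √((1 + 2 * ω) / (2 * (1 + ω) ^ 3))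

/-- The minibatch size `min {mεG√β / √((1+ω)Ld log(1/δ)), m}`. -/
def sgdBatch (n m d : ℕ) (L G ω ε δ : ℝ) : ℝ :=
  min (m * ε * G * √(beta ω n) / √((1 + ω) * L * d * Real.log (1 / δ))) m

/-- The order of the number of rounds:
`√(nL) mε / (G √((1+ω) d log(1/δ))) · (1 + √τ)`. -/
def roundsOrder (n m d : ℕ) (L G ω ε δ : ℝ) : ℝ :=
  √(n * L) * m * ε / (G * √((1 + ω) * d * Real.log (1 / δ))) * (1 + √(tau ω n))

/-- The order of the utility: `G √((1+ω) L d log(1/δ)) / (√n mε) · (1 + √τ)`. -/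
def utilityOrder (n m d : ℕ) (L G ω ε δ : ℝ) : ℝ :=
  G * √((1 + ω) * L * d * Real.log (1 / δ)) / (√(n : ℝ) * m * ε) * (1 + √(tau ω n))

/-- The initial value `Φ₀ = f(x⁰) - f^* + β/(Ln) ∑_i ‖∇f_i(x⁰) - s_i⁰‖²` of the potential, where
`s_i⁰ = 0` and `f^* = inf f`. -/
def initialPotential {d n m : ℕ} {Z : Type u} (loss : Z → Vec d → ℝ) (D : Fin n → Fin m → Z)
    (L ω : ℝ) (x₀ : Vec d) : ℝ :=
  objective loss D x₀ - (⨅ x, objective loss D x) +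
    beta ω n / (L * n) * ∑ i, ‖gradient (clientObjective loss (D i)) x₀‖ ^ 2

end SoteriaFL

end

/-! Privacy. Every message is a randomized function of earlier messages and fresh seeds, so it
suffices to bound the Rényi divergence of order `α` round by round and add. `HolderDom` encodes that
bound in dual (Hölder) form, which needs no densities on the path space: post-processing is
`HolderDom.map`, adaptive composition is `HolderDom.comp`, and testing with an indicator gives `(ε,
δ)` in `HolderDom.le_add`. In one round only the perturbed gradient of one client pays.
Conditionally on the other samples, its law under either dataset is a mixture `(1-q) N(c, σ²) + q
N(c + a, σ²)` with `q = b/m`, the same `c`, and `‖a‖ ≤ G/b`. Relative to the common Gaussian both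
mixtures have densities of mean one, so the first-order Taylor term of their powers integrates to
zero and the remainder is of order `(α q G/(b σ))² = (α G/(m σ))²`: the sampling rate cancels. This
is `lintegral_mul_mixRatio_le`. With `α = 2 + 2 log(1/δ)/ε`, the `T` rounds cost at most `log(1/δ)`
for the stated noise.

Utility. The potential `f - inf f + w · (1/n) ∑ ‖∇f_i(x) - s_i‖²` decreases in expectation by `η/2
‖∇f‖²` per round, up to a noise term (`lintegral_potential_step`, with the scalar arithmetic in
`step_inequality`). The server direction is unbiased for `∇f`, independence of the clients divides
its variance by `n`, and the shift stepsize contracts the reference errors by enough to absorb the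
compression variance they cause. Telescoping gives `sum_integral_gradNormSq_le`.

Parameters. `roundsOrder * utilityOrder = L (1 + √τ)²` makes `1/T` a multiple of the utility, and
the variances of the Gaussian noise and of the minibatch are bounded by multiples of the same
quantity (`utility_bound`). -/

namespace SoteriaFL

/-! ### Independence of the past from a fresh coordinate. -/

section Independence

/-- A function of the coordinates in a finite set is independent of another coordinate. -/
lemma map_prodMk_eval {ι : Type*} [DecidableEq ι] {S : ι → Type*} [∀ i, MeasurableSpace (S i)]
    {μ : Measure (∀ i, S i)} [IsProbabilityMeasure μ]
    (hμ : iIndepFun (fun i ω => ω i) μ)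
    {s : Finset ι} {i : ι} (hi : i ∉ s) {X : Type*} [MeasurableSpace X] {g : (∀ i, S i) → X}
    (hg : Measurable g) (hdep : ∀ ω ω', (∀ k ∈ s, ω k = ω' k) → g ω = g ω') :
    μ.map (fun ω => (g ω, ω i)) = (μ.map g).prod (μ.map fun ω => ω i) := by
  obtain ⟨ω₀⟩ : Nonempty (∀ i, S i) := nonempty_of_isProbabilityMeasure μ
  have hind := hμ.indepFun_finset s {i} (by simpa using hi) (fun i => measurable_pi_apply i)
  -- `g` factors through the coordinates in `s`: the missing ones may be filled from a fixed point
  -- `ω₀`, since `g` ignores them.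
  let ext : (∀ k : s, S k) → ∀ i, S i := fun a k => if h : k ∈ s then a ⟨k, h⟩ else ω₀ k
  have hext : Measurable ext := by
    refine measurable_pi_lambda _ fun k => ?_
    by_cases h : k ∈ s
    · simpa [ext, h] using measurable_pi_apply _
    · simp [ext, h]
  have hgext : g = fun ω => g (ext fun k => ω k) := by
    funext ω
    refine hdep _ _ fun k hk => ?_
    simp [ext, hk]
  have := hind.comp (φ := g ∘ ext) (ψ := fun a : ∀ k : ({i} : Finset ι), S k => a ⟨i, by simp⟩)
    (hg.comp hext)
    (measurable_pi_apply (X := fun k : ({i} : Finset ι) => S k) ⟨i, by simp⟩)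
  have h2 : IndepFun g (fun ω : ∀ i, S i => ω i) μ := by
    rw [hgext]
    exact this
  exact (indepFun_iff_map_prod_eq_prod_map_map hg.aemeasurable
    (measurable_pi_apply i).aemeasurable).1 h2

/-- Used with `g` the message history before round `t`: it is independent of the seeds of round `t`,
which is the product form required by `HolderDom.comp`. -/
lemma infinitePi_map_prodMk_eval {S : Type*} [MeasurableSpace S] (κ : ℕ → Measure S)
    [∀ t, IsProbabilityMeasure (κ t)] (t : ℕ) {X : Type*} [MeasurableSpace X] {g : (ℕ → S) → X}
    (hg : Measurable g) (hdep : ∀ ρ ρ', (∀ k < t, ρ k = ρ' k) → g ρ = g ρ') :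
    (Measure.infinitePi κ).map (fun ρ => (g ρ, ρ t))
      = ((Measure.infinitePi κ).map g).prod (κ t) := by
  rw [map_prodMk_eval (s := Finset.range t) (i := t)
    (iIndepFun_infinitePi (X := fun _ ω => ω) fun _ => measurable_id) (by simp) hg
    (fun ω ω' h => hdep _ _ fun k hk => h k (by simpa using hk)), Measure.infinitePi_map_eval]

/-- Used twice within a round: to separate one sample from the rest of the minibatch, and one client
from the other clients. -/
lemma pi_map_prodMk_eval {ι : Type*} [Fintype ι] [DecidableEq ι] {S : Type*} [MeasurableSpace S]
    (κ : ι → Measure S) [∀ t, IsProbabilityMeasure (κ t)] (i : ι) {X : Type*} [MeasurableSpace X]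
    {g : (ι → S) → X} (hg : Measurable g)
    (hdep : ∀ ρ ρ', (∀ k, k ≠ i → ρ k = ρ' k) → g ρ = g ρ') :
    (Measure.pi κ).map (fun ρ => (g ρ, ρ i)) = ((Measure.pi κ).map g).prod (κ i) := by
  rw [map_prodMk_eval (s := Finset.univ.erase i) (i := i)
    (iIndepFun_pi (X := fun _ ω => ω) fun _ => aemeasurable_id) (by simp) hg
    (fun ω ω' h => hdep _ _ fun k hk => h k (by simpa using hk)),
    (measurePreserving_eval κ i).map_eq]

end Independence

/-! ### Rényi divergence in dual form: post-processing, composition, conversion. -/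

section HolderDom

open scoped ENNReal

/-- The dual form of a bound on a Rényi divergence of `μ` from `ν`: for conjugate exponents `p`
and `q` it says that `‖dμ/dν‖_{L^q(ν)} ≤ R`. -/
def HolderDom {X : Type*} [MeasurableSpace X] (p : ℝ) (R : ℝ≥0∞) (μ ν : Measure X) : Prop :=
  ∀ f : X → ℝ≥0∞, Measurable f → ∫⁻ x, f x ∂μ ≤ R * (∫⁻ x, f x ^ p ∂ν) ^ (1 / p)

variable {X Y W : Type*} [MeasurableSpace X] [MeasurableSpace Y] [MeasurableSpace W]

/-- Data processing: a test function on the target is pulled back to the source. -/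
lemma HolderDom.map {p : ℝ} {R : ℝ≥0∞} {μ ν : Measure X} (h : HolderDom p R μ ν) {g : X → Y}
    (hg : Measurable g) : HolderDom p R (μ.map g) (ν.map g) := by
  intro f hf
  rw [lintegral_map hf hg, lintegral_map (hf.pow_const p) hg]
  exact h _ (hf.comp hg)

/-- Hölder's inequality against the constant function `1`. It serves for the stages that do not
depend on the changed entry, which cost the factor `1`. -/
lemma HolderDom.refl {p : ℝ} (hp : 1 < p) (μ : Measure X) [IsProbabilityMeasure μ] :
    HolderDom p 1 μ μ := by
  intro f hf
  have := ENNReal.lintegral_mul_le_Lp_mul_Lq μ (Real.HolderConjugate.conjExponent hp)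
    hf.aemeasurable (aemeasurable_const (b := (1 : ℝ≥0∞)))
  simpa using this

/-- Adaptive composition. -/
lemma HolderDom.comp {p : ℝ} (hp : 0 < p) {R₁ R₂ : ℝ≥0∞} {μ ν : Measure X} {κ : Measure Y}
    [SFinite κ] (h : HolderDom p R₁ μ ν) {φ ψ : X → Y → W}
    (hφ : Measurable (Function.uncurry φ)) (hψ : Measurable (Function.uncurry ψ))
    (h2 : ∀ x, HolderDom p R₂ (κ.map (φ x)) (κ.map (ψ x))) :
    HolderDom p (R₁ * R₂) ((μ.prod κ).map (Function.uncurry φ))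
      ((ν.prod κ).map (Function.uncurry ψ)) := by
  intro f hf
  have hfp := hf.pow_const p
  rw [lintegral_map hf hφ, lintegral_map hfp hψ,
    lintegral_prod (fun z => f (Function.uncurry φ z)) (hf.comp hφ).aemeasurable,
    lintegral_prod (fun z => f (Function.uncurry ψ z) ^ p) (hfp.comp hψ).aemeasurable]
  simp only [Function.uncurry_apply_pair]
  have hin : ∀ x, ∫⁻ y, f (φ x y) ∂κ ≤ R₂ * (∫⁻ y, f (ψ x y) ^ p ∂κ) ^ (1 / p) := by
    intro x
    have := h2 x f hf
    rwa [lintegral_map hf hφ.of_uncurry_left, lintegral_map hfp hψ.of_uncurry_left] at this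
  have hm : Measurable fun x => ∫⁻ y, f (ψ x y) ^ p ∂κ :=
    Measurable.lintegral_prod_right (hfp.comp hψ)
  calc ∫⁻ x, ∫⁻ y, f (φ x y) ∂κ ∂μ
      ≤ ∫⁻ x, R₂ * (∫⁻ y, f (ψ x y) ^ p ∂κ) ^ (1 / p) ∂μ := lintegral_mono hin
    _ = R₂ * ∫⁻ x, (∫⁻ y, f (ψ x y) ^ p ∂κ) ^ (1 / p) ∂μ :=
        lintegral_const_mul _ (hm.pow_const _)
    -- The outer bound is applied to the inner `L^p` norm as a function of `x`; its `p`-th power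
    -- undoes the inner root, so the two integrals merge.
    _ ≤ R₂ * (R₁ * (∫⁻ x, ((∫⁻ y, f (ψ x y) ^ p ∂κ) ^ (1 / p)) ^ p ∂ν) ^ (1 / p)) := by
        gcongr
        exact h _ (hm.pow_const _)
    _ = _ := by
        rw [mul_comm R₁ R₂, mul_assoc]
        congr 4
        funext x
        rw [← ENNReal.rpow_mul, one_div_mul_cancel hp.ne', ENNReal.rpow_one]

/-- The conversion to approximate differential privacy. -/
lemma HolderDom.le_add {α B ε δ : ℝ} (hα : 1 < α) (hδ : 0 ≤ δ)
    {μ ν : Measure X} [IsProbabilityMeasure μ] [IsProbabilityMeasure ν]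
    (h : HolderDom (α / (α - 1)) (ENNReal.ofReal (Real.exp (B / α))) μ ν)
    (hB : Real.exp (B - ε * (α - 1)) ≤ δ) {S : Set X} (hS : MeasurableSet S) :
    μ S ≤ ENNReal.ofReal (Real.exp ε) * ν S + ENNReal.ofReal δ := by
  have hα1 : 0 < α - 1 := by linarith
  -- An indicator equals its own powers, so this test gives `μ S ≤ e^(B/α) (ν S)^(1-1/α)`.
  have h0 := h (S.indicator 1) (measurable_one.indicator hS)
  have e1 : ∀ x, (S.indicator (1 : X → ℝ≥0∞) x) ^ (α / (α - 1)) = S.indicator 1 x := by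
    intro x
    by_cases hx : x ∈ S
    · simp [hx]
    · have : 0 < α / (α - 1) := by positivity
      simp [hx, this]
  simp only [e1] at h0
  rw [lintegral_indicator_one hS, lintegral_indicator_one hS] at h0
  have hμ : μ S = ENNReal.ofReal (μ.real S) := by simp
  have hν : ν S = ENNReal.ofReal (ν.real S) := by simp
  set a := μ.real S with ha
  set b := ν.real S with hb
  have ha0 : 0 ≤ a := measureReal_nonneg
  have hb0 : 0 ≤ b := measureReal_nonneg
  have hexp : 0 < 1 / (α / (α - 1)) := by positivity
  rw [hμ, hν, ENNReal.ofReal_rpow_of_nonneg hb0 hexp.le, ← ENNReal.ofReal_mul (by positivity),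
    ENNReal.ofReal_le_ofReal_iff (by positivity)] at h0
  rw [hμ, hν, ← ENNReal.ofReal_mul (by positivity), ← ENNReal.ofReal_add (by positivity) hδ]
  refine ENNReal.ofReal_le_ofReal ?_
  -- Otherwise `ν S ≤ e^(-ε) μ S`; inserted above, this is an inequality for `μ S` alone, which
  -- solves to `μ S ≤ e^(B - ε(α-1)) ≤ δ`.
  by_cases hc : a ≤ Real.exp ε * b
  · linarith
  push Not at hc
  have ha' : 0 < a := lt_of_le_of_lt (by positivity) hc
  have hb' : b ≤ Real.exp (-ε) * a := by
    rw [Real.exp_neg]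
    rw [le_inv_mul_iff₀ (Real.exp_pos _)]
    exact hc.le
  have h3 : a ≤ Real.exp (B / α) * (Real.exp (-ε) * a) ^ (1 / (α / (α - 1))) :=
    h0.trans (by gcongr)
  have e2 : (1 / (α / (α - 1))) = 1 - 1 / α := by
    field_simp
  rw [e2] at h3
  have h4 : a ^ (1 / α) ≤ Real.exp (B / α - ε * (1 - 1 / α)) := by
    rw [Real.mul_rpow (Real.exp_pos _).le ha0, ← Real.exp_mul, ← mul_assoc, ← Real.exp_add,
      Real.rpow_sub ha', Real.rpow_one] at h3
    have hp : 0 < a ^ (1 / α) := Real.rpow_pos_of_pos ha' _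
    rw [mul_div_assoc', le_div_iff₀ hp, mul_comm a, mul_le_mul_iff_left₀ ha'] at h3
    rw [sub_eq_add_neg, ← neg_mul]
    exact h3
  have h5 : a ≤ Real.exp (B - ε * (α - 1)) := by
    have := Real.rpow_le_rpow (by positivity) h4 (by linarith : (0 : ℝ) ≤ α)
    rw [← Real.rpow_mul ha0, ← Real.exp_mul, one_div_mul_cancel (by positivity),
      Real.rpow_one] at this
    convert this using 2
    field_simp
  have : 0 ≤ Real.exp ε * b := by positivity
  linarith

end HolderDom

end SoteriaFL

namespace SoteriaFL

/-! ### Second-order bounds for real powers. -/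

section PowerBounds

/-- Convexity: the tangent of the `p`-th power at `w`, evaluated at `1`, lies below the graph. It is
Bernoulli's inequality for `w⁻¹` multiplied by `w ^ p`. -/
lemma rpow_le_add_mul_rpow_sub_one {w p : ℝ} (hw : 0 < w) (hp : 1 ≤ p) :
    w ^ p ≤ 1 + p * w ^ (p - 1) * (w - 1) := by
  have h := one_add_mul_self_le_rpow_one_add (s := w⁻¹ - 1) (by linarith [inv_pos.2 hw]) hp
  rw [add_sub_cancel, Real.inv_rpow hw.le] at h
  have hwp : 0 < w ^ p := Real.rpow_pos_of_pos hw p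
  have h2 := mul_le_mul_of_nonneg_left h hwp.le
  rw [mul_inv_cancel₀ hwp.ne'] at h2
  have e : w ^ p = w ^ (p - 1) * w := by rw [Real.rpow_sub_one hw.ne']; field_simp
  have e2 : w ^ p * w⁻¹ = w ^ (p - 1) := by rw [Real.rpow_sub_one hw.ne']; rfl
  have h3 : w ^ p * (1 + p * (w⁻¹ - 1)) = w ^ p + p * (w ^ p * w⁻¹) - p * w ^ p := by ring
  rw [h3, e2] at h2
  nlinarith

/-- Second order Taylor bound for real powers. -/
lemma rpow_le_taylor {w p : ℝ} (hw : 0 < w) (hp : 2 ≤ p) :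
    w ^ p ≤ 1 + p * (w - 1) + p ^ 2 * ((w - 1) ^ 2 + (w - 1) ^ 2 * w ^ (p - 2)) := by
  have h1 := rpow_le_add_mul_rpow_sub_one hw (by linarith : 1 ≤ p)
  have hz : 0 < w ^ (p - 2) := Real.rpow_pos_of_pos hw _
  have h2 : (w - 1) * (w ^ (p - 1) - 1) ≤ (p - 1) * ((w - 1) ^ 2 + (w - 1) ^ 2 * w ^ (p - 2)) := by
    have hnn : 0 ≤ (p - 1) * ((w - 1) ^ 2 * w ^ (p - 2)) :=
      mul_nonneg (by linarith) (by positivity)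
    have hnn' : 0 ≤ (p - 1) * (w - 1) ^ 2 := mul_nonneg (by linarith) (by positivity)
    -- For `w ≥ 1` the increment of the power is controlled by its slope at `w`, which gives the
    -- weight `w ^ (p - 2)`; for `w ≤ 1` by the slope at `1`, which gives the weight `1`.
    rcases le_total 1 w with hw1 | hw1
    · have h3 := rpow_le_add_mul_rpow_sub_one hw (by linarith : 1 ≤ p - 1)
      rw [show p - 1 - 1 = p - 2 by ring] at h3
      have := mul_le_mul_of_nonneg_left (sub_le_iff_le_add'.2 h3) (sub_nonneg.2 hw1)
      nlinarith
    · have h3 := one_add_mul_self_le_rpow_one_add (s := w - 1) (by linarith)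
        (by linarith : 1 ≤ p - 1)
      rw [add_sub_cancel] at h3
      have := mul_le_mul_of_nonneg_left (sub_nonneg.2 h3) (sub_nonneg.2 hw1)
      nlinarith
  have h3 : p * ((w - 1) * (w ^ (p - 1) - 1))
      ≤ p * ((p - 1) * ((w - 1) ^ 2 + (w - 1) ^ 2 * w ^ (p - 2))) :=
    mul_le_mul_of_nonneg_left h2 (by linarith)
  have h4 : 0 ≤ p * ((w - 1) ^ 2 + (w - 1) ^ 2 * w ^ (p - 2)) :=
    mul_nonneg (by linarith) (by positivity)
  nlinarith

/-- The bound for positive powers at `w⁻¹`. The linear term becomes `w⁻¹ - 1 = -(w - 1) + (w - 1)²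
w⁻¹`, which accounts for the extra weight `w⁻¹`. -/
lemma rpow_neg_le_taylor {w p : ℝ} (hw : 0 < w) (hp : 2 ≤ p) :
    w ^ (-p) ≤ 1 - p * (w - 1) + p ^ 2 * ((w - 1) ^ 2 * w ^ (-1 : ℝ)
      + (w - 1) ^ 2 * w ^ (-2 : ℝ) + (w - 1) ^ 2 * w ^ (-p)) := by
  have h := rpow_le_taylor (inv_pos.2 hw) hp
  have e : (w⁻¹ - 1) ^ 2 * w⁻¹ ^ (p - 2) = (w - 1) ^ 2 * w ^ (-p) := by
    rw [Real.inv_rpow hw.le, ← Real.rpow_neg hw.le, show -(p - 2) = -p + 2 by ring,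
      Real.rpow_add hw, Real.rpow_two]
    field_simp
    ring
  have e2 : w ^ (-2 : ℝ) = w⁻¹ ^ 2 := by
    rw [Real.rpow_neg hw.le, Real.rpow_two, inv_pow]
  have e3 : (w⁻¹ - 1) ^ 2 = (w - 1) ^ 2 * w⁻¹ ^ 2 := by
    field_simp
    ring
  have e4 : w⁻¹ - 1 = -(w - 1) + (w - 1) ^ 2 * w⁻¹ := by
    field_simp
    ring
  rw [Real.inv_rpow hw.le, ← Real.rpow_neg hw.le, e, e3, e4] at h
  rw [e2, Real.rpow_neg_one]
  have : p * ((w - 1) ^ 2 * w⁻¹) ≤ p ^ 2 * ((w - 1) ^ 2 * w⁻¹) := by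
    have : 0 ≤ (w - 1) ^ 2 * w⁻¹ := by positivity
    gcongr
    nlinarith
  nlinarith

end PowerBounds

/-! ### Pointwise bounds for the density of a two-component mixture. -/

section Mixture

/-- The density of the mixture `(1-q) P + q P'`, where `dP'/dP = e^y`. -/
noncomputable def mixDensity (q y : ℝ) : ℝ := 1 - q + q * Real.exp y

lemma mixDensity_pos {q y : ℝ} (hq : 0 ≤ q) (hq1 : q ≤ 1) : 0 < mixDensity q y := by
  unfold mixDensity
  rcases hq.eq_or_lt with rfl | h
  · simp
  · have := mul_pos h (Real.exp_pos y)
    linarith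

/-- Convexity of the exponential between `0` and `y`. -/
lemma exp_mul_le_mixDensity {q y : ℝ} (hq : 0 ≤ q) (hq1 : q ≤ 1) :
    Real.exp (q * y) ≤ mixDensity q y := by
  have := convexOn_exp.2 (Set.mem_univ 0) (Set.mem_univ y) (sub_nonneg.2 hq1) hq (by ring)
  simpa [mixDensity] using this

/-- The linear term has coefficient exactly one and no constant beside it, so it disappears when
averaged over a centered variable. -/
lemma exp_le_add_exp_sq (t : ℝ) : Real.exp t ≤ t + Real.exp (t ^ 2) := by
  rcases le_or_gt |t| 1 with h | h
  · have h2 : Real.exp t ≤ 1 + t + t ^ 2 := by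
      have := Real.norm_exp_sub_one_sub_id_le (x := t) (by simpa using h)
      rw [Real.norm_eq_abs, Real.norm_eq_abs, sq_abs] at this
      linarith [(abs_le.1 this).2]
    linarith [Real.add_one_le_exp (t ^ 2)]
  · rcases le_total 0 t with h0 | h0
    · rw [abs_of_nonneg h0] at h
      have : Real.exp t ≤ Real.exp (t ^ 2) := Real.exp_le_exp.2 (by nlinarith)
      linarith
    · rw [abs_of_nonpos h0] at h
      have h1 : Real.exp t ≤ 1 := Real.exp_le_one_iff.2 h0
      have := Real.add_one_le_exp (t ^ 2)
      nlinarith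

/-- After extracting `exp (q * y)`, the remaining factor is the exponential moment of a centered
variable taking the values `-q y` and `(1 - q) y`; the linear terms of `exp_le_add_exp_sq` cancel.
-/
lemma mixDensity_le_exp {q y : ℝ} (hq : 0 ≤ q) (hq1 : q ≤ 1) :
    mixDensity q y ≤ Real.exp (q * y + y ^ 2) := by
  have h1 := exp_le_add_exp_sq (-(q * y))
  have h2 := exp_le_add_exp_sq ((1 - q) * y)
  have h3 : Real.exp ((-(q * y)) ^ 2) ≤ Real.exp (y ^ 2) := by
    apply Real.exp_le_exp.2
    have : q ^ 2 ≤ 1 := by nlinarith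
    nlinarith [sq_nonneg y]
  have h4 : Real.exp (((1 - q) * y) ^ 2) ≤ Real.exp (y ^ 2) := by
    apply Real.exp_le_exp.2
    have : (1 - q) ^ 2 ≤ 1 := by nlinarith
    nlinarith [sq_nonneg y]
  have h5 : mixDensity q y
      = Real.exp (q * y) * ((1 - q) * Real.exp (-(q * y)) + q * Real.exp ((1 - q) * y)) := by
    rw [mul_add, mul_left_comm, ← Real.exp_add, mul_left_comm, ← Real.exp_add, mixDensity,
      show q * y + -(q * y) = 0 by ring, show q * y + (1 - q) * y = y by ring]
    simp
  rw [h5, Real.exp_add]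
  gcongr
  have h6 := mul_le_mul_of_nonneg_left (h1.trans (add_le_add_right h3 _)) (sub_nonneg.2 hq1)
  have h7 := mul_le_mul_of_nonneg_left (h2.trans (add_le_add_right h4 _)) hq
  nlinarith

/-- Powers of the density of a mixture, uniformly in the exponent. -/
lemma mixDensity_rpow_le {q y s k : ℝ} (hq : 0 ≤ q) (hq1 : q ≤ 1) (hs : |s| ≤ k) :
    mixDensity q y ^ s ≤ Real.exp (k * (q * |y| + y ^ 2)) := by
  have hw := mixDensity_pos (y := y) hq hq1
  rw [Real.rpow_def_of_pos hw]
  apply Real.exp_le_exp.2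
  have h1 : q * y ≤ Real.log (mixDensity q y) :=
    (Real.le_log_iff_exp_le hw).2 (exp_mul_le_mixDensity hq hq1)
  have h2 : Real.log (mixDensity q y) ≤ q * y + y ^ 2 :=
    (Real.log_le_iff_le_exp hw).2 (mixDensity_le_exp hq hq1)
  have h3 : |Real.log (mixDensity q y)| ≤ q * |y| + y ^ 2 := by
    have h4 : q * y ≤ q * |y| := mul_le_mul_of_nonneg_left (le_abs_self y) hq
    have h5 : q * -|y| ≤ q * y := mul_le_mul_of_nonneg_left (neg_abs_le y) hq
    rw [abs_le]
    constructor <;> nlinarith [sq_nonneg y]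
  calc Real.log (mixDensity q y) * s ≤ |Real.log (mixDensity q y) * s| := le_abs_self _
    _ = |s| * |Real.log (mixDensity q y)| := by rw [abs_mul, mul_comm]
    _ ≤ k * (q * |y| + y ^ 2) := by gcongr; exact (abs_nonneg s).trans hs

lemma sq_exp_sub_one_le (y : ℝ) : (Real.exp y - 1) ^ 2 ≤ y ^ 2 * Real.exp (2 * |y|) := by
  have h : |Real.exp y - 1| ≤ |y| * Real.exp |y| := by
    rcases le_total 0 y with h | h
    · rw [abs_of_nonneg h, abs_of_nonneg (by linarith [Real.one_le_exp h])]
      have := Real.add_one_le_exp (-y)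
      have h2 := mul_le_mul_of_nonneg_left this (Real.exp_pos y).le
      rw [← Real.exp_add, add_neg_cancel, Real.exp_zero] at h2
      nlinarith
    · rw [abs_of_nonpos h, abs_of_nonpos (by linarith [Real.exp_le_one_iff.2 h])]
      have := Real.add_one_le_exp y
      have h2 := Real.one_le_exp (neg_nonneg.2 h)
      nlinarith
  calc (Real.exp y - 1) ^ 2 = |Real.exp y - 1| ^ 2 := (sq_abs _).symm
    _ ≤ (|y| * Real.exp |y|) ^ 2 := by gcongr
    _ = _ := by rw [mul_pow, sq_abs, ← Real.exp_nat_mul]; norm_num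

/-- The square supplies `q² r²`. In the power, the part of the exponent linear in `x` is of size `k
q r |x|`, and completing the square turns it into `2 (k q r)² + x²/8`; `k r² ≤ 1/64` keeps the
quadratic part small. What remains fits in `exp (x²/4)`, which is integrable under the standard
Gaussian. -/
lemma sq_mixDensity_sub_one_mul_rpow_le {q r k s x : ℝ} (hq : 0 ≤ q) (hq1 : q ≤ 1) (hr : 0 ≤ r)
    (hk : 2 ≤ k) (hkr : k * r ^ 2 ≤ 1 / 64) (hs : |s| ≤ k) :
    (mixDensity q (r * x - r ^ 2 / 2) - 1) ^ 2 * mixDensity q (r * x - r ^ 2 / 2) ^ s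
      ≤ 32 * Real.exp 2 * (q ^ 2 * r ^ 2) * Real.exp (2 * (k * q * r) ^ 2)
        * Real.exp (x ^ 2 / 4) := by
  set y := r * x - r ^ 2 / 2 with hy
  have hr2 : r ^ 2 ≤ 1 / 128 := by nlinarith [sq_nonneg r]
  have hy2 : y ^ 2 ≤ r ^ 2 * (2 * x ^ 2 + 1 / 2) := by
    have : y ^ 2 ≤ 2 * (r * x) ^ 2 + 2 * (r ^ 2 / 2) ^ 2 := by
      rw [hy]
      nlinarith [sq_nonneg (r * x + r ^ 2 / 2)]
    nlinarith [sq_nonneg r]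
  have hya : |y| ≤ r * |x| + r ^ 2 / 2 := by
    calc |y| ≤ |r * x| + |r ^ 2 / 2| := abs_sub _ _
      _ = _ := by rw [abs_mul, abs_of_nonneg hr,
          abs_of_nonneg (by positivity : 0 ≤ r ^ 2 / 2)]
  have h1 : (mixDensity q y - 1) ^ 2 ≤ q ^ 2 * (y ^ 2 * Real.exp (2 * |y|)) := by
    have : (mixDensity q y - 1) ^ 2 = q ^ 2 * (Real.exp y - 1) ^ 2 := by unfold mixDensity; ring
    rw [this]
    gcongr
    exact sq_exp_sub_one_le y
  have h2 := mixDensity_rpow_le (y := y) hq hq1 hs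
  -- The polynomial factor is traded for `exp (x²/16)`; of the total `x²/4` this leaves `3x²/16` for
  -- the exponent in the next bound.
  have h3 : y ^ 2 ≤ r ^ 2 * (32 * Real.exp (x ^ 2 / 16)) := by
    refine hy2.trans ?_
    gcongr
    linarith [Real.add_one_le_exp (x ^ 2 / 16)]
  have h4 : 2 * |y| + k * (q * |y| + y ^ 2) ≤ 2 + 2 * (k * q * r) ^ 2 + 3 * x ^ 2 / 16 := by
    have a1 : 2 * |y| ≤ 1 + y ^ 2 := by nlinarith [sq_nonneg (|y| - 1), sq_abs y]
    have a2 : k * q * |y| ≤ k * q * r * |x| + 1 / 64 := by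
      have : k * q * |y| ≤ k * q * (r * |x| + r ^ 2 / 2) := by gcongr
      have h' : q * (k * r ^ 2) ≤ 1 * (1 / 64) := by gcongr
      nlinarith
    have a3 : k * q * r * |x| ≤ 2 * (k * q * r) ^ 2 + x ^ 2 / 8 := by
      nlinarith [sq_nonneg (4 * (k * q * r) - |x|), sq_abs x]
    have a4 : y ^ 2 ≤ (k / 2) * y ^ 2 := by nlinarith [sq_nonneg y]
    have a5 : k * y ^ 2 ≤ 1 / 64 * (2 * x ^ 2 + 1 / 2) := by
      calc k * y ^ 2 ≤ k * (r ^ 2 * (2 * x ^ 2 + 1 / 2)) := by gcongr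
        _ = (k * r ^ 2) * (2 * x ^ 2 + 1 / 2) := by ring
        _ ≤ _ := by gcongr
    nlinarith [sq_nonneg x]
  calc (mixDensity q y - 1) ^ 2 * mixDensity q y ^ s
      ≤ (q ^ 2 * (y ^ 2 * Real.exp (2 * |y|))) * Real.exp (k * (q * |y| + y ^ 2)) := by
        gcongr
        exact Real.rpow_nonneg (mixDensity_pos hq hq1).le _
    _ = q ^ 2 * y ^ 2 * Real.exp (2 * |y| + k * (q * |y| + y ^ 2)) := by
        rw [Real.exp_add]; ring
    _ ≤ q ^ 2 * (r ^ 2 * (32 * Real.exp (x ^ 2 / 16)))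
          * Real.exp (2 + 2 * (k * q * r) ^ 2 + 3 * x ^ 2 / 16) := by gcongr
    _ = _ := by
        rw [show x ^ 2 / 4 = x ^ 2 / 16 + 3 * x ^ 2 / 16 by ring, Real.exp_add, Real.exp_add,
          Real.exp_add]
        ring

end Mixture

/-! ### Moments of the likelihood ratio in dimension one. -/

section GaussianMoments

lemma integrable_exp_sq_div_four :
    Integrable (fun x : ℝ => Real.exp (x ^ 2 / 4)) (gaussianReal 0 1) := by
  rw [gaussianReal_of_var_ne_zero 0 one_ne_zero,
    integrable_withDensity_iff (measurable_gaussianPDF 0 1)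
      (Filter.Eventually.of_forall fun x => gaussianPDF_lt_top)]
  simp only [toReal_gaussianPDF, gaussianPDFReal]
  have := (integrable_exp_neg_mul_sq (b := 1 / 4) (by norm_num)).const_mul ((√(2 * Real.pi * 1))⁻¹)
  refine this.congr (Filter.Eventually.of_forall fun x => ?_)
  simp only [NNReal.coe_one]
  rw [mul_left_comm, ← Real.exp_add]
  congr 2
  ring

/-- The likelihood ratio of a translate has mean one; this removes the first-order term of the
moments. -/
lemma integral_exp_gaussianReal (r : ℝ) :
    ∫ x, Real.exp (r * x - r ^ 2 / 2) ∂(gaussianReal 0 1) = 1 := by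
  have h := mgf_gaussianReal (p := gaussianReal 0 1) (X := id) Measure.map_id r
  simp only [mgf, id, zero_mul, NNReal.coe_one, one_mul, zero_add] at h
  simp only [sub_eq_add_neg, Real.exp_add]
  rw [integral_mul_const, h, ← Real.exp_add]
  simp

lemma integrable_exp_gaussianReal (r : ℝ) :
    Integrable (fun x => Real.exp (r * x - r ^ 2 / 2)) (gaussianReal 0 1) :=
  Integrable.of_integral_ne_zero (by rw [integral_exp_gaussianReal]; exact one_ne_zero)

/-- The constant in the moment bounds for Gaussian mixtures. -/
noncomputable def momentConst : ℝ :=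
  96 * Real.exp 2 * ∫ x : ℝ, Real.exp (x ^ 2 / 4) ∂(gaussianReal 0 1) + 2

lemma momentConst_pos : 0 < momentConst := by
  have : 0 ≤ ∫ x : ℝ, Real.exp (x ^ 2 / 4) ∂(gaussianReal 0 1) :=
    integral_nonneg fun x => (Real.exp_pos _).le
  unfold momentConst
  positivity

/-- The linear term integrates to zero for every coefficient `j`, because the mixture has mass one.
The factor `3` leaves room for the three second-order terms of the negative powers; the positive
powers have two. -/
lemma lintegral_le_of_taylor {q r k j : ℝ} (g : ℝ → ℝ) (hg : Measurable g)
    (hg0 : ∀ x, 0 ≤ g x)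
    (h : ∀ x, g x ≤ 1 + j * (mixDensity q (r * x - r ^ 2 / 2) - 1) + k ^ 2 * (3 *
      (32 * Real.exp 2 * (q ^ 2 * r ^ 2) * Real.exp (2 * (k * q * r) ^ 2)
        * Real.exp (x ^ 2 / 4)))) :
    ∫⁻ x, ENNReal.ofReal (g x) ∂(gaussianReal 0 1)
      ≤ ENNReal.ofReal (Real.exp (momentConst * (k * q * r) ^ 2)) := by
  have i1 : Integrable (fun x => mixDensity q (r * x - r ^ 2 / 2) - 1) (gaussianReal 0 1) := by
    unfold mixDensity
    exact ((integrable_const _).add ((integrable_exp_gaussianReal r).const_mul q)).sub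
      (integrable_const _)
  have e1 : ∫ x, (mixDensity q (r * x - r ^ 2 / 2) - 1) ∂(gaussianReal 0 1) = 0 := by
    have : ∀ x, mixDensity q (r * x - r ^ 2 / 2) - 1
        = q * Real.exp (r * x - r ^ 2 / 2) - q := fun x => by unfold mixDensity; ring
    simp only [this]
    rw [integral_sub ((integrable_exp_gaussianReal r).const_mul q) (integrable_const _),
      integral_const_mul, integral_exp_gaussianReal]
    simp
  have i2 : Integrable (fun x : ℝ => k ^ 2 * (3 *
      (32 * Real.exp 2 * (q ^ 2 * r ^ 2) * Real.exp (2 * (k * q * r) ^ 2)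
        * Real.exp (x ^ 2 / 4)))) (gaussianReal 0 1) :=
    ((integrable_exp_sq_div_four.const_mul _).const_mul _).const_mul _
  have i12 : Integrable (fun x => 1 + j * (mixDensity q (r * x - r ^ 2 / 2) - 1))
      (gaussianReal 0 1) := (integrable_const (1 : ℝ)).add (i1.const_mul j)
  have i3 := i12.add i2
  have ig : Integrable g (gaussianReal 0 1) := by
    refine i3.mono' hg.aestronglyMeasurable (Filter.Eventually.of_forall fun x => ?_)
    rw [Real.norm_of_nonneg (hg0 x)]
    exact h x
  rw [← ofReal_integral_eq_lintegral_ofReal ig (Filter.Eventually.of_forall hg0)]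
  refine ENNReal.ofReal_le_ofReal ((integral_mono ig i3 h).trans ?_)
  rw [integral_add' i12 i2, integral_add (integrable_const (1 : ℝ)) (i1.const_mul j),
    integral_const_mul, e1, integral_const_mul, integral_const_mul, integral_const_mul]
  set M := ∫ x : ℝ, Real.exp (x ^ 2 / 4) ∂(gaussianReal 0 1) with hM
  have hM0 : 0 ≤ M := integral_nonneg fun x => (Real.exp_pos _).le
  set t := (k * q * r) ^ 2 with ht
  have ht0 : 0 ≤ t := sq_nonneg _
  have e3 : k ^ 2 * (3 * (32 * Real.exp 2 * (q ^ 2 * r ^ 2) * Real.exp (2 * t) * M))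
      = 96 * Real.exp 2 * M * t * Real.exp (2 * t) := by rw [ht]; ring
  rw [e3]
  simp only [integral_const, probReal_univ, smul_eq_mul, mul_one, mul_zero, add_zero]
  -- With `t = (k q r)²` the factor `exp (2 t)` is pulled out in front; it is the summand `2` of
  -- `momentConst`.
  calc 1 + 96 * Real.exp 2 * M * t * Real.exp (2 * t)
      ≤ Real.exp (2 * t) * (96 * Real.exp 2 * M * t + 1) := by
        have : 1 ≤ Real.exp (2 * t) := Real.one_le_exp (by positivity)
        nlinarith
    _ ≤ Real.exp (2 * t) * Real.exp (96 * Real.exp 2 * M * t) := by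
        gcongr
        exact Real.add_one_le_exp _
    _ = Real.exp (momentConst * t) := by
        rw [← Real.exp_add, momentConst]
        congr 1
        ring

lemma measurable_mixDensity_rpow (q r s : ℝ) :
    Measurable fun x : ℝ => mixDensity q (r * x - r ^ 2 / 2) ^ s := by
  unfold mixDensity
  fun_prop

/-- Positive moments of the likelihood ratio of a Gaussian mixture. -/
lemma lintegral_mixDensity_rpow_le {q r k : ℝ} (hq : 0 ≤ q) (hq1 : q ≤ 1) (hr : 0 ≤ r)
    (hk : 2 ≤ k) (hkr : k * r ^ 2 ≤ 1 / 64) :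
    ∫⁻ x, ENNReal.ofReal (mixDensity q (r * x - r ^ 2 / 2) ^ k) ∂(gaussianReal 0 1)
      ≤ ENNReal.ofReal (Real.exp (momentConst * (k * q * r) ^ 2)) := by
  refine lintegral_le_of_taylor (j := k) _ (measurable_mixDensity_rpow q r k)
    (fun x => Real.rpow_nonneg (mixDensity_pos hq hq1).le _) fun x => ?_
  refine (rpow_le_taylor (mixDensity_pos hq hq1) hk).trans ?_
  have h0 := sq_mixDensity_sub_one_mul_rpow_le (x := x) (s := 0) hq hq1 hr hk hkr
    (by rw [abs_zero]; linarith)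
  have h1 := sq_mixDensity_sub_one_mul_rpow_le (x := x) (s := k - 2) hq hq1 hr hk hkr
    (by rw [abs_of_nonneg] <;> linarith)
  rw [Real.rpow_zero, mul_one] at h0
  gcongr
  have := (sq_nonneg _).trans h0
  linarith

/-- Negative moments of the likelihood ratio of a Gaussian mixture. -/
lemma lintegral_mixDensity_rpow_neg_le {q r k j : ℝ} (hq : 0 ≤ q) (hq1 : q ≤ 1) (hr : 0 ≤ r)
    (hj : 2 ≤ j) (hjk : j ≤ k) (hkr : k * r ^ 2 ≤ 1 / 64) :
    ∫⁻ x, ENNReal.ofReal (mixDensity q (r * x - r ^ 2 / 2) ^ (-j)) ∂(gaussianReal 0 1)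
      ≤ ENNReal.ofReal (Real.exp (momentConst * (k * q * r) ^ 2)) := by
  -- The application has `j = 2(α - 1)` and `k = 2α`; stating the bound at `k` gives it the same
  -- form as the bound for the positive moment.
  have hk : 2 ≤ k := hj.trans hjk
  refine lintegral_le_of_taylor (j := -j) _ (measurable_mixDensity_rpow q r (-j))
    (fun x => Real.rpow_nonneg (mixDensity_pos hq hq1).le _) fun x => ?_
  refine (rpow_neg_le_taylor (mixDensity_pos hq hq1) hj).trans ?_
  have h0 := sq_mixDensity_sub_one_mul_rpow_le (x := x) (s := -1) hq hq1 hr hk hkr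
    (by norm_num; linarith)
  have h1 := sq_mixDensity_sub_one_mul_rpow_le (x := x) (s := -2) hq hq1 hr hk hkr
    (by norm_num; linarith)
  have h2 := sq_mixDensity_sub_one_mul_rpow_le (x := x) (s := -j) hq hq1 hr hk hkr
    (by rw [abs_neg, abs_of_nonneg] <;> linarith)
  set w := mixDensity q (r * x - r ^ 2 / 2) with hw
  have hw0 : 0 < w := mixDensity_pos hq hq1
  have hs : 0 ≤ (w - 1) ^ 2 * w ^ (-1 : ℝ) + (w - 1) ^ 2 * w ^ (-2 : ℝ)
      + (w - 1) ^ 2 * w ^ (-j) := by positivity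
  rw [neg_mul, ← sub_eq_add_neg]
  gcongr
  linarith

end GaussianMoments

end SoteriaFL

namespace SoteriaFL

/-! ### Translates of the standard Gaussian measure. -/

section CameronMartin

open scoped ENNReal

lemma lintegral_pi_prod {ι : Type*} [Fintype ι] {S : ι → Type*} [∀ i, MeasurableSpace (S i)]
    (μ : ∀ i, Measure (S i)) [∀ i, IsProbabilityMeasure (μ i)] {g : ∀ i, S i → ℝ≥0∞}
    (hg : ∀ i, Measurable (g i)) :
    ∫⁻ x, ∏ i, g i (x i) ∂(Measure.pi μ) = ∏ i, ∫⁻ x, g i x ∂(μ i) := by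
  rw [lintegral_prod_eq_prod_lintegral_of_indepFun Finset.univ
    (fun i (x : ∀ i, S i) => g i (x i))
    (iIndepFun_pi fun i => (hg i).aemeasurable)
    (fun i => (hg i).comp (measurable_pi_apply i))]
  refine Finset.prod_congr rfl fun i _ => ?_
  rw [← lintegral_map (hg i) (measurable_pi_apply i), (measurePreserving_eval μ i).map_eq]

/-- Both measures agree on boxes, where the indicator of the box times the product density is again
a product. -/
lemma pi_withDensity {ι : Type*} [Fintype ι] {S : ι → Type*} [∀ i, MeasurableSpace (S i)]
    (μ : ∀ i, Measure (S i)) [∀ i, IsProbabilityMeasure (μ i)] {g : ∀ i, S i → ℝ≥0∞}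
    (hg : ∀ i, Measurable (g i)) [∀ i, SigmaFinite ((μ i).withDensity (g i))] :
    Measure.pi (fun i => (μ i).withDensity (g i))
      = (Measure.pi μ).withDensity fun x => ∏ i, g i (x i) := by
  refine Measure.pi_eq fun s hs => ?_
  rw [withDensity_apply _ (MeasurableSet.univ_pi hs),
    ← lintegral_indicator (MeasurableSet.univ_pi hs)]
  have : ∀ x : ∀ i, S i, (Set.univ.pi s).indicator (fun x => ∏ i, g i (x i)) x
      = ∏ i, (s i).indicator (g i) (x i) := by
    intro x
    by_cases hx : x ∈ Set.univ.pi s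
    · rw [Set.indicator_of_mem hx]
      exact Finset.prod_congr rfl fun i _ => (Set.indicator_of_mem (hx i trivial) _).symm
    · rw [Set.indicator_of_notMem hx]
      simp only [Set.mem_pi, not_forall] at hx
      obtain ⟨i, _, hi⟩ := hx
      exact (Finset.prod_eq_zero (Finset.mem_univ i) (Set.indicator_of_notMem hi _)).symm
  simp only [this]
  rw [lintegral_pi_prod μ fun i => (hg i).indicator (hs i)]
  refine Finset.prod_congr rfl fun i _ => ?_
  rw [withDensity_apply _ (hs i), lintegral_indicator (hs i)]

lemma gaussianReal_map_add_eq_withDensity (a : ℝ) :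
    (gaussianReal 0 1).map (fun x => x + a)
      = (gaussianReal 0 1).withDensity fun x => ENNReal.ofReal (Real.exp (a * x - a ^ 2 / 2)) := by
  rw [gaussianReal_map_add_const, gaussianReal_of_var_ne_zero _ one_ne_zero,
    gaussianReal_of_var_ne_zero _ one_ne_zero,
    ← withDensity_mul _ (measurable_gaussianPDF _ _) (by fun_prop)]
  congr 1
  funext x
  simp only [gaussianPDF, Pi.mul_apply]
  rw [← ENNReal.ofReal_mul (gaussianPDFReal_nonneg _ _ _)]
  congr 1
  simp only [gaussianPDFReal, NNReal.coe_one]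
  rw [mul_assoc _ (Real.exp _), ← Real.exp_add]
  congr 2
  ring

/-- The Cameron-Martin formula for the standard Gaussian measure. -/
lemma lintegral_add_stdGaussian {d : ℕ} (a : Vec d) {F : Vec d → ℝ≥0∞} (hF : Measurable F) :
    ∫⁻ z, F (z + a) ∂(stdGaussian (Vec d))
      = ∫⁻ z, F z * ENNReal.ofReal (Real.exp (inner ℝ a z - ‖a‖ ^ 2 / 2))
          ∂(stdGaussian (Vec d)) := by
  have hto : Measurable (WithLp.toLp 2 : (Fin d → ℝ) → Vec d) := by fun_prop
  have hadd : Measurable fun (x : Fin d → ℝ) (i : Fin d) => x i + a i := by fun_prop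
  have hpi : (Measure.pi fun _ : Fin d => gaussianReal 0 1).map (fun x i => x i + a i)
      = (Measure.pi fun _ : Fin d => gaussianReal 0 1).withDensity
        fun x => ∏ i, ENNReal.ofReal (Real.exp (a i * x i - a i ^ 2 / 2)) := by
    have hp : ∀ i, IsProbabilityMeasure ((gaussianReal 0 1).map (fun x => x + a i)) := fun i =>
      Measure.isProbabilityMeasure_map (by fun_prop)
    rw [Measure.pi_map_pi (f := fun i x => x + a i) (fun i => by fun_prop)]
    have : ∀ i, IsProbabilityMeasure ((gaussianReal 0 1).withDensity
        fun x => ENNReal.ofReal (Real.exp (a i * x - a i ^ 2 / 2))) := fun i => by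
      rw [← gaussianReal_map_add_eq_withDensity]
      exact hp i
    simp only [gaussianReal_map_add_eq_withDensity]
    exact pi_withDensity _ fun i => by fun_prop
  rw [← map_pi_eq_stdGaussian, lintegral_map (by fun_prop) hto, lintegral_map (by fun_prop) hto]
  have h1 : ∀ x : Fin d → ℝ, WithLp.toLp 2 x + a = WithLp.toLp 2 fun i => x i + a i :=
    fun x => by ext i; simp
  simp only [h1]
  rw [← lintegral_map (f := fun x => F (WithLp.toLp 2 x)) (hF.comp hto) hadd, hpi,
    lintegral_withDensity_eq_lintegral_mul (Measure.pi fun _ : Fin d => gaussianReal 0 1)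
      (f := fun x => ∏ i, ENNReal.ofReal (Real.exp (a i * x i - a i ^ 2 / 2))) (by fun_prop)
      (g := fun x => F (WithLp.toLp 2 x)) (hF.comp hto)]
  refine lintegral_congr fun x => ?_
  rw [Pi.mul_apply, mul_comm, ← ENNReal.ofReal_prod_of_nonneg fun i _ => (Real.exp_pos _).le,
    ← Real.exp_sum]
  congr 3
  rw [Finset.sum_sub_distrib, EuclideanSpace.real_norm_sq_eq, Finset.sum_div]
  simp [PiLp.inner_apply, mul_comm]

/-- A continuous linear functional of a Gaussian is Gaussian, here with variance `‖e‖² = 1`. This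
reduces the `d`-dimensional moments to dimension one. -/
lemma stdGaussian_map_inner {d : ℕ} {e : Vec d} (he : ‖e‖ = 1) :
    (stdGaussian (Vec d)).map (fun z => inner ℝ e z) = gaussianReal 0 1 := by
  have h := IsGaussian.map_eq_gaussianReal (μ := stdGaussian (Vec d)) (innerSL ℝ e)
  rw [variance_dual_stdGaussian, integral_strongDual_stdGaussian, innerSL_apply_norm, he] at h
  simpa using h

end CameronMartin

/-! ### Rényi divergence of two Gaussian mixtures with a common component. -/

section GaussianMixture

open scoped ENNReal

/-- The likelihood ratio with respect to the standard Gaussian of its mixture with its translate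
by `a`. -/
noncomputable def mixRatio {d : ℕ} (q : ℝ) (a z : Vec d) : ℝ :=
  mixDensity q (inner ℝ a z - ‖a‖ ^ 2 / 2)

lemma measurable_mixRatio {d : ℕ} (q : ℝ) (a : Vec d) : Measurable (mixRatio q a) := by
  unfold mixRatio mixDensity
  fun_prop

/-- The ratio depends on `z` only through its component along `a`. -/
lemma lintegral_mixRatio_rpow {d : ℕ} (hd : 0 < d) (q : ℝ) (a : Vec d) (s : ℝ) :
    ∫⁻ z, ENNReal.ofReal (mixRatio q a z ^ s) ∂(stdGaussian (Vec d))
      = ∫⁻ x, ENNReal.ofReal (mixDensity q (‖a‖ * x - ‖a‖ ^ 2 / 2) ^ s) ∂(gaussianReal 0 1) := by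
  -- For `a = 0` any unit vector serves as direction; `0 < d` provides one.
  obtain ⟨e, he, hae⟩ : ∃ e : Vec d, ‖e‖ = 1 ∧ a = ‖a‖ • e := by
    by_cases ha : a = 0
    · exact ⟨EuclideanSpace.single ⟨0, hd⟩ 1, by simp, by simp [ha]⟩
    · have : ‖a‖ ≠ 0 := norm_ne_zero_iff.2 ha
      exact ⟨‖a‖⁻¹ • a, by rw [norm_smul, norm_inv, norm_norm, inv_mul_cancel₀ this],
        by rw [smul_inv_smul₀ this]⟩
  rw [← stdGaussian_map_inner he, lintegral_map
    (measurable_mixDensity_rpow q ‖a‖ s).ennreal_ofReal (by fun_prop)]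
  refine lintegral_congr fun z => ?_
  have : inner ℝ a z = ‖a‖ * inner ℝ e z := by
    conv_lhs => rw [hae]
    rw [real_inner_smul_left]
  rw [mixRatio, this]

/-- The Rényi divergence of two Gaussian mixtures, in dual form. -/
lemma lintegral_mul_mixRatio_le {d : ℕ} (hd : 0 < d) {q α r : ℝ} (hq : 0 ≤ q) (hq1 : q ≤ 1)
    (hα : 2 ≤ α) (hαr : 2 * α * r ^ 2 ≤ 1 / 64) {a a' : Vec d} (ha : ‖a‖ ≤ r) (ha' : ‖a'‖ ≤ r)
    {F : Vec d → ℝ≥0∞} (hF : Measurable F) :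
    ∫⁻ z, F z * ENNReal.ofReal (mixRatio q a z) ∂(stdGaussian (Vec d))
      ≤ ENNReal.ofReal (Real.exp (momentConst * (2 * α * q * r) ^ 2 / α))
        * (∫⁻ z, F z ^ (α / (α - 1)) * ENNReal.ofReal (mixRatio q a' z)
            ∂(stdGaussian (Vec d))) ^ (1 / (α / (α - 1))) := by
  have hα1 : 0 < α - 1 := by linarith
  have hr : 0 ≤ r := (norm_nonneg a).trans ha
  set p := α / (α - 1) with hp
  have hp0 : 0 < p := by positivity
  have hpα : α * (1 / p) = α - 1 := by rw [hp]; field_simp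
  set B := momentConst * (2 * α * q * r) ^ 2 with hB
  have hw : ∀ z, 0 < mixRatio q a z := fun z => mixDensity_pos hq hq1
  have hw' : ∀ z, 0 < mixRatio q a' z := fun z => mixDensity_pos hq hq1
  have hm := measurable_mixRatio q a
  have hm' := measurable_mixRatio q a'
  have hkr : ∀ x : Vec d, ‖x‖ ≤ r → 2 * α * ‖x‖ ^ 2 ≤ 1 / 64 := fun x hx => by
    refine le_trans ?_ hαr
    gcongr
  have hBx : ∀ x : Vec d, ‖x‖ ≤ r →
      ENNReal.ofReal (Real.exp (momentConst * (2 * α * q * ‖x‖) ^ 2))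
        ≤ ENNReal.ofReal (Real.exp B) := fun x hx => by
    have := momentConst_pos
    refine ENNReal.ofReal_le_ofReal (Real.exp_le_exp.2 ?_)
    rw [hB]
    gcongr
  have hM : ∫⁻ z, ENNReal.ofReal (mixRatio q a z ^ (2 * α)) ∂(stdGaussian (Vec d))
      ≤ ENNReal.ofReal (Real.exp B) := by
    rw [lintegral_mixRatio_rpow hd]
    exact (lintegral_mixDensity_rpow_le hq hq1 (norm_nonneg a) (by linarith) (hkr a ha)).trans
      (hBx a ha)
  have hM' : ∫⁻ z, ENNReal.ofReal (mixRatio q a' z ^ (-(2 * (α - 1)))) ∂(stdGaussian (Vec d))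
      ≤ ENNReal.ofReal (Real.exp B) := by
    rw [lintegral_mixRatio_rpow hd]
    exact (lintegral_mixDensity_rpow_neg_le hq hq1 (norm_nonneg a') (by linarith) (by linarith)
      (hkr a' ha')).trans (hBx a' ha')
  -- This is the Rényi moment `∫ w^α w'^(-(α-1))`. Cauchy-Schwarz decouples the two ratios at the
  -- price of doubling the orders, hence `2 * α` in the hypotheses.
  have hcs : ∫⁻ z, ENNReal.ofReal (mixRatio q a z ^ α)
        * ENNReal.ofReal (mixRatio q a' z ^ (-(α - 1))) ∂(stdGaussian (Vec d))
      ≤ ENNReal.ofReal (Real.exp B) := by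
    refine (ENNReal.lintegral_mul_le_Lp_mul_Lq _ Real.HolderConjugate.two_two
      (hm.pow_const α).ennreal_ofReal.aemeasurable
      (hm'.pow_const _).ennreal_ofReal.aemeasurable).trans ?_
    have e1 : ∀ z, ENNReal.ofReal (mixRatio q a z ^ α) ^ (2 : ℝ)
        = ENNReal.ofReal (mixRatio q a z ^ (2 * α)) := fun z => by
      rw [ENNReal.ofReal_rpow_of_pos (Real.rpow_pos_of_pos (hw z) _), ← Real.rpow_mul (hw z).le,
        mul_comm]
    have e2 : ∀ z, ENNReal.ofReal (mixRatio q a' z ^ (-(α - 1))) ^ (2 : ℝ)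
        = ENNReal.ofReal (mixRatio q a' z ^ (-(2 * (α - 1)))) := fun z => by
      rw [ENNReal.ofReal_rpow_of_pos (Real.rpow_pos_of_pos (hw' z) _),
        ← Real.rpow_mul (hw' z).le]
      congr 2
      ring
    simp only [e1, e2]
    calc _ ≤ ENNReal.ofReal (Real.exp B) ^ (1 / 2 : ℝ)
          * ENNReal.ofReal (Real.exp B) ^ (1 / 2 : ℝ) := by gcongr
      _ = _ := by
        rw [← ENNReal.rpow_add _ _ (by simp [Real.exp_pos]) (by simp)]
        norm_num
  have hconj : α.HolderConjugate p := Real.HolderConjugate.conjExponent (by linarith)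
  -- Change of the reference from `w` to `w'`: in `w = (w w'^(-1/p)) w'^(1/p)` the `p`-th power of
  -- the last factor is `w'` and, since `α/p = α - 1`, the `α`-th power of the first is the Rényi
  -- integrand.
  have hsplit : ∀ z, F z * ENNReal.ofReal (mixRatio q a z)
      = (ENNReal.ofReal (mixRatio q a z * mixRatio q a' z ^ (-(1 / p))))
        * (F z * ENNReal.ofReal (mixRatio q a' z ^ (1 / p))) := fun z => by
    rw [mul_left_comm, ← ENNReal.ofReal_mul (mul_nonneg (hw z).le (Real.rpow_nonneg (hw' z).le _)),
      mul_assoc, ← Real.rpow_add (hw' z)]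
    simp
  simp only [hsplit]
  refine (ENNReal.lintegral_mul_le_Lp_mul_Lq _ hconj
    (hm.mul (hm'.pow_const _)).ennreal_ofReal.aemeasurable
    (hF.mul (hm'.pow_const _).ennreal_ofReal).aemeasurable).trans ?_
  have e3 : ∀ z, ENNReal.ofReal (mixRatio q a z * mixRatio q a' z ^ (-(1 / p))) ^ α
      = ENNReal.ofReal (mixRatio q a z ^ α)
        * ENNReal.ofReal (mixRatio q a' z ^ (-(α - 1))) := fun z => by
    have h0 := Real.rpow_pos_of_pos (hw' z) (-(1 / p))
    rw [ENNReal.ofReal_rpow_of_pos (mul_pos (hw z) h0), Real.mul_rpow (hw z).le h0.le,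
      ENNReal.ofReal_mul (Real.rpow_nonneg (hw z).le _), ← Real.rpow_mul (hw' z).le]
    congr 3
    rw [neg_mul, mul_comm, hpα]
  have e4 : ∀ z, (F z * ENNReal.ofReal (mixRatio q a' z ^ (1 / p))) ^ p
      = F z ^ p * ENNReal.ofReal (mixRatio q a' z) := fun z => by
    rw [ENNReal.mul_rpow_of_nonneg _ _ hp0.le,
      ENNReal.ofReal_rpow_of_pos (Real.rpow_pos_of_pos (hw' z) _), ← Real.rpow_mul (hw' z).le,
      one_div_mul_cancel hp0.ne', Real.rpow_one]
  simp only [Pi.mul_apply, e3, e4]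
  gcongr
  calc _ ≤ ENNReal.ofReal (Real.exp B) ^ (1 / α) := by gcongr
    _ = _ := by
      rw [ENNReal.ofReal_rpow_of_pos (Real.exp_pos _), ← Real.exp_mul]
      congr 2
      ring

end GaussianMixture

end SoteriaFL

namespace SoteriaFL

/-! ### Privacy loss of one client in one round. -/

section ClientPrivacy

open scoped ENNReal

/-- The Bernoulli law of the inclusion of a sample in the minibatch. -/
noncomputable def coinLaw (q : ℝ) : Measure Bool :=
  ENNReal.ofReal q • Measure.dirac true + ENNReal.ofReal (1 - q) • Measure.dirac false

lemma isProbabilityMeasure_coinLaw {q : ℝ} (hq : 0 ≤ q) (hq1 : q ≤ 1) :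
    IsProbabilityMeasure (coinLaw q) := by
  constructor
  simp only [coinLaw, Measure.add_apply, Measure.smul_apply, measure_univ, smul_eq_mul, mul_one]
  rw [← ENNReal.ofReal_add hq (by linarith)]
  simp

lemma minibatchLaw_eq (m : ℕ) (b : ℝ) :
    minibatchLaw m b = Measure.pi fun _ : Fin m => coinLaw (b / m) := rfl

lemma isProbabilityMeasure_minibatchLaw {m : ℕ} {b : ℝ} (hb : 0 ≤ b) (hbm : b ≤ m) :
    IsProbabilityMeasure (minibatchLaw m b) := by
  rw [minibatchLaw_eq]
  have := isProbabilityMeasure_coinLaw (q := b / m) (by positivity)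
    (div_le_one_of_le₀ hbm (by positivity))
  infer_instance

instance (d : ℕ) (σ : ℝ) : IsProbabilityMeasure (gaussianNoise d σ) :=
  Measure.isProbabilityMeasure_map (by fun_prop)

/-- The law of the random choices of one client in one round. -/
noncomputable def clientLaw (m d : ℕ) {U : Type v} [MeasurableSpace U] (b σ : ℝ) (ν : Measure U) :
    Measure (Seed m d U) :=
  (minibatchLaw m b).prod ((gaussianNoise d σ).prod ν)

/-- Isolates the only sample in which neighboring datasets differ; the first summand no longer
depends on whether it was drawn. -/
lemma localGradient_eq_add {d m : ℕ} {Z : Type u} (loss : Z → Vec d → ℝ) (b : ℝ)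
    (Di : Fin m → Z) (I : Fin m → Bool) (j : Fin m) (x : Vec d) :
    localGradient loss b Di I x = localGradient loss b Di (Function.update I j false) x
      + if I j then (1 / b) • gradient (loss (Di j)) x else 0 := by
  unfold localGradient
  rw [← Finset.add_sum_erase _ _ (Finset.mem_univ j),
    ← Finset.add_sum_erase _ (fun k => if Function.update I j false k = true then _ else _)
      (Finset.mem_univ j)]
  have : ∀ k ∈ Finset.univ.erase j,
      (if Function.update I j false k = true then gradient (loss (Di k)) x else 0)
        = if I k then gradient (loss (Di k)) x else 0 := fun k hk => by
    rw [Function.update_of_ne (Finset.ne_of_mem_erase hk)]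
  rw [Finset.sum_congr rfl this, Function.update_self, if_neg Bool.false_ne_true, zero_add,
    smul_add, add_comm]
  congr 1
  split_ifs <;> simp

lemma localGradient_update_false_congr {d m : ℕ} {Z : Type u} (loss : Z → Vec d → ℝ) (b : ℝ)
    {Di Di' : Fin m → Z} {j : Fin m} (h : ∀ k, k ≠ j → Di k = Di' k) (I : Fin m → Bool)
    (x : Vec d) :
    localGradient loss b Di (Function.update I j false) x
      = localGradient loss b Di' (Function.update I j false) x := by
  unfold localGradient
  congr 1
  refine Finset.sum_congr rfl fun k _ => ?_
  by_cases hk : k = j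
  · subst hk; simp
  · rw [h k hk]

/-- In units of `σ`, the branch where the sample is drawn is a translate by `σ⁻¹ • a`, to which the
Cameron-Martin formula applies; averaging over the coin turns the density into `mixRatio`. -/
lemma lintegral_coin_gaussian {d : ℕ} {q σ : ℝ} (hq : 0 ≤ q) (hq1 : q ≤ 1) (hσ : σ ≠ 0)
    (c a : Vec d) {f : Vec d → ℝ≥0∞} (hf : Measurable f) :
    ∫⁻ w, f w ∂(((coinLaw q).prod (gaussianNoise d σ)).map
        fun w => c + ((if w.1 then a else 0) + w.2))
      = ∫⁻ z, f (c + σ • z) * ENNReal.ofReal (mixRatio q (σ⁻¹ • a) z) ∂(stdGaussian (Vec d)) := by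
  have := isProbabilityMeasure_coinLaw hq hq1
  have hm : Measurable fun w : Bool × Vec d => c + ((if w.1 then a else 0) + w.2) := by
    have : Measurable fun w : Bool × Vec d => (if w.1 then a else 0) :=
      (measurable_of_countable fun β : Bool => if β then a else 0).comp measurable_fst
    fun_prop
  rw [lintegral_map hf hm,
    lintegral_prod (fun w : Bool × Vec d => f (c + ((if w.1 then a else 0) + w.2)))
      (hf.comp hm).aemeasurable]
  rw [coinLaw, lintegral_add_measure, lintegral_smul_measure, lintegral_smul_measure,
    lintegral_dirac, lintegral_dirac]
  simp only [if_true, Bool.false_eq_true, if_false, zero_add, gaussianNoise, smul_eq_mul]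
  rw [lintegral_map (by fun_prop) (by fun_prop), lintegral_map (by fun_prop) (by fun_prop)]
  have h1 : ∀ z : Vec d, c + (a + σ • z) = c + σ • (z + σ⁻¹ • a) := fun z => by
    rw [smul_add, smul_inv_smul₀ hσ, add_comm a]
  simp only [h1]
  rw [lintegral_add_stdGaussian (σ⁻¹ • a) (F := fun z => f (c + σ • z)) (by fun_prop),
    ← lintegral_const_mul _ (by fun_prop), ← lintegral_const_mul _ (by fun_prop),
    ← lintegral_add_left (by fun_prop)]
  refine lintegral_congr fun z => ?_
  rw [mul_left_comm, mul_comm (ENNReal.ofReal (1 - q)), ← mul_add,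
    ← ENNReal.ofReal_mul hq, ← ENNReal.ofReal_add (by positivity) (by linarith), mixRatio,
    mixDensity, add_comm (1 - q)]

lemma measurable_localGradient {d m : ℕ} {Z : Type u} (loss : Z → Vec d → ℝ) (b : ℝ)
    (Di : Fin m → Z) (x : Vec d) : Measurable fun I => localGradient loss b Di I x :=
  measurable_of_countable _

/-- The Rényi divergence of the perturbed local gradients on neighboring datasets. -/
lemma holderDom_localGradient {d m : ℕ} (hd : 0 < d) {Z : Type u} (loss : Z → Vec d → ℝ)
    {G b σ α : ℝ} (hG : ∀ z, HasBoundedGradient G (loss z)) (hb : 0 < b) (hbm : b ≤ m)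
    (hσ : 0 < σ) (hα : 2 ≤ α) (hαr : 2 * α * (G / (b * σ)) ^ 2 ≤ 1 / 64)
    {Di Di' : Fin m → Z} (hD : Neighbors Di Di') (x : Vec d) :
    HolderDom (α / (α - 1))
      (ENNReal.ofReal (Real.exp (momentConst * (2 * α * (b / m) * (G / (b * σ))) ^ 2 / α)))
      (((minibatchLaw m b).prod (gaussianNoise d σ)).map
        fun w => localGradient loss b Di w.1 x + w.2)
      (((minibatchLaw m b).prod (gaussianNoise d σ)).map
        fun w => localGradient loss b Di' w.1 x + w.2) := by
  obtain ⟨j, hj⟩ := hD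
  have hm0 : (0 : ℝ) < m := hb.trans_le hbm
  have hq : 0 ≤ b / m := by positivity
  have hq1 : b / m ≤ 1 := div_le_one_of_le₀ hbm hm0.le
  have := isProbabilityMeasure_coinLaw hq hq1
  have := isProbabilityMeasure_minibatchLaw hb.le hbm
  have hp : 1 < α / (α - 1) := by rw [lt_div_iff₀] <;> linarith
  -- The estimator without sample `j`: it is the same for both datasets and independent of the coin
  -- of `j`.
  set c : (Fin m → Bool) → Vec d :=
    fun I => localGradient loss b Di (Function.update I j false) x with hc
  have hcm : Measurable c := measurable_of_countable _
  have hind : (minibatchLaw m b).map (fun I => (c I, I j))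
      = ((minibatchLaw m b).map c).prod (coinLaw (b / m)) := by
    rw [minibatchLaw_eq]
    refine pi_map_prodMk_eval _ j hcm fun I I' h => ?_
    simp only [hc]
    congr 1
    funext k
    by_cases hk : k = j
    · subst hk; simp
    · simp [hk, h k hk]
  let φ : Vec d → Vec d → Bool × Vec d → Vec d := fun a c w => c + ((if w.1 then a else 0) + w.2)
  have hφ : ∀ a, Measurable (Function.uncurry (φ a)) := fun a => by
    have : Measurable fun w : Vec d × Bool × Vec d => (if w.2.1 then a else 0) :=
      (measurable_of_countable fun β : Bool => if β then a else 0).comp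
        (measurable_fst.comp measurable_snd)
    simp only [φ, Function.uncurry_def]
    fun_prop
  have key : ∀ E : Fin m → Z, (∀ k, k ≠ j → E k = Di k) →
      ((minibatchLaw m b).prod (gaussianNoise d σ)).map
        (fun w => localGradient loss b E w.1 x + w.2)
      = ((((minibatchLaw m b).map c).prod ((coinLaw (b / m)).prod (gaussianNoise d σ)))).map
        (Function.uncurry (φ ((1 / b) • gradient (loss (E j)) x))) := by
    intro E hE
    have := Measure.isProbabilityMeasure_map (μ := minibatchLaw m b) hcm.aemeasurable
    rw [← Measure.prodAssoc_prod, ← hind]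
    nth_rewrite 2 [← Measure.map_id (μ := gaussianNoise d σ)]
    rw [Measure.map_prod_map _ _ (by fun_prop) measurable_id,
      Measure.map_map (hφ _) (by fun_prop),
      Measure.map_map ((hφ _).comp (by fun_prop))
        ((hcm.prodMk (measurable_pi_apply j)).prodMap measurable_id)]
    congr 1
    funext w
    change localGradient loss b E w.1 x + w.2
      = c w.1 + ((if w.1 j then (1 / b) • gradient (loss (E j)) x else 0) + w.2)
    rw [localGradient_eq_add loss b E w.1 j, localGradient_update_false_congr loss b hE, add_assoc]
  rw [key Di fun _ _ => rfl, key Di' fun k hk => (hj k hk).symm]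
  have := Measure.isProbabilityMeasure_map (μ := minibatchLaw m b) hcm.aemeasurable
  -- Composition with first stage `c`, whose law does not depend on the dataset and costs `1`; only
  -- the coin, the gradient of sample `j` and the noise pay.
  rw [← one_mul (ENNReal.ofReal _)]
  refine HolderDom.comp (by linarith) (HolderDom.refl hp _) (hφ _) (hφ _) fun y f hf => ?_
  -- The length of the translate in units of the noise; this is the `r` of the moment bounds.
  have hnorm : ∀ z, ‖σ⁻¹ • ((1 / b) • gradient (loss z) x)‖ ≤ G / (b * σ) := fun z => by
    rw [norm_smul, norm_smul, norm_inv, norm_div, norm_one, Real.norm_of_nonneg hσ.le,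
      Real.norm_of_nonneg hb.le]
    calc σ⁻¹ * (1 / b * ‖gradient (loss z) x‖) ≤ σ⁻¹ * (1 / b * G) := by gcongr; exact hG z x
      _ = _ := by field_simp
  have h1 := lintegral_coin_gaussian hq hq1 hσ.ne' y ((1 / b) • gradient (loss (Di j)) x) hf
  have h2 := lintegral_coin_gaussian hq hq1 hσ.ne' y ((1 / b) • gradient (loss (Di' j)) x)
    (hf.pow_const (α / (α - 1)))
  simp only [φ]
  rw [h1, h2]
  exact lintegral_mul_mixRatio_le hd hq hq1 hα hαr (hnorm _) (hnorm _)
    (F := fun z => f (y + σ • z)) (by fun_prop)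

/-- The message of a client is a randomized function of its perturbed local gradient. -/
lemma holderDom_message {d m : ℕ} (hd : 0 < d) {Z : Type u} (loss : Z → Vec d → ℝ)
    {U : Type v} [MeasurableSpace U] (ν : Measure U) [IsProbabilityMeasure ν]
    {K : U → Vec d → Vec d} (hK : Measurable (Function.uncurry K))
    {G b σ α : ℝ} (hG : ∀ z, HasBoundedGradient G (loss z)) (hb : 0 < b) (hbm : b ≤ m)
    (hσ : 0 < σ) (hα : 2 ≤ α) (hαr : 2 * α * (G / (b * σ)) ^ 2 ≤ 1 / 64)
    {Di Di' : Fin m → Z} (hD : Neighbors Di Di') (x s : Vec d) :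
    HolderDom (α / (α - 1))
      (ENNReal.ofReal (Real.exp (momentConst * (2 * α * (b / m) * (G / (b * σ))) ^ 2 / α)))
      ((clientLaw m d b σ ν).map (message loss b K Di x s))
      ((clientLaw m d b σ ν).map (message loss b K Di' x s)) := by
  have := isProbabilityMeasure_minibatchLaw hb.le hbm
  have hp : 1 < α / (α - 1) := by rw [lt_div_iff₀] <;> linarith
  have hφ : Measurable (Function.uncurry fun (w : Vec d) (r : U) => K r (w - s)) :=
    hK.comp (f := fun p : Vec d × U => (p.2, p.1 - s)) (by fun_prop)
  have hg : ∀ E : Fin m → Z, Measurable fun w : (Fin m → Bool) × Vec d =>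
      localGradient loss b E w.1 x + w.2 := fun E =>
    ((measurable_localGradient loss b E x).comp measurable_fst).add measurable_snd
  have key : ∀ E : Fin m → Z, (clientLaw m d b σ ν).map (message loss b K E x s)
      = ((((minibatchLaw m b).prod (gaussianNoise d σ)).map
        fun w => localGradient loss b E w.1 x + w.2).prod ν).map
          (Function.uncurry fun (w : Vec d) (r : U) => K r (w - s)) := by
    intro E
    nth_rewrite 2 [← Measure.map_id (μ := ν)]
    rw [Measure.map_prod_map _ _ (hg E) measurable_id,
      Measure.map_map hφ ((hg E).prodMap measurable_id), clientLaw, ← Measure.prodAssoc_prod,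
      Measure.map_map _ (by fun_prop)]
    · rfl
    · unfold message
      refine hK.comp (f := fun r : Seed m d U => (r.2.2, localGradient loss b E r.1 x + r.2.1 - s))
        ?_
      have : Measurable fun r : Seed m d U => localGradient loss b E r.1 x :=
        (measurable_localGradient loss b E x).comp measurable_fst
      fun_prop
  -- Here the first stage pays and the compressor, whose randomness does not see the data, is the
  -- second stage with factor `1`.
  rw [key, key, ← mul_one (ENNReal.ofReal _)]
  have := Measure.isProbabilityMeasure_map
    (μ := (minibatchLaw m b).prod (gaussianNoise d σ)) (hg Di).aemeasurable
  have := Measure.isProbabilityMeasure_map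
    (μ := (minibatchLaw m b).prod (gaussianNoise d σ)) (hg Di').aemeasurable
  refine HolderDom.comp (by linarith)
    (holderDom_localGradient hd loss hG hb hbm hσ hα hαr hD x) hφ hφ fun y => ?_
  have := Measure.isProbabilityMeasure_map (μ := ν) (f := fun r => K r (y - s))
    (hφ.of_uncurry_left (x := y)).aemeasurable
  exact HolderDom.refl hp _

end ClientPrivacy

end SoteriaFL

namespace SoteriaFL

/-! ### Composition over clients and rounds, and the privacy guarantee. -/

section Transcript

open scoped ENNReal

variable {d n m : ℕ} {Z : Type u} {U : Type v}

/-- The joint law of the random choices of all clients in one round. -/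
noncomputable def roundLaw (m d : ℕ) {n : ℕ} {U : Type v} [MeasurableSpace U] (b σ : ℝ)
    (ν : Fin n → Measure U) : Measure (Fin n → Seed m d U) :=
  Measure.pi fun i => clientLaw m d b σ (ν i)

lemma isProbabilityMeasure_clientLaw [MeasurableSpace U] {b σ : ℝ} (hb : 0 ≤ b) (hbm : b ≤ m)
    (ν : Measure U) [IsProbabilityMeasure ν] : IsProbabilityMeasure (clientLaw m d b σ ν) := by
  have := isProbabilityMeasure_minibatchLaw hb hbm
  unfold clientLaw
  infer_instance

lemma isProbabilityMeasure_roundLaw [MeasurableSpace U] {b σ : ℝ} (hb : 0 ≤ b) (hbm : b ≤ m)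
    (ν : Fin n → Measure U) [∀ i, IsProbabilityMeasure (ν i)] :
    IsProbabilityMeasure (roundLaw m d b σ ν) := by
  have := fun i => isProbabilityMeasure_clientLaw (d := d) (σ := σ) hb hbm (ν i)
  unfold roundLaw
  infer_instance

lemma seedLaw_eq [MeasurableSpace U] (P : Params d) (ν : ℕ → Fin n → Measure U) :
    seedLaw m P ν = Measure.infinitePi fun t => roundLaw m d P.b P.σ (ν t) := rfl

lemma measurable_gradient_of_isSmooth {L : ℝ} {g : Vec d → ℝ} (hg : IsSmooth L g) :
    Measurable (gradient g) := by
  have : LipschitzWith (Real.toNNReal L) (gradient g) :=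
    LipschitzWith.of_dist_le_mul fun x y => by
      rw [dist_eq_norm, dist_eq_norm]
      exact (hg.2 x y).trans (by gcongr; exact Real.le_coe_toNNReal L)
  exact this.continuous.measurable

lemma measurable_message [MeasurableSpace U] {loss : Z → Vec d → ℝ}
    (hloss : ∀ z, Measurable (gradient (loss z))) (b : ℝ) {K : U → Vec d → Vec d}
    (hK : Measurable (Function.uncurry K)) (Di : Fin m → Z) {X : Type*} [MeasurableSpace X]
    {x s : X → Vec d} {r : X → Seed m d U} (hx : Measurable x) (hs : Measurable s)
    (hr : Measurable r) : Measurable fun y => message loss b K Di (x y) (s y) (r y) := by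
  have h1 : Measurable fun y => localGradient loss b Di (r y).1 (x y) := by
    unfold localGradient
    have : Measurable fun y => ∑ j, if (r y).1 j then gradient (loss (Di j)) (x y) else 0 := by
      refine Finset.measurable_sum _ fun j _ => ?_
      refine Measurable.ite ?_ ((hloss _).comp hx) measurable_const
      exact ((measurable_pi_apply j).comp (measurable_fst.comp hr)) (measurableSet_singleton true)
    exact this.const_smul (1 / b)
  have h2 : Measurable fun y => (r y).2.1 := measurable_fst.comp (measurable_snd.comp hr)
  have h3 : Measurable fun y => (r y).2.2 := measurable_snd.comp (measurable_snd.comp hr)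
  have h4 : Measurable fun y => localGradient loss b Di (r y).1 (x y) + (r y).2.1 - s y := by
    fun_prop
  exact hK.comp (h3.prodMk h4)

/-- One round: the messages of all clients, when the data of one client are changed in one
entry. -/
lemma holderDom_round [MeasurableSpace U] (hd : 0 < d) {loss : Z → Vec d → ℝ}
    (hloss : ∀ z, Measurable (gradient (loss z)))
    (ν : Fin n → Measure U) [∀ i, IsProbabilityMeasure (ν i)]
    {K : Fin n → U → Vec d → Vec d} (hK : ∀ i, Measurable (Function.uncurry (K i)))
    {G b σ α : ℝ} (hG : ∀ z, HasBoundedGradient G (loss z)) (hb : 0 < b) (hbm : b ≤ m)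
    (hσ : 0 < σ) (hα : 2 ≤ α) (hαr : 2 * α * (G / (b * σ)) ^ 2 ≤ 1 / 64)
    {D D' : Fin n → Fin m → Z} {i : Fin n} (hD : Neighbors (D i) (D' i))
    (hDD : ∀ k, k ≠ i → D k = D' k) (x : Vec d) (s : Fin n → Vec d) :
    HolderDom (α / (α - 1))
      (ENNReal.ofReal (Real.exp (momentConst * (2 * α * (b / m) * (G / (b * σ))) ^ 2 / α)))
      ((roundLaw m d b σ ν).map fun r k => message loss b (K k) (D k) x (s k) (r k))
      ((roundLaw m d b σ ν).map fun r k => message loss b (K k) (D' k) x (s k) (r k)) := by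
  have := fun i => isProbabilityMeasure_clientLaw (d := d) (σ := σ) hb.le hbm (ν i)
  have := isProbabilityMeasure_roundLaw (d := d) (σ := σ) hb.le hbm ν
  have hp : 1 < α / (α - 1) := by rw [lt_div_iff₀] <;> linarith
  have hmsg : ∀ (E : Fin m → Z) (k : Fin n), Measurable (message loss b (K k) E x (s k)) :=
    fun E k => measurable_message hloss b (hK k) E measurable_const measurable_const measurable_id
  -- The messages of the other clients, with a dummy entry at `i` so that `g` does not involve the
  -- seed of client `i`. They cost `1`, so a round costs as much as one client.
  let g : (Fin n → Seed m d U) → Fin n → Vec d :=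
    fun r k => if k = i then 0 else message loss b (K k) (D k) x (s k) (r k)
  have hg : Measurable g := by
    refine measurable_pi_lambda _ fun k => ?_
    by_cases hk : k = i
    · simp [g, hk]
    · simpa [g, hk, Function.comp_def] using (hmsg (D k) k).comp (measurable_pi_apply k)
  have hind := pi_map_prodMk_eval (fun k => clientLaw m d b σ (ν k)) i hg fun r r' h => by
    funext k
    by_cases hk : k = i
    · simp [g, hk]
    · simp [g, hk, h k hk]
  let φ : (Fin m → Z) → (Fin n → Vec d) → Seed m d U → Fin n → Vec d :=
    fun E y r => Function.update y i (message loss b (K i) E x (s i) r)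
  have hupd : ∀ y : Fin n → Vec d, Measurable (Function.update y i) := fun y =>
    measurable_update y
  have hφ : ∀ E, Measurable (Function.uncurry (φ E)) := fun E => by
    have : Measurable fun p : (Fin n → Vec d) × Vec d => Function.update p.1 i p.2 :=
      measurable_update'
    exact this.comp (measurable_fst.prodMk ((hmsg E i).comp measurable_snd))
  have key : ∀ E : Fin n → Fin m → Z, (∀ k, k ≠ i → E k = D k) →
      (roundLaw m d b σ ν).map (fun r k => message loss b (K k) (E k) x (s k) (r k))
        = (((roundLaw m d b σ ν).map g).prod (clientLaw m d b σ (ν i))).map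
          (Function.uncurry (φ (E i))) := by
    intro E hE
    rw [roundLaw, ← hind, Measure.map_map (hφ _) (hg.prodMk (measurable_pi_apply i))]
    congr 1
    funext r k
    by_cases hk : k = i
    · subst hk; simp [φ]
    · simp [φ, hk, g, hE k hk]
  rw [key D fun _ _ => rfl, key D' fun k hk => (hDD k hk).symm, ← one_mul (ENNReal.ofReal _)]
  have := Measure.isProbabilityMeasure_map (μ := roundLaw m d b σ ν) hg.aemeasurable
  refine HolderDom.comp (by linarith) (HolderDom.refl hp _) (hφ _) (hφ _) fun y => ?_
  have := (holderDom_message hd loss (ν i) (hK i) hG hb hbm hσ hα hαr hD x (s i)).map (hupd y)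
  rwa [Measure.map_map (hupd y) (hmsg _ i), Measure.map_map (hupd y) (hmsg _ i)] at this

/-- The state at the beginning of round `t` as a function of the messages. -/
noncomputable def replay (P : Params d) (h : ℕ → Fin n → Vec d) : ℕ → State d n
  | 0 => ⟨P.x₀, fun _ => 0, 0⟩
  | t + 1 => update P (replay P h t) (h t)

lemma replay_congr (P : Params d) {h h' : ℕ → Fin n → Vec d} {t : ℕ}
    (hh : ∀ k < t, h k = h' k) : replay P h t = replay P h' t := by
  induction t with
  | zero => rfl
  | succ t ih =>
    rw [replay, replay, ih fun k hk => hh k (by omega), hh t (by omega)]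

lemma measurable_replay (P : Params d) (t : ℕ) :
    (Measurable fun h : ℕ → Fin n → Vec d => (replay P h t).x) ∧
    (∀ i, Measurable fun h : ℕ → Fin n → Vec d => (replay P h t).shift i) ∧
    (Measurable fun h : ℕ → Fin n → Vec d => (replay P h t).serverShift) := by
  induction t with
  | zero => exact ⟨measurable_const, fun i => measurable_const, measurable_const⟩
  | succ t ih =>
    obtain ⟨h1, h2, h3⟩ := ih
    simp only [replay, update]
    refine ⟨by fun_prop, fun i => ?_, by fun_prop⟩
    have := h2 i
    fun_prop

/-- The messages of the first `t` rounds. -/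
noncomputable def history (loss : Z → Vec d → ℝ) (P : Params d)
    (K : ℕ → Fin n → U → Vec d → Vec d) (D : Fin n → Fin m → Z) (t : ℕ)
    (ρ : ℕ → Fin n → Seed m d U) : ℕ → Fin n → Vec d :=
  fun k i => if k < t then message loss P.b (K k i) (D i) (state loss P K D ρ k).x
    ((state loss P K D ρ k).shift i) (ρ k i) else 0

/-- Extend the history by the messages of round `t`. -/
noncomputable def extendHistory (loss : Z → Vec d → ℝ) (P : Params d)
    (K : ℕ → Fin n → U → Vec d → Vec d) (D : Fin n → Fin m → Z) (t : ℕ)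
    (h : ℕ → Fin n → Vec d) (r : Fin n → Seed m d U) : ℕ → Fin n → Vec d :=
  Function.update h t fun i =>
    message loss P.b (K t i) (D i) (replay P h t).x ((replay P h t).shift i) (r i)

/-- The model and the references are determined by the messages. Hence, given the same history, the
two datasets meet the same model and references, as adaptive composition requires. -/
lemma replay_history (loss : Z → Vec d → ℝ) (P : Params d) (K : ℕ → Fin n → U → Vec d → Vec d)
    (D : Fin n → Fin m → Z) (t : ℕ) (ρ : ℕ → Fin n → Seed m d U) :
    replay P (history loss P K D t ρ) t = state loss P K D ρ t := by
  -- The truncation time `T` of the history is held fixed while `t` runs through the induction.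
  have h : ∀ T t, t ≤ T → replay P (history loss P K D T ρ) t = state loss P K D ρ t := by
    intro T t
    induction t with
    | zero => intro _; rfl
    | succ t ih =>
      intro ht
      rw [replay, state, ih (by omega)]
      congr 1
      funext i
      simp [history, show t < T by omega]
  exact h t t le_rfl

lemma history_succ (loss : Z → Vec d → ℝ) (P : Params d) (K : ℕ → Fin n → U → Vec d → Vec d)
    (D : Fin n → Fin m → Z) (t : ℕ) (ρ : ℕ → Fin n → Seed m d U) :
    history loss P K D (t + 1) ρ
      = extendHistory loss P K D t (history loss P K D t ρ) (ρ t) := by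
  funext k
  rw [extendHistory, replay_history]
  by_cases hk : k = t
  · subst hk
    funext i
    simp [history]
  · rw [Function.update_of_ne hk]
    have : k < t + 1 ↔ k < t := by omega
    funext i
    simp [history, this]

lemma history_congr (loss : Z → Vec d → ℝ) (P : Params d) (K : ℕ → Fin n → U → Vec d → Vec d)
    (D : Fin n → Fin m → Z) (t : ℕ) {ρ ρ' : ℕ → Fin n → Seed m d U}
    (h : ∀ k < t, ρ k = ρ' k) : history loss P K D t ρ = history loss P K D t ρ' := by
  induction t with
  | zero => funext k i; simp [history]
  | succ t ih => rw [history_succ, history_succ, ih fun k hk => h k (by omega), h t (by omega)]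

variable [MeasurableSpace U]

lemma measurable_extendHistory {loss : Z → Vec d → ℝ}
    (hloss : ∀ z, Measurable (gradient (loss z))) (P : Params d)
    {K : ℕ → Fin n → U → Vec d → Vec d} (hK : ∀ t i, Measurable (Function.uncurry (K t i)))
    (D : Fin n → Fin m → Z) (t : ℕ) :
    Measurable (Function.uncurry (extendHistory loss P K D t)) := by
  obtain ⟨h1, h2, -⟩ := measurable_replay (n := n) P t
  have hu : Measurable fun p : (ℕ → Fin n → Vec d) × (Fin n → Vec d) =>
    Function.update p.1 t p.2 := measurable_update'
  refine hu.comp (measurable_fst.prodMk (measurable_pi_lambda _ fun i => ?_))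
  exact measurable_message hloss P.b (hK t i) (D i) (h1.comp measurable_fst)
    ((h2 i).comp measurable_fst) ((measurable_pi_apply i).comp measurable_snd)

lemma measurable_history {loss : Z → Vec d → ℝ}
    (hloss : ∀ z, Measurable (gradient (loss z))) (P : Params d)
    {K : ℕ → Fin n → U → Vec d → Vec d} (hK : ∀ t i, Measurable (Function.uncurry (K t i)))
    (D : Fin n → Fin m → Z) (t : ℕ) : Measurable (history loss P K D t) := by
  induction t with
  | zero =>
    have : history loss P K D 0 = fun _ _ _ => 0 := by
      funext ρ k i
      simp [history]
    rw [this]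
    exact measurable_const
  | succ t ih =>
    have : history loss P K D (t + 1) = fun ρ => Function.uncurry (extendHistory loss P K D t)
        (history loss P K D t ρ, ρ t) := by
      funext ρ
      exact history_succ ..
    rw [this]
    exact (measurable_extendHistory hloss P hK D t).comp (ih.prodMk (measurable_pi_apply t))

/-- The history uses only earlier seeds, so its law evolves by adjoining an independent round. Both
the privacy and the convergence induction rest on this. -/
lemma seedLaw_map_history_succ {loss : Z → Vec d → ℝ}
    (hloss : ∀ z, Measurable (gradient (loss z))) (P : Params d) (hb : 0 ≤ P.b) (hbm : P.b ≤ m)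
    (ν : ℕ → Fin n → Measure U) [∀ t i, IsProbabilityMeasure (ν t i)]
    {K : ℕ → Fin n → U → Vec d → Vec d} (hK : ∀ t i, Measurable (Function.uncurry (K t i)))
    (D : Fin n → Fin m → Z) (t : ℕ) :
    (seedLaw m P ν).map (history loss P K D (t + 1))
      = (((seedLaw m P ν).map (history loss P K D t)).prod (roundLaw m d P.b P.σ (ν t))).map
        (Function.uncurry (extendHistory loss P K D t)) := by
  have := fun t => isProbabilityMeasure_roundLaw (d := d) (σ := P.σ) hb hbm (ν t)
  have hm := measurable_history hloss P hK D t
  rw [seedLaw_eq, ← infinitePi_map_prodMk_eval (fun t => roundLaw m d P.b P.σ (ν t)) t hm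
    fun ρ ρ' h => history_congr loss P K D t h,
    Measure.map_map (measurable_extendHistory hloss P hK D t) (hm.prodMk (measurable_pi_apply t))]
  congr 1
  funext ρ
  exact history_succ ..

lemma isProbabilityMeasure_seedLaw (P : Params d) (hb : 0 ≤ P.b) (hbm : P.b ≤ m)
    (ν : ℕ → Fin n → Measure U) [∀ t i, IsProbabilityMeasure (ν t i)] :
    IsProbabilityMeasure (seedLaw m P ν) := by
  have := fun t => isProbabilityMeasure_roundLaw (d := d) (σ := P.σ) hb hbm (ν t)
  rw [seedLaw_eq]
  infer_instance

/-- Each round multiplies the constant by the same `e^(B/α)`, because the one-round bound holds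
uniformly in the model and the references. -/
lemma holderDom_history (hd : 0 < d) {loss : Z → Vec d → ℝ}
    (hloss : ∀ z, Measurable (gradient (loss z))) (P : Params d) (hb : 0 < P.b) (hbm : P.b ≤ m)
    (ν : ℕ → Fin n → Measure U) [∀ t i, IsProbabilityMeasure (ν t i)]
    {K : ℕ → Fin n → U → Vec d → Vec d} (hK : ∀ t i, Measurable (Function.uncurry (K t i)))
    {G α : ℝ} (hG : ∀ z, HasBoundedGradient G (loss z)) (hσ : 0 < P.σ) (hα : 2 ≤ α)
    (hαr : 2 * α * (G / (P.b * P.σ)) ^ 2 ≤ 1 / 64)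
    {D D' : Fin n → Fin m → Z} {i : Fin n} (hD : Neighbors (D i) (D' i))
    (hDD : ∀ k, k ≠ i → D k = D' k) (t : ℕ) :
    HolderDom (α / (α - 1))
      (ENNReal.ofReal (Real.exp
        (t * (momentConst * (2 * α * (P.b / m) * (G / (P.b * P.σ))) ^ 2) / α)))
      ((seedLaw m P ν).map (history loss P K D t))
      ((seedLaw m P ν).map (history loss P K D' t)) := by
  have := isProbabilityMeasure_seedLaw P hb.le hbm ν
  have hp : 1 < α / (α - 1) := by rw [lt_div_iff₀] <;> linarith
  have hprob : ∀ E t, IsProbabilityMeasure ((seedLaw m P ν).map (history loss P K E t)) :=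
    fun E t => Measure.isProbabilityMeasure_map (measurable_history hloss P hK E t).aemeasurable
  induction t with
  | zero =>
    have : history loss P K D 0 = history loss P K D' 0 := by
      funext ρ k i
      simp [history]
    rw [this]
    simpa using HolderDom.refl hp ((seedLaw m P ν).map (history loss P K D' 0))
  | succ t ih =>
    have := isProbabilityMeasure_roundLaw (d := d) (σ := P.σ) hb.le hbm (ν t)
    rw [seedLaw_map_history_succ hloss P hb.le hbm ν hK D t,
      seedLaw_map_history_succ hloss P hb.le hbm ν hK D' t]
    set B := momentConst * (2 * α * (P.b / m) * (G / (P.b * P.σ))) ^ 2 with hB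
    have e : ENNReal.ofReal (Real.exp ((t + 1 : ℕ) * B / α))
        = ENNReal.ofReal (Real.exp (t * B / α)) * ENNReal.ofReal (Real.exp (B / α)) := by
      rw [← ENNReal.ofReal_mul (Real.exp_pos _).le, ← Real.exp_add]
      congr 2
      push_cast
      ring
    rw [e]
    have hme := fun E : Fin n → Fin m → Z => measurable_extendHistory hloss P hK E t
    refine HolderDom.comp (by linarith) ih (hme D) (hme D') fun h => ?_
    have hupd : Measurable (Function.update h t) := measurable_update h
    have hmsg : ∀ E : Fin n → Fin m → Z, Measurable fun (r : Fin n → Seed m d U) i =>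
        message loss P.b (K t i) (E i) (replay P h t).x ((replay P h t).shift i) (r i) :=
      fun E => measurable_pi_lambda _ fun i => measurable_message hloss P.b (hK t i) (E i)
        measurable_const measurable_const (measurable_pi_apply i)
    have := (holderDom_round hd hloss (ν t) (hK t) hG hb hbm hσ hα hαr hD hDD (replay P h t).x
      (replay P h t).shift).map hupd
    rwa [Measure.map_map hupd (hmsg D), Measure.map_map hupd (hmsg D')] at this

lemma transcriptLaw_eq {loss : Z → Vec d → ℝ}
    (hloss : ∀ z, Measurable (gradient (loss z))) (P : Params d)
    (ν : ℕ → Fin n → Measure U) {K : ℕ → Fin n → U → Vec d → Vec d}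
    (hK : ∀ t i, Measurable (Function.uncurry (K t i))) (D : Fin n → Fin m → Z) (T : ℕ) :
    transcriptLaw loss P ν K T D = ((seedLaw m P ν).map (history loss P K D T)).map
      fun h (t : Fin T) => h t := by
  rw [Measure.map_map (by fun_prop) (measurable_history hloss P hK D T), transcriptLaw]
  congr 1
  funext ρ t i
  simp [transcript, history]

/-- Privacy of the algorithm in terms of the moment order `α`. -/
lemma algorithmIsLDP_of_order (hd : 0 < d) {loss : Z → Vec d → ℝ}
    (hloss : ∀ z, Measurable (gradient (loss z))) (P : Params d) (hb : 0 < P.b) (hbm : P.b ≤ m)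
    (ν : ℕ → Fin n → Measure U) [∀ t i, IsProbabilityMeasure (ν t i)]
    {K : ℕ → Fin n → U → Vec d → Vec d} (hK : ∀ t i, Measurable (Function.uncurry (K t i)))
    {G α ε δ : ℝ} (hG : ∀ z, HasBoundedGradient G (loss z)) (hσ : 0 < P.σ) (hα : 2 ≤ α)
    (hαr : 2 * α * (G / (P.b * P.σ)) ^ 2 ≤ 1 / 64) (hδ : 0 ≤ δ) (T : ℕ)
    (hB : Real.exp (T * (momentConst * (2 * α * (P.b / m) * (G / (P.b * P.σ))) ^ 2)
      - ε * (α - 1)) ≤ δ) :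
    AlgorithmIsLDP m loss P ν K T ε δ := by
  intro i D Di Di' hD S hS
  have := isProbabilityMeasure_seedLaw P hb.le hbm ν
  have hr : Measurable fun (h : ℕ → Fin n → Vec d) (t : Fin T) => h t := by fun_prop
  have hprob : ∀ E, IsProbabilityMeasure (transcriptLaw loss P ν K T E) := fun E => by
    rw [transcriptLaw_eq hloss P ν hK]
    have := Measure.isProbabilityMeasure_map (μ := seedLaw m P ν)
      (measurable_history hloss P hK E T).aemeasurable
    exact Measure.isProbabilityMeasure_map hr.aemeasurable
  have h := (holderDom_history hd hloss P hb hbm ν hK hG hσ hα hαr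
    (D := Function.update D i Di) (D' := Function.update D i Di') (i := i) (by simpa using hD)
    (fun k hk => by simp [hk]) T).map hr
  rw [← transcriptLaw_eq hloss P ν hK, ← transcriptLaw_eq hloss P ν hK] at h
  exact h.le_add (by linarith) hδ hB hS

/-- The constant in the noise variance. -/
noncomputable def noiseConst (A : ℝ) : ℝ := 16 * momentConst * (A + 1) ^ 2

lemma noiseConst_pos {A : ℝ} (hA : 0 < A) : 0 < noiseConst A := by
  have := momentConst_pos
  unfold noiseConst
  positivity

/-- Privacy of the algorithm. -/
lemma algorithmIsLDP (hd : 0 < d) (hm : 0 < m) {loss : Z → Vec d → ℝ}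
    (hloss : ∀ z, Measurable (gradient (loss z))) (P : Params d) (hb : 0 < P.b) (hbm : P.b ≤ m)
    (ν : ℕ → Fin n → Measure U) [∀ t i, IsProbabilityMeasure (ν t i)]
    {K : ℕ → Fin n → U → Vec d → Vec d} (hK : ∀ t i, Measurable (Function.uncurry (K t i)))
    {A G ε δ : ℝ} (hA : 0 < A) (hG0 : 0 < G) (hG : ∀ z, HasBoundedGradient G (loss z))
    (hε : 0 < ε) (hδ : 0 < δ) (hδ1 : δ < 1) {T : ℕ} (hT : 0 < T)
    (hσ : P.σ = √(noiseConst A * (G ^ 2 * T * Real.log (1 / δ) / (m ^ 2 * ε ^ 2))))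
    (h1 : ε ≤ A * Real.log (1 / δ))
    (h2 : ε < noiseConst A / (256 * (A + 1)) * (P.b ^ 2 * T / m ^ 2)) :
    AlgorithmIsLDP m loss P ν K T ε δ := by
  set Λ := Real.log (1 / δ) with hΛ
  set c := noiseConst A with hc
  have hc0 : 0 < c := noiseConst_pos hA
  have hΛ0 : 0 < Λ := Real.log_pos (one_lt_one_div hδ hδ1)
  have hm0 : (0 : ℝ) < m := by exact_mod_cast hm
  have hT0 : (0 : ℝ) < T := by exact_mod_cast hT
  have hσ2 : P.σ ^ 2 = c * (G ^ 2 * T * Λ / (m ^ 2 * ε ^ 2)) := by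
    rw [hσ, Real.sq_sqrt (by positivity)]
  have hσ0 : 0 < P.σ := by rw [hσ]; positivity
  -- With this order `ε (α - 1) = ε + 2Λ`, so a total divergence of at most `Λ` leaves `e^(-Λ) = δ`.
  set α := 2 + 2 * Λ / ε with hα
  have hαε : α * ε = 2 * ε + 2 * Λ := by rw [hα]; field_simp
  have hα2 : 2 ≤ α := by
    have : 0 ≤ 2 * Λ / ε := by positivity
    linarith
  have hαε' : α * ε ≤ 2 * (A + 1) * Λ := by rw [hαε]; nlinarith
  have hratio : (G / (P.b * P.σ)) ^ 2 = m ^ 2 * ε ^ 2 / (P.b ^ 2 * (c * T * Λ)) := by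
    rw [div_pow, mul_pow, hσ2]
    field_simp
  refine algorithmIsLDP_of_order hd hloss P hb hbm ν hK hG hσ0 hα2 ?_ hδ.le T ?_
  -- The validity condition of the moment bounds. From `α ε ≤ 2 (A + 1) Λ` it reduces to the
  -- hypothesis on `ε`, whose constant `256 (A + 1)` is `64 · 4 (A + 1)`.
  · rw [hratio]
    have h3 : ε * (m ^ 2 * (256 * (A + 1))) < c * (P.b ^ 2 * T) := by
      rw [div_mul_div_comm, lt_div_iff₀ (by positivity)] at h2
      linarith
    have h4 : 2 * α * (m ^ 2 * ε ^ 2 / (P.b ^ 2 * (c * T * Λ)))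
        = 2 * (α * ε) * (ε * m ^ 2) / (P.b ^ 2 * (c * T * Λ)) := by ring
    rw [h4, div_le_iff₀ (by positivity)]
    calc 2 * (α * ε) * (ε * m ^ 2) ≤ 2 * (2 * (A + 1) * Λ) * (ε * m ^ 2) := by gcongr
      _ = Λ / 64 * (ε * (m ^ 2 * (256 * (A + 1)))) := by ring
      _ ≤ Λ / 64 * (c * (P.b ^ 2 * T)) := by gcongr
      _ = _ := by ring
  · have h3 : T * (momentConst * (2 * α * (P.b / m) * (G / (P.b * P.σ))) ^ 2)
        = 4 * momentConst * (α * ε) ^ 2 / (c * Λ) := by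
      rw [mul_pow, hratio]
      field_simp
      ring
    -- This fixes `noiseConst`: the left side is at most `4 * momentConst * 4 (A + 1)² Λ / c`, which
    -- equals `Λ`.
    have h4 : 4 * momentConst * (α * ε) ^ 2 / (c * Λ) ≤ Λ := by
      have := momentConst_pos
      rw [div_le_iff₀ (by positivity)]
      calc 4 * momentConst * (α * ε) ^ 2 ≤ 4 * momentConst * (2 * (A + 1) * Λ) ^ 2 := by gcongr
        _ = _ := by rw [hc, noiseConst]; ring
    have h5 : ε * (α - 1) = ε + 2 * Λ := by linarith
    rw [h3, h5]
    calc _ ≤ Real.exp (-Λ) := Real.exp_le_exp.2 (by linarith)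
      _ = δ := by rw [hΛ, ← Real.log_inv, Real.exp_log (by positivity)]; simp

end Transcript

end SoteriaFL

namespace SoteriaFL

/-! ### Averages of smooth functions and the descent lemma. -/

section Smoothness

variable {d : ℕ}

lemma hasGradientAt_average {ι : Type*} (J : Finset ι) {g : ι → Vec d → ℝ}
    (hg : ∀ j, Differentiable ℝ (g j)) (c : ℝ) (x : Vec d) :
    HasGradientAt (fun x => c * ∑ j ∈ J, g j x) (c • ∑ j ∈ J, gradient (g j) x) x := by
  rw [hasGradientAt_iff_hasFDerivAt, map_smul, map_sum]
  have := (HasFDerivAt.fun_sum fun j (_ : j ∈ J) =>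
    ((hg j x).hasGradientAt.hasFDerivAt)).const_mul c
  exact this

lemma IsSmooth.average {N : ℕ} (hN : 0 < N) {L : ℝ} {g : Fin N → Vec d → ℝ}
    (hg : ∀ j, IsSmooth L (g j)) : IsSmooth L fun x => (1 / (N : ℝ)) * ∑ j, g j x := by
  have hN' : (0 : ℝ) < N := by exact_mod_cast hN
  have h := fun x => hasGradientAt_average Finset.univ (fun j => (hg j).1) (1 / (N : ℝ)) x
  refine ⟨fun x => (h x).differentiableAt, fun x y => ?_⟩
  rw [(h x).gradient, (h y).gradient, ← smul_sub, ← Finset.sum_sub_distrib, norm_smul,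
    Real.norm_of_nonneg (by positivity)]
  calc 1 / (N : ℝ) * ‖∑ j, (gradient (g j) x - gradient (g j) y)‖
      ≤ 1 / (N : ℝ) * ∑ _j : Fin N, L * ‖x - y‖ := by
        gcongr
        exact norm_sum_le_of_le _ fun j _ => (hg j).2 x y
    _ = L * ‖x - y‖ := by simp; field_simp

lemma HasBoundedGradient.average {N : ℕ} (hN : 0 < N) {G L : ℝ} {g : Fin N → Vec d → ℝ}
    (hs : ∀ j, IsSmooth L (g j)) (hg : ∀ j, HasBoundedGradient G (g j)) :
    HasBoundedGradient G fun x => (1 / (N : ℝ)) * ∑ j, g j x := by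
  have hN' : (0 : ℝ) < N := by exact_mod_cast hN
  intro x
  rw [(hasGradientAt_average Finset.univ (fun j => (hs j).1) (1 / (N : ℝ)) x).gradient, norm_smul,
    Real.norm_of_nonneg (by positivity)]
  calc 1 / (N : ℝ) * ‖∑ j, gradient (g j) x‖ ≤ 1 / (N : ℝ) * ∑ _j : Fin N, G := by
        gcongr
        exact norm_sum_le_of_le _ fun j _ => hg j x
    _ = G := by simp; field_simp

/-- The descent lemma. -/
lemma IsSmooth.descent {L : ℝ} {g : Vec d → ℝ} (hg : IsSmooth L g) (x p : Vec d) :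
    g (x + p) ≤ g x + inner ℝ (gradient g x) p + L / 2 * ‖p‖ ^ 2 := by
  -- The difference of the two sides along the segment, up to a constant; the Lipschitz bound on the
  -- gradient makes its derivative nonpositive on `(0, 1)`.
  let φ : ℝ → ℝ := fun t => g (x + t • p) - t * inner ℝ (gradient g x) p - L / 2 * t ^ 2 * ‖p‖ ^ 2
  have hder : ∀ t, HasDerivAt φ (inner ℝ (gradient g (x + t • p)) p - inner ℝ (gradient g x) p
      - L * t * ‖p‖ ^ 2) t := by
    intro t
    have h1 : HasDerivAt (fun t : ℝ => x + t • p) p t := by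
      simpa using ((hasDerivAt_id t).smul_const p).const_add x
    have h2 := (hg.1 (x + t • p)).hasGradientAt.hasFDerivAt.comp_hasDerivAt t h1
    have h3 := (hasDerivAt_id t).mul_const (inner ℝ (gradient g x) p)
    have h4 := (((hasDerivAt_id t).pow 2).const_mul (L / 2)).mul_const (‖p‖ ^ 2)
    have h5 := (h2.sub h3).sub h4
    simp only [InnerProductSpace.toDual_apply_apply, id, one_mul, Function.comp_def] at h5
    refine h5.congr_deriv ?_
    push_cast
    ring
  have hanti : AntitoneOn φ (Set.Icc 0 1) := by
    refine antitoneOn_of_deriv_nonpos (convex_Icc 0 1)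
      (fun t _ => (hder t).continuousAt.continuousWithinAt)
      (fun t _ => (hder t).differentiableAt.differentiableWithinAt) fun t ht => ?_
    rw [interior_Icc] at ht
    rw [(hder t).deriv, ← inner_sub_left]
    have h1 := real_inner_le_norm (gradient g (x + t • p) - gradient g x) p
    have h2 := hg.2 (x + t • p) x
    rw [add_sub_cancel_left, norm_smul, Real.norm_of_nonneg ht.1.le] at h2
    have := mul_le_mul_of_nonneg_right h2 (norm_nonneg p)
    nlinarith
  have h := hanti (Set.left_mem_Icc.2 zero_le_one) (Set.right_mem_Icc.2 zero_le_one) zero_le_one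
  simp only [φ, one_smul, zero_smul, add_zero] at h
  linarith

end Smoothness

/-! ### Orthogonality of centered random vectors. -/

section SecondMoments

variable {E : Type*} [NormedAddCommGroup E] [InnerProductSpace ℝ E]

lemma integrable_inner_of_memLp {X : Type*} [MeasurableSpace X] {μ : Measure X} {f g : X → E}
    (hf : MemLp f 2 μ) (hg : MemLp g 2 μ) : Integrable (fun x => inner ℝ (f x) (g x)) μ := by
  refine ((hf.integrable_norm_pow two_ne_zero).add (hg.integrable_norm_pow two_ne_zero)).mono'
    (hf.1.inner hg.1) (Filter.Eventually.of_forall fun x => ?_)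
  have := norm_inner_le_norm (𝕜 := ℝ) (f x) (g x)
  simp only [Pi.add_apply]
  nlinarith [sq_nonneg (‖f x‖ - ‖g x‖), norm_nonneg (f x), norm_nonneg (g x)]

lemma integral_norm_add_sq {X : Type*} [MeasurableSpace X] {μ : Measure X} {f g : X → E}
    (hf : MemLp f 2 μ) (hg : MemLp g 2 μ) (h : ∫ x, inner ℝ (f x) (g x) ∂μ = 0) :
    ∫ x, ‖f x + g x‖ ^ 2 ∂μ = ∫ x, ‖f x‖ ^ 2 ∂μ + ∫ x, ‖g x‖ ^ 2 ∂μ := by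
  simp only [norm_add_sq_real]
  have h1 := hf.integrable_norm_pow two_ne_zero
  have h2 := hg.integrable_norm_pow two_ne_zero
  have h3 := (integrable_inner_of_memLp hf hg).const_mul 2
  rw [integral_add (f := fun x => ‖f x‖ ^ 2 + 2 * inner ℝ (f x) (g x)) (h1.add h3) h2,
    integral_add h1 h3, integral_const_mul, h]
  ring

lemma integral_norm_const_add_sq [CompleteSpace E] {X : Type*} [MeasurableSpace X] {μ : Measure X}
    [IsProbabilityMeasure μ] {g : X → E} (c : E)
    (hg : MemLp g 2 μ) (h : ∫ x, g x ∂μ = 0) :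
    ∫ x, ‖c + g x‖ ^ 2 ∂μ = ‖c‖ ^ 2 + ∫ x, ‖g x‖ ^ 2 ∂μ := by
  rw [integral_norm_add_sq (memLp_const c) hg]
  · simp
  · rw [integral_inner (hg.integrable one_le_two), h, inner_zero_right]

/-- Second moment of a sum, when the second term is conditionally centered. -/
lemma integral_norm_add_sq_prod [CompleteSpace E] {X Y : Type*} [MeasurableSpace X]
    [MeasurableSpace Y]
    {μ : Measure X} {κ : Measure Y} [IsProbabilityMeasure μ] [IsProbabilityMeasure κ]
    {f : X → E} {g : X × Y → E} (hf : MemLp f 2 μ) (hg : MemLp g 2 (μ.prod κ))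
    (hc : ∀ x, ∫ y, g (x, y) ∂κ = 0) :
    ∫ z, ‖f z.1 + g z‖ ^ 2 ∂(μ.prod κ)
      = ∫ x, ‖f x‖ ^ 2 ∂μ + ∫ z, ‖g z‖ ^ 2 ∂(μ.prod κ) := by
  have hf' : MemLp (fun z : X × Y => f z.1) 2 (μ.prod κ) :=
    hf.comp_measurePreserving measurePreserving_fst
  have hgi : Integrable g (μ.prod κ) := hg.integrable one_le_two
  rw [integral_norm_add_sq hf' hg]
  · rw [integral_fun_fst (fun x => ‖f x‖ ^ 2)]
    simp
  · rw [integral_prod _ (integrable_inner_of_memLp hf' hg)]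
    refine integral_eq_zero_of_ae ?_
    filter_upwards [hgi.prod_right_ae] with x hx
    simp only [Pi.zero_apply]
    rw [integral_inner hx, hc, inner_zero_right]

/-- Second moment of a sum of independent centered vectors. -/
lemma integral_norm_sum_sq [CompleteSpace E] [MeasurableSpace E] [BorelSpace E]
    {ι : Type*} [Fintype ι] {S : ι → Type*} [∀ i, MeasurableSpace (S i)]
    {κ : ∀ i, Measure (S i)} [∀ i, IsProbabilityMeasure (κ i)] {f : ∀ i, S i → E}
    (hf : ∀ i, MemLp (f i) 2 (κ i)) (h0 : ∀ i, ∫ x, f i x ∂(κ i) = 0) :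
    ∫ ω, ‖∑ i, f i (ω i)‖ ^ 2 ∂(Measure.pi κ) = ∑ i, ∫ x, ‖f i x‖ ^ 2 ∂(κ i) := by
  classical
  have hf' : ∀ i, MemLp (fun ω : ∀ i, S i => f i (ω i)) 2 (Measure.pi κ) := fun i =>
    (hf i).comp_measurePreserving (measurePreserving_eval κ i)
  have hint : ∀ i j, Integrable (fun ω : ∀ i, S i => inner ℝ (f i (ω i)) (f j (ω j)))
      (Measure.pi κ) := fun i j => integrable_inner_of_memLp (hf' i) (hf' j)
  have hind : iIndepFun (fun i (ω : ∀ i, S i) => f i (ω i)) (Measure.pi κ) :=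
    iIndepFun_pi fun i => (hf i).1.aemeasurable
  have hij : ∀ i j, ∫ ω, inner ℝ (f i (ω i)) (f j (ω j)) ∂(Measure.pi κ)
      = if i = j then ∫ x, ‖f i x‖ ^ 2 ∂(κ i) else 0 := by
    intro i j
    split_ifs with h
    · subst h
      simp only [real_inner_self_eq_norm_sq]
      exact integral_comp_eval (f := fun x => ‖f i x‖ ^ 2) ((hf i).1.norm.pow 2)
    · have := (hind.indepFun h).integral_bilin ((hf' i).integrable one_le_two)
        ((hf' j).integrable one_le_two) (innerSL ℝ)
      simp only [innerSL_apply_apply ℝ] at this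
      rw [this, integral_comp_eval (f := f i) (hf i).1, h0, inner_zero_left]
  have hexp : ∀ ω : ∀ i, S i, ‖∑ i, f i (ω i)‖ ^ 2
      = ∑ i, ∑ j, inner ℝ (f i (ω i)) (f j (ω j)) := fun ω => by
    rw [← real_inner_self_eq_norm_sq, sum_inner]
    simp only [inner_sum]
  simp only [hexp]
  rw [integral_finsetSum _ fun i _ => integrable_finsetSum _ fun j _ => hint i j]
  refine Finset.sum_congr rfl fun i _ => ?_
  rw [integral_finsetSum _ fun j _ => hint i j]
  simp [hij]

end SecondMoments

end SoteriaFL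

namespace SoteriaFL

/-! ### Mean and variance of a message. -/

section ClientMoments

variable {d m : ℕ}

lemma integral_norm_sq_stdGaussian : ∫ z, ‖z‖ ^ 2 ∂(stdGaussian (Vec d)) = d := by
  have hcoord : ∀ i : Fin d, ∫ z : Vec d, z i ^ 2 ∂(stdGaussian (Vec d)) = 1 := fun i => by
    have h1 := stdGaussian_map_inner (d := d) (e := EuclideanSpace.single i 1) (by simp)
    have h2 : ∫ x, x ^ 2 ∂(gaussianReal 0 1) = 1 := by
      have := variance_id_gaussianReal (μ := 0) (v := 1)
      rw [variance_of_integral_eq_zero aemeasurable_id (by simp)] at this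
      simpa using this
    rw [← h1, integral_map (by fun_prop) (by fun_prop)] at h2
    simpa [EuclideanSpace.inner_single_left] using h2
  have hint : ∀ i : Fin d, Integrable (fun z : Vec d => z i ^ 2) (stdGaussian (Vec d)) := fun i =>
    Integrable.of_integral_ne_zero (by rw [hcoord]; exact one_ne_zero)
  simp only [EuclideanSpace.real_norm_sq_eq]
  rw [integral_finsetSum _ fun i _ => hint i]
  simp [hcoord]

lemma memLp_gaussianNoise (σ : ℝ) : MemLp (fun z : Vec d => z) 2 (gaussianNoise d σ) := by
  rw [gaussianNoise, memLp_map_measure_iff (by fun_prop) (by fun_prop)]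
  exact (IsGaussian.memLp_two_id (μ := stdGaussian (Vec d))).const_smul σ

lemma integral_gaussianNoise (σ : ℝ) : ∫ z, z ∂(gaussianNoise d σ) = 0 := by
  rw [gaussianNoise, integral_map (by fun_prop) (by fun_prop), integral_smul,
    integral_id_stdGaussian, smul_zero]

lemma integral_norm_sq_gaussianNoise (σ : ℝ) :
    ∫ z, ‖z‖ ^ 2 ∂(gaussianNoise d σ) = σ ^ 2 * d := by
  rw [gaussianNoise, integral_map (by fun_prop) (by fun_prop)]
  simp only [norm_smul, mul_pow, Real.norm_eq_abs, sq_abs]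
  rw [integral_const_mul, integral_norm_sq_stdGaussian]

lemma integral_coinLaw {E : Type*} [NormedAddCommGroup E] [NormedSpace ℝ E] [CompleteSpace E]
    {q : ℝ} (hq : 0 ≤ q) (hq1 : q ≤ 1) (f : Bool → E) :
    ∫ β, f β ∂(coinLaw q) = q • f true + (1 - q) • f false := by
  have hi : ∀ β, Integrable f (Measure.dirac β) := fun β =>
    integrable_dirac (by simp)
  rw [coinLaw, integral_add_measure ((hi _).smul_measure (by simp))
    ((hi _).smul_measure (by simp)), integral_smul_measure, integral_smul_measure, integral_dirac,
    integral_dirac, ENNReal.toReal_ofReal hq, ENNReal.toReal_ofReal (by linarith)]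

lemma gradient_clientObjective {Z : Type u} {loss : Z → Vec d → ℝ} {L : ℝ}
    (hL : ∀ z, IsSmooth L (loss z)) (Di : Fin m → Z) (x : Vec d) :
    gradient (clientObjective loss Di) x = (1 / (m : ℝ)) • ∑ j, gradient (loss (Di j)) x :=
  (hasGradientAt_average Finset.univ (fun j => (hL (Di j)).1) (1 / (m : ℝ)) x).gradient

/-- The fluctuation of the local SGD estimator. -/
lemma localGradient_sub {Z : Type u} {loss : Z → Vec d → ℝ} {L : ℝ}
    (hL : ∀ z, IsSmooth L (loss z)) {b : ℝ} (hb : 0 < b) (Di : Fin m → Z) (I : Fin m → Bool)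
    (x : Vec d) :
    localGradient loss b Di I x - gradient (clientObjective loss Di) x
      = ∑ j, ((1 / b) * ((if I j then 1 else 0) - b / m)) • gradient (loss (Di j)) x := by
  have e : ∀ j, ((1 / b) * ((if I j then 1 else 0) - b / m)) • gradient (loss (Di j)) x
      = (1 / b) • (if I j then gradient (loss (Di j)) x else 0)
        - (1 / (m : ℝ)) • gradient (loss (Di j)) x := fun j => by
    rw [mul_sub, sub_smul, mul_smul, show 1 / b * (b / m) = 1 / (m : ℝ) by field_simp]
    congr 2
    split_ifs <;> simp
  rw [gradient_clientObjective hL, localGradient, Finset.sum_congr rfl fun j _ => e j,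
    Finset.sum_sub_distrib, Finset.smul_sum, Finset.smul_sum]

/-- The fluctuation is a sum of independent centered terms, one per sample, so variances add. The
factor `1 - b / m` is kept because it vanishes for full batches, the GD case. -/
lemma integral_localGradient_sub {Z : Type u} {loss : Z → Vec d → ℝ} {L G : ℝ}
    (hL : ∀ z, IsSmooth L (loss z)) (hG : ∀ z, HasBoundedGradient G (loss z)) {b : ℝ} (hb : 0 < b)
    (hbm : b ≤ m) (Di : Fin m → Z) (x : Vec d) :
    ∫ I, (localGradient loss b Di I x - gradient (clientObjective loss Di) x)
        ∂(minibatchLaw m b) = 0 ∧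
    ∫ I, ‖localGradient loss b Di I x - gradient (clientObjective loss Di) x‖ ^ 2
        ∂(minibatchLaw m b) ≤ (1 - b / m) * (G ^ 2 / b) := by
  have hm0 : (0 : ℝ) < m := hb.trans_le hbm
  have hq : 0 ≤ b / m := by positivity
  have hq1 : b / m ≤ 1 := div_le_one_of_le₀ hbm hm0.le
  have := isProbabilityMeasure_coinLaw hq hq1
  let f : Fin m → Bool → Vec d := fun j β =>
    ((1 / b) * ((if β then 1 else 0) - b / m)) • gradient (loss (Di j)) x
  have hf : ∀ j, MemLp (f j) 2 (coinLaw (b / m)) := fun j => MemLp.of_discrete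
  have hmean : ∀ j, ∫ β, f j β ∂(coinLaw (b / m)) = 0 := fun j => by
    rw [integral_coinLaw hq hq1]
    simp only [f, if_true, Bool.false_eq_true, if_false, smul_smul]
    rw [← add_smul]
    convert zero_smul ℝ _
    ring
  simp only [localGradient_sub hL hb]
  rw [minibatchLaw_eq]
  constructor
  · rw [integral_finsetSum]
    · refine Finset.sum_eq_zero fun j _ => ?_
      have := integral_comp_eval (μ := fun _ : Fin m => coinLaw (b / m)) (i := j) (f := f j)
        (hf j).1
      exact this.trans (hmean j)
    · intro j _
      exact Integrable.of_finite
  · have h := integral_norm_sum_sq hf hmean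
    simp only [f] at h
    rw [h]
    have hj : ∀ j, ∫ β : Bool, ‖((1 / b) * ((if β then 1 else 0) - b / m)) •
        gradient (loss (Di j)) x‖ ^ 2 ∂(coinLaw (b / m))
        ≤ (1 - b / m) * (G ^ 2 / (b * m)) := fun j => by
      rw [integral_coinLaw hq hq1]
      simp only [if_true, Bool.false_eq_true, if_false, norm_smul, mul_pow, Real.norm_eq_abs,
        sq_abs, smul_eq_mul]
      have e : b / m * ((1 / b * (1 - b / m)) ^ 2 * ‖gradient (loss (Di j)) x‖ ^ 2)
          + (1 - b / m) * ((1 / b * (0 - b / m)) ^ 2 * ‖gradient (loss (Di j)) x‖ ^ 2)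
          = (1 - b / m) * (‖gradient (loss (Di j)) x‖ ^ 2 / (b * m)) := by
        field_simp
        ring
      have h1 : 0 ≤ 1 - b / m := by linarith
      simp only [mul_pow] at e
      rw [e]
      gcongr
      exact hG _ x
    calc _ ≤ ∑ _j : Fin m, (1 - b / m) * (G ^ 2 / (b * m)) := Finset.sum_le_sum fun j _ => hj j
      _ = _ := by simp; field_simp

/-- The variance of the perturbed local gradient. -/
noncomputable def noiseLevel (m d : ℕ) (G b σ : ℝ) : ℝ := (1 - b / m) * (G ^ 2 / b) + σ ^ 2 * d

lemma perturbedGradient_moments {Z : Type u} {loss : Z → Vec d → ℝ} {L G : ℝ}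
    (hL : ∀ z, IsSmooth L (loss z)) (hG : ∀ z, HasBoundedGradient G (loss z)) {b : ℝ} (hb : 0 < b)
    (hbm : b ≤ m) (σ : ℝ) (Di : Fin m → Z) (x s : Vec d) :
    let Y : (Fin m → Bool) × Vec d → Vec d := fun w => localGradient loss b Di w.1 x + w.2 - s
    let h := gradient (clientObjective loss Di) x - s
    let μ := (minibatchLaw m b).prod (gaussianNoise d σ)
    MemLp Y 2 μ ∧ ∫ w, Y w ∂μ = h ∧ ∫ w, ‖Y w - h‖ ^ 2 ∂μ ≤ noiseLevel m d G b σ := by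
  intro Y h μ
  have := isProbabilityMeasure_minibatchLaw hb.le hbm
  set g := gradient (clientObjective loss Di) x with hg
  have h1 : MemLp (fun I => localGradient loss b Di I x - g) 2 (minibatchLaw m b) :=
    MemLp.of_discrete
  have h2 : MemLp (fun w : (Fin m → Bool) × Vec d => w.2) 2 μ :=
    (memLp_gaussianNoise σ).comp_measurePreserving measurePreserving_snd
  have h1' : MemLp (fun w : (Fin m → Bool) × Vec d => localGradient loss b Di w.1 x - g) 2 μ :=
    h1.comp_measurePreserving measurePreserving_fst
  obtain ⟨hm1, hv1⟩ := integral_localGradient_sub hL hG hb hbm Di x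
  have hY : ∀ w, Y w - h = (localGradient loss b Di w.1 x - g) + w.2 := fun w => by
    simp only [Y, h]
    abel
  have hY' : Y = fun w => ((localGradient loss b Di w.1 x - g) + w.2) + h := by
    funext w
    rw [← hY, sub_add_cancel]
  refine ⟨?_, ?_, ?_⟩
  · rw [hY']
    exact (h1'.add h2).add (memLp_const h)
  · have i12 : Integrable (fun w : (Fin m → Bool) × Vec d =>
        (localGradient loss b Di w.1 x - g) + w.2) μ := (h1'.add h2).integrable one_le_two
    rw [hY', integral_add i12 (integrable_const _),
      integral_add (h1'.integrable one_le_two) (h2.integrable one_le_two),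
      integral_fun_fst (fun I => localGradient loss b Di I x - g), hm1,
      integral_fun_snd (fun z : Vec d => z), integral_gaussianNoise]
    simp
  · simp only [hY]
    rw [integral_norm_add_sq_prod h1 h2 fun _ => integral_gaussianNoise σ,
      integral_fun_snd (fun z : Vec d => ‖z‖ ^ 2), integral_norm_sq_gaussianNoise]
    simpa [noiseLevel] using hv1

/-- Mean and variance of a compressed random vector. -/
lemma compression_moments {X U : Type*} [MeasurableSpace X] [MeasurableSpace U] {μ : Measure X}
    {ν : Measure U} [IsProbabilityMeasure μ] [IsProbabilityMeasure ν] {K : U → Vec d → Vec d}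
    {ω : ℝ} (hω : 0 ≤ ω) (hK : IsCompressionOperator ν K ω) {Y : X → Vec d} (hYm : Measurable Y)
    (hY : MemLp Y 2 μ) {h : Vec d} (hm : ∫ w, Y w ∂μ = h) {N : ℝ}
    (hN : ∫ w, ‖Y w - h‖ ^ 2 ∂μ ≤ N) :
    MemLp (fun z : X × U => K z.2 (Y z.1)) 2 (μ.prod ν) ∧
    ∫ z, K z.2 (Y z.1) ∂(μ.prod ν) = h ∧
    ∫ z, ‖K z.2 (Y z.1) - h‖ ^ 2 ∂(μ.prod ν) ≤ ω * ‖h‖ ^ 2 + (1 + ω) * N := by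
  set g : X × U → Vec d := fun z => K z.2 (Y z.1) - Y z.1 with hg
  have hKm : Measurable fun z : X × U => K z.2 (Y z.1) :=
    hK.measurable.comp (f := fun z : X × U => (z.2, Y z.1)) (by fun_prop)
  have hgm : Measurable g := hKm.sub (hYm.comp measurable_fst)
  have hYi : Integrable (fun w => ‖Y w‖ ^ 2) μ := hY.integrable_norm_pow two_ne_zero
  have hlint : ∫⁻ z, ENNReal.ofReal (‖g z‖ ^ 2) ∂(μ.prod ν)
      ≤ ENNReal.ofReal (ω * ∫ w, ‖Y w‖ ^ 2 ∂μ) := by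
    rw [lintegral_prod _ (by fun_prop), ← integral_const_mul,
      ofReal_integral_eq_lintegral_ofReal (hYi.const_mul ω)
        (Filter.Eventually.of_forall fun w => by positivity)]
    exact lintegral_mono fun w => hK.variance (Y w)
  have hgi : Integrable (fun z => ‖g z‖ ^ 2) (μ.prod ν) := by
    refine ⟨by fun_prop, ?_⟩
    rw [hasFiniteIntegral_iff_ofReal (Filter.Eventually.of_forall fun z => by positivity)]
    exact hlint.trans_lt ENNReal.ofReal_lt_top
  have hg2 : MemLp g 2 (μ.prod ν) :=
    (memLp_two_iff_integrable_sq_norm hgm.aestronglyMeasurable).2 hgi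
  have hgv : ∫ z, ‖g z‖ ^ 2 ∂(μ.prod ν) ≤ ω * ∫ w, ‖Y w‖ ^ 2 ∂μ := by
    rw [← ofReal_integral_eq_lintegral_ofReal hgi
      (Filter.Eventually.of_forall fun z => by positivity)] at hlint
    exact (ENNReal.ofReal_le_ofReal_iff
      (mul_nonneg hω (integral_nonneg fun w => by positivity))).1 hlint
  -- Unbiasedness is used conditionally on `Y`; the integrability needed to split the integral comes
  -- from the variance bound at each fixed input.
  have hc : ∀ w, ∫ r, g (w, r) ∂ν = 0 := fun w => by
    have hvar : Integrable (fun r => K r (Y w) - Y w) ν := by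
      have hm' : Measurable fun r => K r (Y w) - Y w := by
        have := hK.measurable.comp (measurable_prodMk_right (y := Y w) (α := U))
        exact this.sub_const _
      refine MemLp.integrable one_le_two
        ((memLp_two_iff_integrable_sq_norm hm'.aestronglyMeasurable).2
          ⟨(hm'.norm.pow_const 2).aestronglyMeasurable, ?_⟩)
      rw [hasFiniteIntegral_iff_ofReal (Filter.Eventually.of_forall fun z => by positivity)]
      exact (hK.variance (Y w)).trans_lt ENNReal.ofReal_lt_top
    have hi : Integrable (fun r => K r (Y w)) ν := by
      refine (hvar.add (integrable_const (Y w))).congr (Filter.Eventually.of_forall fun r => ?_)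
      simp
    simp only [hg]
    rw [integral_sub hi (integrable_const _), hK.unbiased]
    simp
  have hY' : MemLp (fun z : X × U => Y z.1) 2 (μ.prod ν) :=
    hY.comp_measurePreserving measurePreserving_fst
  have hsplit : (fun z : X × U => K z.2 (Y z.1)) = fun z => Y z.1 + g z := by
    funext z
    simp [hg]
  have hYh : MemLp (fun w => Y w - h) 2 μ := hY.sub (memLp_const h)
  have hmean0 : ∫ w, (Y w - h) ∂μ = 0 := by
    rw [integral_sub (hY.integrable one_le_two) (integrable_const _), hm]
    simp
  refine ⟨?_, ?_, ?_⟩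
  · rw [hsplit]
    exact hY'.add hg2
  · rw [hsplit, integral_add (hY'.integrable one_le_two) (hg2.integrable one_le_two),
      integral_fun_fst Y, hm, integral_prod _ (hg2.integrable one_le_two)]
    simp [hc]
  · have e1 : ∀ z : X × U, K z.2 (Y z.1) - h = (Y z.1 - h) + g z := fun z => by
      simp only [hg]
      abel
    simp only [e1]
    rw [integral_norm_add_sq_prod hYh hg2 hc]
    -- The compression error is relative to `‖Y‖²`, whose mean is `‖h‖²` plus the variance of `Y`.
    -- The variance thus enters with `ω` from compression and with `1` directly.
    have e2 : ∫ w, ‖Y w‖ ^ 2 ∂μ = ‖h‖ ^ 2 + ∫ w, ‖Y w - h‖ ^ 2 ∂μ := by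
      rw [← integral_norm_const_add_sq h hYh hmean0]
      simp
    rw [e2] at hgv
    nlinarith

/-- Mean and variance of the message of a client. -/
lemma message_moments {Z : Type u} {U : Type v} [MeasurableSpace U] {loss : Z → Vec d → ℝ}
    {L G : ℝ} (hL : ∀ z, IsSmooth L (loss z)) (hG : ∀ z, HasBoundedGradient G (loss z)) {b : ℝ}
    (hb : 0 < b) (hbm : b ≤ m) (σ : ℝ) {ν : Measure U} [IsProbabilityMeasure ν]
    {K : U → Vec d → Vec d} {ω : ℝ} (hω : 0 ≤ ω) (hK : IsCompressionOperator ν K ω)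
    (Di : Fin m → Z) (x s : Vec d) :
    let h := gradient (clientObjective loss Di) x - s
    MemLp (message loss b K Di x s) 2 (clientLaw m d b σ ν) ∧
    ∫ r, message loss b K Di x s r ∂(clientLaw m d b σ ν) = h ∧
    ∫ r, ‖message loss b K Di x s r - h‖ ^ 2 ∂(clientLaw m d b σ ν)
      ≤ ω * ‖h‖ ^ 2 + (1 + ω) * noiseLevel m d G b σ := by
  intro h
  have := isProbabilityMeasure_minibatchLaw hb.le hbm
  obtain ⟨h1, h2, h3⟩ := perturbedGradient_moments hL hG hb hbm σ Di x s
  have hYm : Measurable fun w : (Fin m → Bool) × Vec d =>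
      localGradient loss b Di w.1 x + w.2 - s := by
    have : Measurable fun w : (Fin m → Bool) × Vec d => localGradient loss b Di w.1 x :=
      (measurable_localGradient loss b Di x).comp measurable_fst
    fun_prop
  obtain ⟨c1, c2, c3⟩ := compression_moments hω hK hYm h1 h2 h3
  have hp := (measurePreserving_prodAssoc (minibatchLaw m b) (gaussianNoise d σ) ν).symm
  have hme := (MeasurableEquiv.prodAssoc (α := Fin m → Bool) (β := Vec d)
    (γ := U)).symm.measurableEmbedding
  refine ⟨c1.comp_measurePreserving hp, ?_, ?_⟩
  · exact (hp.integral_comp hme _).trans c2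
  · exact (hp.integral_comp hme fun z : ((Fin m → Bool) × Vec d) × U =>
      ‖K z.2 (localGradient loss b Di z.1.1 x + z.1.2 - s) - h‖ ^ 2).trans_le c3

end ClientMoments

end SoteriaFL

namespace SoteriaFL

/-! ### Expected decrease of the potential in one round. -/

section Step

variable {d n m : ℕ}

/-- Young's inequality; the defect is a square. With `p = 2 (1 + ω)` the second weight is close
enough to `1` to preserve the contraction of the references. -/
lemma norm_add_sq_le_weighted {E : Type*} [NormedAddCommGroup E]
    {p : ℝ} (hp : 1 < p) (a b : E) :
    ‖a + b‖ ^ 2 ≤ p * ‖a‖ ^ 2 + p / (p - 1) * ‖b‖ ^ 2 := by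
  have hp1 : 0 < p - 1 := by linarith
  have h1 : ‖a + b‖ ^ 2 ≤ (‖a‖ + ‖b‖) ^ 2 := by gcongr; exact norm_add_le a b
  have h2 : p * ‖a‖ ^ 2 + p / (p - 1) * ‖b‖ ^ 2 - (‖a‖ + ‖b‖) ^ 2
      = ((p - 1) * ‖a‖ - ‖b‖) ^ 2 / (p - 1) := by
    field_simp
    ring
  have h3 : 0 ≤ ((p - 1) * ‖a‖ - ‖b‖) ^ 2 / (p - 1) := by positivity
  linarith

lemma shiftStepsize_sq {ω : ℝ} (hω : 0 ≤ ω) :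
    shiftStepsize ω ^ 2 = (1 + 2 * ω) / (2 * (1 + ω) ^ 3) :=
  Real.sq_sqrt (by positivity)

/-- The shift stepsize makes the references contract towards the local gradients. -/
lemma shiftStepsize_contraction {ω : ℝ} (hω : 0 ≤ ω) :
    (1 - shiftStepsize ω) ^ 2 + shiftStepsize ω ^ 2 * ω
      ≤ ((2 * (1 + ω) - 1) / (2 * (1 + ω))) ^ 2 := by
  have hu : 0 < 1 + ω := by linarith
  -- Since `γ²` is explicit, only `-2γ` has to be estimated. This lower bound is exactly the value
  -- that turns the claim into the identity `h3` below.
  have h1 : (8 * (1 + ω) - 3) / (8 * (1 + ω) ^ 2) ≤ shiftStepsize ω := by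
    refine Real.le_sqrt_of_sq_le ?_
    rw [div_pow, div_le_div_iff₀ (by positivity) (by positivity)]
    have : 0 ≤ (1 + ω) ^ 3 * (16 * (1 + ω) - 9) := mul_nonneg (by positivity) (by linarith)
    nlinarith
  have h2 : (1 - shiftStepsize ω) ^ 2 + shiftStepsize ω ^ 2 * ω
      = 1 - 2 * shiftStepsize ω + (1 + ω) * shiftStepsize ω ^ 2 := by ring
  rw [h2, shiftStepsize_sq hω]
  have h3 : ((2 * (1 + ω) - 1) / (2 * (1 + ω))) ^ 2
      = 1 - 2 * ((8 * (1 + ω) - 3) / (8 * (1 + ω) ^ 2))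
        + (1 + ω) * ((1 + 2 * ω) / (2 * (1 + ω) ^ 3)) := by
    field_simp
    ring
  rw [h3]
  linarith

/-- The coefficient of the reference errors in the potential. -/
noncomputable def shiftWeight (L ω τ : ℝ) : ℝ := τ ^ 2 / ((1 + 2 * τ) * ((1 + ω) * L))

/-- Scalar bookkeeping: `g` stands for `‖∇f‖²`, `S` for the mean squared reference error, `V` for
the variance of the server direction and `W` for the mean message variance. `shiftWeight` is chosen
so that the contribution of `S` through `V` is paid for by the contraction of the references. -/
lemma step_inequality {L ω τ η N S V W g : ℝ} {n : ℕ} (hn : 0 < n) (hL : 0 < L) (hω : 0 ≤ ω)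
    (hτ : 0 < τ) (hτn : τ ^ 2 = (1 + ω) ^ 3 / n) (hη : 0 < η) (hηL : η ≤ 1 / ((1 + 2 * τ) * L))
    (hS : 0 ≤ S) (hg : 0 ≤ g) (hN : 0 ≤ N)
    (hV : V ≤ (ω * S + (1 + ω) * N) / n) (hW : W ≤ ω * S + (1 + ω) * N) :
    -η * g + L / 2 * η ^ 2 * (g + V) + shiftWeight L ω τ *
      (2 * (1 + ω) * (L ^ 2 * η ^ 2 * (g + V)) + 2 * (1 + ω) / (2 * (1 + ω) - 1) *
        ((1 - shiftStepsize ω) ^ 2 * S + shiftStepsize ω ^ 2 * W))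
      ≤ shiftWeight L ω τ * S - η / 2 * g
        + 3 / 2 * ((1 + ω) / n * N) / (L * (1 + 2 * τ)) := by
  have hn' : (0 : ℝ) < n := by exact_mod_cast hn
  set u := 1 + ω with hu
  have hu0 : 0 < u := by linarith
  have hu1 : 0 < 2 * u - 1 := by linarith
  have ha : 0 < 1 + 2 * τ := by linarith
  set B := shiftWeight L ω τ with hB
  have hB0 : 0 ≤ B := by rw [hB, shiftWeight]; positivity
  have hun : u / n = τ ^ 2 / u ^ 2 := by rw [hτn]; field_simp
  have hha : L * η * (1 + 2 * τ) ≤ 1 := by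
    rw [le_div_iff₀ (by positivity)] at hηL
    linarith
  set c₁ := L * η * (1 / 2 + 2 * τ ^ 2 / (1 + 2 * τ)) with hc1
  have hc10 : 0 ≤ c₁ := by positivity
  have hc1le : c₁ ≤ 1 / 2 := by
    have h1 : 1 / 2 + 2 * τ ^ 2 / (1 + 2 * τ) ≤ (1 + 2 * τ) / 2 := by
      rw [div_add_div _ _ two_ne_zero ha.ne', div_le_div_iff₀ (by positivity) two_pos]
      nlinarith
    calc c₁ ≤ L * η * ((1 + 2 * τ) / 2) := by rw [hc1]; gcongr
      _ ≤ 1 / 2 := by linarith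
  have e1 : L / 2 * η ^ 2 * (g + V) + B * (2 * u * (L ^ 2 * η ^ 2 * (g + V)))
      = η * c₁ * (g + V) := by
    rw [hB, shiftWeight, hc1, ← hu]
    field_simp
  have hηc : η * c₁ ≤ 1 / (2 * (L * (1 + 2 * τ))) := by
    calc η * c₁ ≤ 1 / ((1 + 2 * τ) * L) * (1 / 2) := by gcongr
      _ = _ := by field_simp
  have e2 : η * c₁ * (g + V) ≤ η / 2 * g + (B / (2 * u)) * S
      + 1 / (2 * (L * (1 + 2 * τ))) * (u / n * N) := by
    have h1 : η * c₁ * g ≤ η * (1 / 2) * g := by gcongr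
    have h2 : η * c₁ * V ≤ η * c₁ * ((ω * S + u * N) / n) := by gcongr
    have h3 : (ω * S + u * N) / n ≤ u / n * S + u / n * N := by
      rw [← mul_add, div_mul_eq_mul_div, mul_add]
      gcongr
      linarith
    have h4 : η * c₁ * ((ω * S + u * N) / n)
        ≤ 1 / (2 * (L * (1 + 2 * τ))) * (u / n * S + u / n * N) := by
      refine mul_le_mul hηc h3 (by positivity) (by positivity)
    -- The balance behind `shiftWeight`: with `u / n = τ² / u²`, the reference error entering
    -- through `V` costs exactly `B / (2u) * S`.
    have h5 : 1 / (2 * (L * (1 + 2 * τ))) * (u / n * S) = (B / (2 * u)) * S := by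
      rw [hun, hB, shiftWeight, ← hu]
      field_simp
    nlinarith
  -- The Young factor cancels one of the two powers of `(2u - 1)/(2u)` in the contraction, leaving
  -- `1 - 1/(2u)`: a gain that offsets `h5`.
  have e3 : 2 * u / (2 * u - 1) * ((1 - shiftStepsize ω) ^ 2 * S + shiftStepsize ω ^ 2 * W)
      ≤ (1 - 1 / (2 * u)) * S + 1 / u * N := by
    have h1 : (1 - shiftStepsize ω) ^ 2 * S + shiftStepsize ω ^ 2 * W
        ≤ ((2 * u - 1) / (2 * u)) ^ 2 * S + (2 * u - 1) / (2 * u ^ 2) * N := by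
      have h2 : shiftStepsize ω ^ 2 * W ≤ shiftStepsize ω ^ 2 * (ω * S + u * N) := by gcongr
      have h3 := mul_le_mul_of_nonneg_right (shiftStepsize_contraction hω) hS
      have h4 : shiftStepsize ω ^ 2 * u = (2 * u - 1) / (2 * u ^ 2) := by
        rw [shiftStepsize_sq hω, ← hu, show 1 + 2 * ω = 2 * u - 1 by rw [hu]; ring]
        field_simp
      rw [← h4]
      rw [← hu] at h3
      nlinarith
    calc _ ≤ 2 * u / (2 * u - 1)
          * (((2 * u - 1) / (2 * u)) ^ 2 * S + (2 * u - 1) / (2 * u ^ 2) * N) := by gcongr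
      _ = _ := by field_simp
  have e4 := mul_le_mul_of_nonneg_left e3 hB0
  have e5 : B * (1 / u * N) = 1 / (L * (1 + 2 * τ)) * (u / n * N) := by
    rw [hun, hB, shiftWeight, ← hu]
    field_simp
  have e6 : 3 / 2 * (u / n * N) / (L * (1 + 2 * τ))
      = 1 / (2 * (L * (1 + 2 * τ))) * (u / n * N) + 1 / (L * (1 + 2 * τ)) * (u / n * N) := by
    field_simp
    ring
  have e7 : B * ((1 - 1 / (2 * u)) * S + 1 / u * N)
      = B * S - (B / (2 * u)) * S + B * (1 / u * N) := by
    field_simp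
  rw [e7, e5] at e4
  rw [e6]
  linarith

/-- The potential of the convergence analysis. -/
noncomputable def potential {Z : Type u} (loss : Z → Vec d → ℝ) (D : Fin n → Fin m → Z)
    (w : ℝ) (x : Vec d) (s : Fin n → Vec d) : ℝ :=
  objective loss D x - (⨅ y, objective loss D y)
    + w * ((1 / (n : ℝ)) * ∑ i, ‖gradient (clientObjective loss (D i)) x - s i‖ ^ 2)

section Objective

variable {Z : Type u} {loss : Z → Vec d → ℝ} {L G : ℝ}

lemma isSmooth_clientObjective (hm : 0 < m) (hL : ∀ z, IsSmooth L (loss z)) (Di : Fin m → Z) :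
    IsSmooth L (clientObjective loss Di) :=
  IsSmooth.average hm fun j => hL (Di j)

lemma isSmooth_objective (hn : 0 < n) (hm : 0 < m) (hL : ∀ z, IsSmooth L (loss z))
    (D : Fin n → Fin m → Z) : IsSmooth L (objective loss D) :=
  IsSmooth.average hn fun i => isSmooth_clientObjective hm hL (D i)

lemma hasBoundedGradient_objective (hn : 0 < n) (hm : 0 < m) (hL : ∀ z, IsSmooth L (loss z))
    (hG : ∀ z, HasBoundedGradient G (loss z)) (D : Fin n → Fin m → Z) :
    HasBoundedGradient G (objective loss D) :=
  HasBoundedGradient.average hn (fun i => isSmooth_clientObjective hm hL (D i)) fun i =>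
    HasBoundedGradient.average hm (fun j => hL (D i j)) fun j => hG (D i j)

lemma gradient_objective (hm : 0 < m) (hL : ∀ z, IsSmooth L (loss z)) (D : Fin n → Fin m → Z)
    (x : Vec d) : gradient (objective loss D) x
      = (1 / (n : ℝ)) • ∑ i, gradient (clientObjective loss (D i)) x :=
  (hasGradientAt_average Finset.univ
    (fun i => (isSmooth_clientObjective hm hL (D i)).1) (1 / (n : ℝ)) x).gradient

lemma potential_nonneg {D : Fin n → Fin m → Z} (hbdd : BddBelow (Set.range (objective loss D)))
    {w : ℝ} (hw : 0 ≤ w) (x : Vec d) (s : Fin n → Vec d) : 0 ≤ potential loss D w x s := by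
  have h1 := ciInf_le hbdd x
  have h2 : 0 ≤ w * ((1 / (n : ℝ)) *
      ∑ i, ‖gradient (clientObjective loss (D i)) x - s i‖ ^ 2) := by positivity
  unfold potential
  linarith

/-- The expected decrease of the potential in one round. -/
lemma lintegral_potential_step (hn : 0 < n) (hm : 0 < m) (hL0 : 0 < L)
    (hL : ∀ z, IsSmooth L (loss z)) {D : Fin n → Fin m → Z}
    (hbdd : BddBelow (Set.range (objective loss D))) {ω τ η N : ℝ} (hω : 0 ≤ ω)
    (hτ : 0 < τ) (hτn : τ ^ 2 = (1 + ω) ^ 3 / n) (hη : 0 < η) (hηL : η ≤ 1 / ((1 + 2 * τ) * L))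
    (hN : 0 ≤ N) (x : Vec d) (s : Fin n → Vec d) {Ω : Type*} [MeasurableSpace Ω] {μ : Measure Ω}
    [IsProbabilityMeasure μ] {v : Fin n → Ω → Vec d}
    (hv2 : ∀ k, MemLp (v k) 2 μ)
    (hmean : ∀ k, ∫ r, v k r ∂μ = gradient (clientObjective loss (D k)) x - s k)
    (hvar : ∀ k, ∫ r, ‖v k r - (gradient (clientObjective loss (D k)) x - s k)‖ ^ 2 ∂μ
      ≤ ω * ‖gradient (clientObjective loss (D k)) x - s k‖ ^ 2 + (1 + ω) * N)
    (hsum : ∫ r, ‖∑ k, (v k r - (gradient (clientObjective loss (D k)) x - s k))‖ ^ 2 ∂μ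
      = ∑ k, ∫ r, ‖v k r - (gradient (clientObjective loss (D k)) x - s k)‖ ^ 2 ∂μ) :
    ∫⁻ r, ENNReal.ofReal (potential loss D (shiftWeight L ω τ)
        (x - η • ((1 / (n : ℝ)) • ∑ k, s k + (1 / (n : ℝ)) • ∑ k, v k r))
        fun k => s k + shiftStepsize ω • v k r) ∂μ
      + ENNReal.ofReal (η / 2 * ‖gradient (objective loss D) x‖ ^ 2)
      ≤ ENNReal.ofReal (potential loss D (shiftWeight L ω τ) x s)
        + ENNReal.ofReal (3 / 2 * ((1 + ω) / n * N) / (L * (1 + 2 * τ))) := by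
  have hn' : (0 : ℝ) < n := by exact_mod_cast hn
  set B := shiftWeight L ω τ with hB
  have hB0 : 0 ≤ B := by rw [hB, shiftWeight]; positivity
  set γ := shiftStepsize ω with hγ
  set h : Fin n → Vec d := fun k => gradient (clientObjective loss (D k)) x - s k with hh
  set w : Fin n → Ω → Vec d := fun k r => v k r - h k with hw
  set g := gradient (objective loss D) x with hg
  set e : Ω → Vec d := fun r => (1 / (n : ℝ)) • ∑ k, w k r with he
  set p : ℝ := 2 * (1 + ω) with hp
  have hp1 : 1 < p := by rw [hp]; linarith
  have hw2 : ∀ k, MemLp (w k) 2 μ := fun k => (hv2 k).sub (memLp_const _)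
  have hw0 : ∀ k, ∫ r, w k r ∂μ = 0 := fun k => by
    simp only [hw]
    rw [integral_sub ((hv2 k).integrable one_le_two) (integrable_const _), hmean]
    simp [hh]
  have he2 : MemLp e 2 μ :=
    (memLp_finsetSum Finset.univ fun k _ => hw2 k).const_smul (1 / (n : ℝ))
  have he0 : ∫ r, e r ∂μ = 0 := by
    simp only [he]
    rw [integral_smul, integral_finsetSum _ fun k _ => (hw2 k).integrable one_le_two]
    simp [hw0]
  set S : ℝ := (1 / (n : ℝ)) * ∑ k, ‖h k‖ ^ 2 with hS
  set W : ℝ := (1 / (n : ℝ)) * ∑ k, ∫ r, ‖w k r‖ ^ 2 ∂μ with hW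
  have hWle : W ≤ ω * S + (1 + ω) * N := by
    calc W ≤ (1 / (n : ℝ)) * ∑ k, (ω * ‖h k‖ ^ 2 + (1 + ω) * N) := by
          rw [hW]
          gcongr with k _
          exact hvar k
      _ = ω * S + (1 + ω) * N := by
          rw [Finset.sum_add_distrib, ← Finset.mul_sum, hS]
          simp
          field_simp
  -- The gain from averaging: `hsum` expresses the orthogonality of the clients' errors.
  have hV : ∫ r, ‖e r‖ ^ 2 ∂μ = W / n := by
    simp only [he, norm_smul, mul_pow]
    rw [integral_const_mul, hsum, hW, Real.norm_of_nonneg (by positivity)]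
    field_simp
    rfl
  -- The average reference cancels, so the direction is the gradient plus a centered error.
  have hupd : ∀ r, x - η • ((1 / (n : ℝ)) • ∑ k, s k + (1 / (n : ℝ)) • ∑ k, v k r)
      = x + -(η • (g + e r)) := fun r => by
    rw [hg, gradient_objective hm hL, he, ← smul_add, ← smul_add, ← sub_eq_add_neg,
      ← Finset.sum_add_distrib, ← Finset.sum_add_distrib]
    congr 3
    refine Finset.sum_congr rfl fun k _ => ?_
    simp only [hw, hh]
    abel
  -- An integrable majorant of the new potential, with explicit expectation.
  let Q : Ω → ℝ := fun r => (objective loss D x - ⨅ y, objective loss D y)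
    + (-η * inner ℝ g (g + e r) + L / 2 * η ^ 2 * ‖g + e r‖ ^ 2)
    + B * (p * (L ^ 2 * η ^ 2 * ‖g + e r‖ ^ 2)
      + p / (p - 1) * ((1 / (n : ℝ)) * ∑ k, ‖(1 - γ) • h k + (-γ) • w k r‖ ^ 2))
  have hle : ∀ r, potential loss D B
      (x - η • ((1 / (n : ℝ)) • ∑ k, s k + (1 / (n : ℝ)) • ∑ k, v k r))
      (fun k => s k + γ • v k r) ≤ Q r := fun r => by
    rw [hupd, potential]
    have h1 := (isSmooth_objective hn hm hL D).descent x (-(η • (g + e r)))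
    rw [← hg, inner_neg_right, real_inner_smul_right, norm_neg, norm_smul, mul_pow,
      Real.norm_of_nonneg hη.le] at h1
    have h2 : ∀ k, ‖gradient (clientObjective loss (D k)) (x + -(η • (g + e r)))
        - (s k + γ • v k r)‖ ^ 2 ≤ p * (L ^ 2 * η ^ 2 * ‖g + e r‖ ^ 2)
          + p / (p - 1) * ‖(1 - γ) • h k + (-γ) • w k r‖ ^ 2 := fun k => by
      have h3 : gradient (clientObjective loss (D k)) (x + -(η • (g + e r))) - (s k + γ • v k r)
          = (gradient (clientObjective loss (D k)) (x + -(η • (g + e r)))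
            - gradient (clientObjective loss (D k)) x) + ((1 - γ) • h k + (-γ) • w k r) := by
        simp only [hw, hh]
        module
      rw [h3]
      refine (norm_add_sq_le_weighted hp1 _ _).trans ?_
      have h4 := (isSmooth_clientObjective hm hL (D k)).2 (x + -(η • (g + e r))) x
      rw [add_sub_cancel_left, norm_neg, norm_smul, Real.norm_of_nonneg hη.le] at h4
      gcongr
      calc _ ≤ (L * (η * ‖g + e r‖)) ^ 2 := by gcongr
        _ = _ := by ring
    have h5 : (1 / (n : ℝ)) * ∑ k, ‖gradient (clientObjective loss (D k)) (x + -(η • (g + e r)))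
        - (s k + γ • v k r)‖ ^ 2 ≤ p * (L ^ 2 * η ^ 2 * ‖g + e r‖ ^ 2)
          + p / (p - 1) * ((1 / (n : ℝ)) * ∑ k, ‖(1 - γ) • h k + (-γ) • w k r‖ ^ 2) := by
      calc _ ≤ (1 / (n : ℝ)) * ∑ k, (p * (L ^ 2 * η ^ 2 * ‖g + e r‖ ^ 2)
          + p / (p - 1) * ‖(1 - γ) • h k + (-γ) • w k r‖ ^ 2) := by
            gcongr with k _
            exact h2 k
        _ = _ := by
            rw [Finset.sum_add_distrib, Finset.sum_const, ← Finset.mul_sum, Finset.card_univ,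
              Fintype.card_fin, nsmul_eq_mul]
            have hp' : p - 1 ≠ 0 := by linarith
            field_simp
    have h6 := mul_le_mul_of_nonneg_left h5 hB0
    simp only [Q]
    linarith
  have hge2 : MemLp (fun r => g + e r) 2 μ := (memLp_const g).add he2
  have i1 : Integrable (fun r => inner ℝ g (g + e r)) μ :=
    integrable_inner_of_memLp (memLp_const g) hge2
  have i2 : Integrable (fun r => ‖g + e r‖ ^ 2) μ := hge2.integrable_norm_pow two_ne_zero
  have hcw : ∀ k, MemLp (fun r => (-γ) • w k r) 2 μ := fun k => (hw2 k).const_smul (-γ)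
  have i3 : ∀ k, Integrable (fun r => ‖(1 - γ) • h k + (-γ) • w k r‖ ^ 2) μ := fun k => by
    have hs : MemLp (fun r => (1 - γ) • h k + (-γ) • w k r) 2 μ :=
      (memLp_const ((1 - γ) • h k)).add (hcw k)
    exact hs.integrable_norm_pow two_ne_zero
  have j1 : ∫ r, inner ℝ g (g + e r) ∂μ = ‖g‖ ^ 2 := by
    rw [integral_inner (hge2.integrable one_le_two), integral_add (integrable_const _)
      (he2.integrable one_le_two), he0]
    simp
  have j2 : ∫ r, ‖g + e r‖ ^ 2 ∂μ = ‖g‖ ^ 2 + W / n := by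
    rw [integral_norm_const_add_sq g he2 he0, hV]
  have j3 : ∀ k, ∫ r, ‖(1 - γ) • h k + (-γ) • w k r‖ ^ 2 ∂μ
      = (1 - γ) ^ 2 * ‖h k‖ ^ 2 + γ ^ 2 * ∫ r, ‖w k r‖ ^ 2 ∂μ := fun k => by
    have hm0 : ∫ r, (-γ) • w k r ∂μ = 0 := by rw [integral_smul, hw0, smul_zero]
    rw [integral_norm_const_add_sq _ (hcw k) hm0]
    simp only [norm_smul, mul_pow, Real.norm_eq_abs, sq_abs, neg_sq]
    rw [integral_const_mul]
  have i4 : Integrable (fun r => -η * inner ℝ g (g + e r) + L / 2 * η ^ 2 * ‖g + e r‖ ^ 2) μ :=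
    (i1.const_mul _).add (i2.const_mul _)
  have i5 : Integrable (fun r => (objective loss D x - ⨅ y, objective loss D y)
      + (-η * inner ℝ g (g + e r) + L / 2 * η ^ 2 * ‖g + e r‖ ^ 2)) μ :=
    (integrable_const _).add i4
  have i6 : Integrable (fun r => p / (p - 1) * ((1 / (n : ℝ)) *
      ∑ k, ‖(1 - γ) • h k + (-γ) • w k r‖ ^ 2)) μ :=
    ((integrable_finsetSum _ fun k _ => i3 k).const_mul _).const_mul _
  have i7 : Integrable (fun r => p * (L ^ 2 * η ^ 2 * ‖g + e r‖ ^ 2)) μ :=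
    (i2.const_mul _).const_mul _
  have i8 : Integrable (fun r => B * (p * (L ^ 2 * η ^ 2 * ‖g + e r‖ ^ 2)
      + p / (p - 1) * ((1 / (n : ℝ)) * ∑ k, ‖(1 - γ) • h k + (-γ) • w k r‖ ^ 2))) μ :=
    (i7.add i6).const_mul B
  have hQi : Integrable Q μ := i5.add i8
  have hQ : ∫ r, Q r ∂μ = (objective loss D x - ⨅ y, objective loss D y)
      + (-η * ‖g‖ ^ 2 + L / 2 * η ^ 2 * (‖g‖ ^ 2 + W / n))
      + B * (p * (L ^ 2 * η ^ 2 * (‖g‖ ^ 2 + W / n))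
        + p / (p - 1) * ((1 - γ) ^ 2 * S + γ ^ 2 * W)) := by
    simp only [Q]
    rw [integral_add i5 i8, integral_add (integrable_const _) i4,
      integral_add (i1.const_mul _) (i2.const_mul _), integral_const_mul, integral_const_mul,
      integral_const_mul, integral_add i7 i6, integral_const_mul, integral_const_mul,
      integral_const_mul, integral_const_mul, integral_finsetSum _ fun k _ => i3 k, j1, j2,
      Finset.sum_congr rfl fun k _ => j3 k, Finset.sum_add_distrib, ← Finset.mul_sum,
      ← Finset.mul_sum, hS, hW]
    simp only [integral_const, probReal_univ, one_smul]
    ring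
  have hpot0 := fun r => potential_nonneg hbdd hB0
    (x - η • ((1 / (n : ℝ)) • ∑ k, s k + (1 / (n : ℝ)) • ∑ k, v k r)) fun k => s k + γ • v k r
  have hQ0 : ∀ r, 0 ≤ Q r := fun r => (hpot0 r).trans (hle r)
  have hS0 : 0 ≤ S := mul_nonneg (by positivity) (Finset.sum_nonneg fun k _ => sq_nonneg _)
  have hstep := step_inequality (V := W / n) (W := W) (g := ‖g‖ ^ 2) hn hL0 hω hτ hτn hη hηL
    hS0 (sq_nonneg _) hN (div_le_div_of_nonneg_right hWle hn'.le) hWle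
  calc _ ≤ ∫⁻ r, ENNReal.ofReal (Q r) ∂μ + ENNReal.ofReal (η / 2 * ‖g‖ ^ 2) := by
        gcongr with r
        exact hle r
    _ = ENNReal.ofReal (∫ r, Q r ∂μ + η / 2 * ‖g‖ ^ 2) := by
        rw [← ofReal_integral_eq_lintegral_ofReal hQi (Filter.Eventually.of_forall hQ0),
          ENNReal.ofReal_add (integral_nonneg hQ0) (by positivity)]
    _ ≤ ENNReal.ofReal (potential loss D B x s
          + 3 / 2 * ((1 + ω) / n * N) / (L * (1 + 2 * τ))) := by
        refine ENNReal.ofReal_le_ofReal ?_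
        rw [hQ, potential]
        linarith
    _ ≤ _ := ENNReal.ofReal_add_le

end Objective

end Step

end SoteriaFL

namespace SoteriaFL

/-! ### Telescoping the potential along the run. -/

section Convergence

variable {d n m : ℕ} {Z : Type u} {U : Type v} {loss : Z → Vec d → ℝ} {L G : ℝ}

/-- The server's reference follows the average of the clients' references, since both start at zero
and are updated linearly. This is what makes the server direction unbiased. -/
lemma replay_serverShift (P : Params d) (h : ℕ → Fin n → Vec d) (t : ℕ) :
    (replay P h t).serverShift = (1 / (n : ℝ)) • ∑ k, (replay P h t).shift k := by
  induction t with
  | zero => simp [replay]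
  | succ t ih =>
    simp only [replay, update]
    rw [ih, Finset.sum_add_distrib, smul_add, ← Finset.smul_sum, smul_comm]

lemma measurable_potential_replay (hn : 0 < n) (hm : 0 < m) (hL : ∀ z, IsSmooth L (loss z))
    (D : Fin n → Fin m → Z) (w : ℝ) (P : Params d) (t : ℕ) :
    Measurable fun h => potential loss D w (replay P h t).x (replay P h t).shift := by
  obtain ⟨h1, h2, -⟩ := measurable_replay (n := n) P t
  have hf : Measurable (objective loss D) :=
    (isSmooth_objective hn hm hL D).1.continuous.measurable
  have hg : ∀ i, Measurable (gradient (clientObjective loss (D i))) := fun i =>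
    measurable_gradient_of_isSmooth (isSmooth_clientObjective hm hL (D i))
  unfold potential
  refine ((hf.comp h1).sub_const _).add (Measurable.const_mul (Measurable.const_mul ?_ _) _)
  exact Finset.measurable_sum _ fun i _ => (((hg i).comp h1).sub (h2 i)).norm.pow_const 2

lemma replay_extendHistory (P : Params d) (K : ℕ → Fin n → U → Vec d → Vec d)
    (D : Fin n → Fin m → Z) (t : ℕ) (h : ℕ → Fin n → Vec d) (r : Fin n → Seed m d U) :
    replay P (extendHistory loss P K D t h r) (t + 1) = update P (replay P h t) fun i =>
      message loss P.b (K t i) (D i) (replay P h t).x ((replay P h t).shift i) (r i) := by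
  rw [replay, extendHistory, Function.update_self,
    replay_congr P (h' := h) fun k hk => Function.update_of_ne hk.ne _ _]

variable [MeasurableSpace U]

/-- The expected decrease of the potential in one round of the algorithm. -/
lemma lintegral_potential_round (hn : 0 < n) (hm : 0 < m) (hL0 : 0 < L)
    (hL : ∀ z, IsSmooth L (loss z)) (hG : ∀ z, HasBoundedGradient G (loss z))
    {D : Fin n → Fin m → Z} (hbdd : BddBelow (Set.range (objective loss D))) {ω τ : ℝ}
    (hω : 0 ≤ ω) (hτ : 0 < τ) (hτn : τ ^ 2 = (1 + ω) ^ 3 / n) (P : Params d) (hη : 0 < P.η)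
    (hηL : P.η ≤ 1 / ((1 + 2 * τ) * L)) (hγ : P.γ = shiftStepsize ω) (hb : 0 < P.b)
    (hbm : P.b ≤ m) (ν : ℕ → Fin n → Measure U) [∀ t i, IsProbabilityMeasure (ν t i)]
    {K : ℕ → Fin n → U → Vec d → Vec d} (hK : ∀ t i, IsCompressionOperator (ν t i) (K t i) ω)
    (t : ℕ) (h : ℕ → Fin n → Vec d) :
    ∫⁻ r, ENNReal.ofReal (potential loss D (shiftWeight L ω τ)
        (replay P (extendHistory loss P K D t h r) (t + 1)).x
        (replay P (extendHistory loss P K D t h r) (t + 1)).shift) ∂(roundLaw m d P.b P.σ (ν t))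
      + ENNReal.ofReal (P.η / 2 * ‖gradient (objective loss D) (replay P h t).x‖ ^ 2)
      ≤ ENNReal.ofReal (potential loss D (shiftWeight L ω τ) (replay P h t).x
          (replay P h t).shift)
        + ENNReal.ofReal (3 / 2 * ((1 + ω) / n * noiseLevel m d G P.b P.σ)
          / (L * (1 + 2 * τ))) := by
  simp only [replay_extendHistory, update, replay_serverShift, hγ]
  have hm0 : (0 : ℝ) < m := by exact_mod_cast hm
  have hN : 0 ≤ noiseLevel m d G P.b P.σ := by
    have : P.b / m ≤ 1 := div_le_one_of_le₀ hbm hm0.le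
    have h1 : 0 ≤ 1 - P.b / m := by linarith
    unfold noiseLevel
    positivity
  have := fun i => isProbabilityMeasure_clientLaw (d := d) (σ := P.σ) hb.le hbm (ν t i)
  have := isProbabilityMeasure_roundLaw (d := d) (σ := P.σ) hb.le hbm (ν t)
  have hmom := fun k => message_moments hL hG hb hbm P.σ hω (hK t k) (D k) (replay P h t).x
    ((replay P h t).shift k)
  have heval : ∀ k, MeasurePreserving (fun r : Fin n → Seed m d U => r k)
      (roundLaw m d P.b P.σ (ν t)) (clientLaw m d P.b P.σ (ν t k)) := fun k =>
    measurePreserving_eval _ k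
  have hc2 : ∀ k, MemLp (fun r => message loss P.b (K t k) (D k) (replay P h t).x
      ((replay P h t).shift k) r - (gradient (clientObjective loss (D k)) (replay P h t).x
        - (replay P h t).shift k)) 2 (clientLaw m d P.b P.σ (ν t k)) := fun k =>
    (hmom k).1.sub (memLp_const (gradient (clientObjective loss (D k)) (replay P h t).x
      - (replay P h t).shift k))
  have hc0 : ∀ k, ∫ r, (message loss P.b (K t k) (D k) (replay P h t).x
      ((replay P h t).shift k) r - (gradient (clientObjective loss (D k)) (replay P h t).x
        - (replay P h t).shift k)) ∂(clientLaw m d P.b P.σ (ν t k)) = 0 := fun k => by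
    rw [integral_sub ((hmom k).1.integrable one_le_two) (integrable_const _), (hmom k).2.1]
    simp
  have hsq : ∀ k, ∫ r, ‖message loss P.b (K t k) (D k) (replay P h t).x
      ((replay P h t).shift k) (r k) - (gradient (clientObjective loss (D k)) (replay P h t).x
        - (replay P h t).shift k)‖ ^ 2 ∂(roundLaw m d P.b P.σ (ν t))
      = ∫ r, ‖message loss P.b (K t k) (D k) (replay P h t).x ((replay P h t).shift k) r
        - (gradient (clientObjective loss (D k)) (replay P h t).x - (replay P h t).shift k)‖ ^ 2
          ∂(clientLaw m d P.b P.σ (ν t k)) := fun k =>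
    integral_comp_eval (μ := fun k => clientLaw m d P.b P.σ (ν t k)) (i := k)
      ((hc2 k).1.norm.pow 2)
  have hv2 : ∀ k, MemLp (fun r : Fin n → Seed m d U => message loss P.b (K t k) (D k)
      (replay P h t).x ((replay P h t).shift k) (r k)) 2 (roundLaw m d P.b P.σ (ν t)) :=
    fun k => (hmom k).1.comp_measurePreserving (heval k)
  have hmean : ∀ k, ∫ r, message loss P.b (K t k) (D k) (replay P h t).x
      ((replay P h t).shift k) (r k) ∂(roundLaw m d P.b P.σ (ν t))
      = gradient (clientObjective loss (D k)) (replay P h t).x - (replay P h t).shift k :=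
    fun k => (integral_comp_eval (μ := fun k => clientLaw m d P.b P.σ (ν t k)) (i := k)
      (hmom k).1.1).trans (hmom k).2.1
  have hsum := (integral_norm_sum_sq hc2 hc0).trans (Finset.sum_congr rfl fun k _ => (hsq k).symm)
  exact lintegral_potential_step hn hm hL0 hL hbdd hω hτ hτn hη hηL hN _ _ hv2 hmean
    (fun k => (hsq k).trans_le (hmom k).2.2) hsum

lemma measurable_gradNormSq (hn : 0 < n) (hm : 0 < m) (hL : ∀ z, IsSmooth L (loss z))
    (P : Params d) {K : ℕ → Fin n → U → Vec d → Vec d}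
    (hK : ∀ t i, Measurable (Function.uncurry (K t i))) (D : Fin n → Fin m → Z) (t : ℕ) :
    Measurable (gradNormSq loss P K D t) := by
  have hloss := fun z => measurable_gradient_of_isSmooth (hL z)
  have h1 := (measurable_replay (n := n) P t).1.comp (measurable_history hloss P hK D t)
  have h2 := measurable_gradient_of_isSmooth (isSmooth_objective hn hm hL D)
  have h3 : gradNormSq loss P K D t = fun ρ =>
      ‖gradient (objective loss D) (replay P (history loss P K D t ρ) t).x‖ ^ 2 := by
    funext ρ
    rw [replay_history, gradNormSq]
  rw [h3]
  exact (h2.comp h1).norm.pow_const 2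

lemma integrable_gradNormSq (hn : 0 < n) (hm : 0 < m) (hL : ∀ z, IsSmooth L (loss z))
    (hG : ∀ z, HasBoundedGradient G (loss z)) (P : Params d) (hb : 0 ≤ P.b) (hbm : P.b ≤ m)
    (ν : ℕ → Fin n → Measure U) [∀ t i, IsProbabilityMeasure (ν t i)]
    {K : ℕ → Fin n → U → Vec d → Vec d}
    (hK : ∀ t i, Measurable (Function.uncurry (K t i))) (D : Fin n → Fin m → Z) (t : ℕ) :
    Integrable (gradNormSq loss P K D t) (seedLaw m P ν) := by
  have := isProbabilityMeasure_seedLaw P hb hbm ν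
  refine Integrable.of_bound (measurable_gradNormSq hn hm hL P hK D t).aestronglyMeasurable
    (G ^ 2) (Filter.Eventually.of_forall fun ρ => ?_)
  rw [gradNormSq, Real.norm_of_nonneg (by positivity)]
  gcongr
  exact hasBoundedGradient_objective hn hm hL hG D _

/-- The one-round inequality holds for every fixed history; it is integrated over the law of the
history, the fresh round being independent. -/
lemma lintegral_potential_succ (hn : 0 < n) (hm : 0 < m) (hL0 : 0 < L)
    (hL : ∀ z, IsSmooth L (loss z)) (hG : ∀ z, HasBoundedGradient G (loss z))
    {D : Fin n → Fin m → Z} (hbdd : BddBelow (Set.range (objective loss D))) {ω τ : ℝ}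
    (hω : 0 ≤ ω) (hτ : 0 < τ) (hτn : τ ^ 2 = (1 + ω) ^ 3 / n) (P : Params d) (hη : 0 < P.η)
    (hηL : P.η ≤ 1 / ((1 + 2 * τ) * L)) (hγ : P.γ = shiftStepsize ω) (hb : 0 < P.b)
    (hbm : P.b ≤ m) (ν : ℕ → Fin n → Measure U) [∀ t i, IsProbabilityMeasure (ν t i)]
    {K : ℕ → Fin n → U → Vec d → Vec d} (hK : ∀ t i, IsCompressionOperator (ν t i) (K t i) ω)
    (t : ℕ) :
    ∫⁻ ρ, ENNReal.ofReal (potential loss D (shiftWeight L ω τ) (state loss P K D ρ (t + 1)).x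
        (state loss P K D ρ (t + 1)).shift) ∂(seedLaw m P ν)
      + ENNReal.ofReal (P.η / 2 * ∫ ρ, gradNormSq loss P K D t ρ ∂(seedLaw m P ν))
      ≤ ∫⁻ ρ, ENNReal.ofReal (potential loss D (shiftWeight L ω τ) (state loss P K D ρ t).x
          (state loss P K D ρ t).shift) ∂(seedLaw m P ν)
        + ENNReal.ofReal (3 / 2 * ((1 + ω) / n * noiseLevel m d G P.b P.σ)
          / (L * (1 + 2 * τ))) := by
  have := isProbabilityMeasure_seedLaw P hb.le hbm ν
  have := isProbabilityMeasure_roundLaw (d := d) (σ := P.σ) hb.le hbm (ν t)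
  have hloss := fun z => measurable_gradient_of_isSmooth (hL z)
  have hKm := fun t i => (hK t i).measurable
  set B := shiftWeight L ω τ with hB
  have hH := measurable_history hloss P hKm D t
  have hE := measurable_extendHistory hloss P hKm D t
  have hpot := fun t => (measurable_potential_replay hn hm hL D B P t).ennreal_ofReal
  have hprob : IsProbabilityMeasure ((seedLaw m P ν).map (history loss P K D t)) :=
    Measure.isProbabilityMeasure_map hH.aemeasurable
  have hgrad : Measurable fun h : ℕ → Fin n → Vec d =>
      ENNReal.ofReal (P.η / 2 * ‖gradient (objective loss D) (replay P h t).x‖ ^ 2) :=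
    (((measurable_gradient_of_isSmooth (isSmooth_objective hn hm hL D)).comp
      (measurable_replay P t).1).norm.pow_const 2).const_mul _ |>.ennreal_ofReal
  have e1 : ∫⁻ ρ, ENNReal.ofReal (potential loss D B (state loss P K D ρ (t + 1)).x
        (state loss P K D ρ (t + 1)).shift) ∂(seedLaw m P ν)
      = ∫⁻ h, ∫⁻ r, ENNReal.ofReal (potential loss D B
          (replay P (extendHistory loss P K D t h r) (t + 1)).x
          (replay P (extendHistory loss P K D t h r) (t + 1)).shift)
          ∂(roundLaw m d P.b P.σ (ν t)) ∂((seedLaw m P ν).map (history loss P K D t)) := by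
    simp only [← replay_history]
    rw [← lintegral_map (hpot (t + 1)) (measurable_history hloss P hKm D (t + 1)),
      seedLaw_map_history_succ hloss P hb.le hbm ν hKm D t, lintegral_map (hpot (t + 1)) hE]
    exact lintegral_prod _ ((hpot (t + 1)).comp hE).aemeasurable
  have e2 : ENNReal.ofReal (P.η / 2 * ∫ ρ, gradNormSq loss P K D t ρ ∂(seedLaw m P ν))
      = ∫⁻ h, ENNReal.ofReal (P.η / 2 * ‖gradient (objective loss D) (replay P h t).x‖ ^ 2)
          ∂((seedLaw m P ν).map (history loss P K D t)) := by
    rw [lintegral_map hgrad hH, ← integral_const_mul, ofReal_integral_eq_lintegral_ofReal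
      ((integrable_gradNormSq hn hm hL hG P hb.le hbm ν hKm D t).const_mul _)
      (Filter.Eventually.of_forall fun ρ => by unfold gradNormSq; positivity)]
    simp only [replay_history, gradNormSq]
  have e3 : ∫⁻ ρ, ENNReal.ofReal (potential loss D B (state loss P K D ρ t).x
          (state loss P K D ρ t).shift) ∂(seedLaw m P ν)
      = ∫⁻ h, ENNReal.ofReal (potential loss D B (replay P h t).x (replay P h t).shift)
          ∂((seedLaw m P ν).map (history loss P K D t)) := by
    rw [lintegral_map (hpot t) hH]
    simp only [replay_history]
  rw [e1, e2, e3, ← lintegral_add_right _ hgrad]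
  refine (lintegral_mono fun h => lintegral_potential_round hn hm hL0 hL hG hbdd hω hτ hτn P hη
    hηL hγ hb hbm ν hK t h).trans_eq ?_
  rw [lintegral_add_right _ measurable_const, lintegral_const, measure_univ, mul_one]

/-- Convergence of the algorithm. -/
lemma sum_integral_gradNormSq_le (hn : 0 < n) (hm : 0 < m) (hL0 : 0 < L)
    (hL : ∀ z, IsSmooth L (loss z)) (hG : ∀ z, HasBoundedGradient G (loss z))
    {D : Fin n → Fin m → Z} (hbdd : BddBelow (Set.range (objective loss D))) {ω τ : ℝ}
    (hω : 0 ≤ ω) (hτ : 0 < τ) (hτn : τ ^ 2 = (1 + ω) ^ 3 / n) (P : Params d) (hη : 0 < P.η)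
    (hηL : P.η ≤ 1 / ((1 + 2 * τ) * L)) (hγ : P.γ = shiftStepsize ω) (hb : 0 < P.b)
    (hbm : P.b ≤ m) (ν : ℕ → Fin n → Measure U) [∀ t i, IsProbabilityMeasure (ν t i)]
    {K : ℕ → Fin n → U → Vec d → Vec d} (hK : ∀ t i, IsCompressionOperator (ν t i) (K t i) ω)
    (T : ℕ) :
    P.η / 2 * ∑ t ∈ Finset.range T, ∫ ρ, gradNormSq loss P K D t ρ ∂(seedLaw m P ν)
      ≤ potential loss D (shiftWeight L ω τ) P.x₀ (fun _ => 0)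
        + T * (3 / 2 * ((1 + ω) / n * noiseLevel m d G P.b P.σ) / (L * (1 + 2 * τ))) := by
  have := isProbabilityMeasure_seedLaw P hb.le hbm ν
  have hm0 : (0 : ℝ) < m := by exact_mod_cast hm
  set B := shiftWeight L ω τ with hB
  have hB0 : 0 ≤ B := by rw [hB, shiftWeight]; positivity
  set R := 3 / 2 * ((1 + ω) / n * noiseLevel m d G P.b P.σ) / (L * (1 + 2 * τ)) with hR
  have hR0 : 0 ≤ R := by
    have : P.b / m ≤ 1 := div_le_one_of_le₀ hbm hm0.le
    have h1 : 0 ≤ 1 - P.b / m := by linarith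
    rw [hR, noiseLevel]
    positivity
  have hg0 : ∀ t, 0 ≤ ∫ ρ, gradNormSq loss P K D t ρ ∂(seedLaw m P ν) := fun t =>
    integral_nonneg fun ρ => by unfold gradNormSq; positivity
  have hpot0 := potential_nonneg hbdd hB0 P.x₀ fun _ : Fin n => (0 : Vec d)
  -- The sum telescopes in `[0, ∞]`: the potential is nonnegative and the gradient terms stay on the
  -- left, so no integrability of the potential and no subtraction are needed.
  have hind : ∀ T : ℕ, ∫⁻ ρ, ENNReal.ofReal (potential loss D B (state loss P K D ρ T).x
        (state loss P K D ρ T).shift) ∂(seedLaw m P ν)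
      + ENNReal.ofReal (P.η / 2 *
          ∑ t ∈ Finset.range T, ∫ ρ, gradNormSq loss P K D t ρ ∂(seedLaw m P ν))
      ≤ ENNReal.ofReal (potential loss D B P.x₀ (fun _ => 0) + T * R) := by
    intro T
    induction T with
    | zero => simp [state]
    | succ T ih =>
      rw [Finset.sum_range_succ, mul_add, add_comm (P.η / 2 * _), ENNReal.ofReal_add
        (mul_nonneg (by linarith) (hg0 T))
        (mul_nonneg (by linarith) (Finset.sum_nonneg fun t _ => hg0 t)), ← add_assoc]
      calc _ ≤ ∫⁻ ρ, ENNReal.ofReal (potential loss D B (state loss P K D ρ T).x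
            (state loss P K D ρ T).shift) ∂(seedLaw m P ν) + ENNReal.ofReal R
            + ENNReal.ofReal (P.η / 2 *
              ∑ t ∈ Finset.range T, ∫ ρ, gradNormSq loss P K D t ρ ∂(seedLaw m P ν)) := by
            exact add_le_add (lintegral_potential_succ hn hm hL0 hL hG hbdd hω hτ hτn P hη hηL hγ
              hb hbm ν hK T) le_rfl
        _ ≤ ENNReal.ofReal (potential loss D B P.x₀ (fun _ => 0) + T * R)
            + ENNReal.ofReal R := by
            rw [add_right_comm]
            gcongr
        _ = _ := by
            rw [← ENNReal.ofReal_add (by positivity) hR0]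
            congr 1
            push_cast
            ring
  have h := le_add_self.trans (hind T)
  exact (ENNReal.ofReal_le_ofReal_iff (by positivity)).1 h

end Convergence

/-! ### Substitution of the stated parameters. -/

section Parameters

lemma tau_pos {ω : ℝ} (hω : 0 ≤ ω) {n : ℕ} (hn : 0 < n) : 0 < tau ω n := by
  have hn' : (0 : ℝ) < n := by exact_mod_cast hn
  have hu : 0 < 1 + ω := by linarith
  unfold tau
  positivity

lemma tau_sq {ω : ℝ} (hω : 0 ≤ ω) (n : ℕ) : tau ω n ^ 2 = (1 + ω) ^ 3 / n := by
  have hu : 0 < 1 + ω := by linarith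
  rw [tau, div_pow, Real.sq_sqrt (by positivity), ← Real.rpow_natCast, ← Real.rpow_mul hu.le,
    ← Real.rpow_natCast]
  norm_num

lemma sqrt_eq_tau {ω : ℝ} (hω : 0 ≤ ω) {n : ℕ} (hn : 0 < n) :
    √((1 + ω) ^ 3 / n) = tau ω n := by
  rw [← tau_sq hω n, Real.sqrt_sq (tau_pos hω hn).le]

lemma beta_pos {ω : ℝ} (hω : 0 ≤ ω) {n : ℕ} (hn : 0 < n) : 0 < beta ω n := by
  have := tau_pos hω hn
  unfold beta
  positivity

/-- The potential of the analysis is at most the potential in the statement of the theorem. -/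
lemma potential_le_initialPotential {d n m : ℕ} {Z : Type u} (loss : Z → Vec d → ℝ)
    (D : Fin n → Fin m → Z) {L ω : ℝ} (hL : 0 < L) (hω : 0 ≤ ω) (hn : 0 < n) (x : Vec d) :
    potential loss D (shiftWeight L ω (tau ω n)) x (fun _ => 0)
      ≤ initialPotential loss D L ω x := by
  have hτ := tau_pos hω hn
  have hn' : (0 : ℝ) < n := by exact_mod_cast hn
  -- This is `τ / (1 + 2τ) ≤ 1/2`.
  have h1 : shiftWeight L ω (tau ω n) ≤ beta ω n / L := by
    rw [shiftWeight, beta, div_div, div_le_div_iff₀ (by positivity) (by positivity)]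
    have : 0 ≤ tau ω n * ((1 + ω) * L) := by positivity
    nlinarith
  simp only [potential, initialPotential, sub_zero]
  rw [← mul_assoc]
  gcongr
  calc shiftWeight L ω (tau ω n) * (1 / (n : ℝ)) ≤ beta ω n / L * (1 / (n : ℝ)) := by gcongr
    _ = _ := by field_simp

variable {n m d : ℕ} {L G ω ε δ : ℝ}

lemma utilityOrder_pos (hn : 0 < n) (hm : 0 < m) (hd : 0 < d) (hL : 0 < L) (hG : 0 < G)
    (hω : 0 ≤ ω) (hε : 0 < ε) (hδ : 0 < δ) (hδ1 : δ < 1) :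
    0 < utilityOrder n m d L G ω ε δ := by
  have hΛ : 0 < Real.log (1 / δ) := Real.log_pos (one_lt_one_div hδ hδ1)
  have hn' : (0 : ℝ) < n := by exact_mod_cast hn
  have hm' : (0 : ℝ) < m := by exact_mod_cast hm
  have hd' : (0 : ℝ) < d := by exact_mod_cast hd
  unfold utilityOrder
  positivity

/-- Converts `1/T` into a multiple of the utility; only the factor `L (1 + √τ)²` survives. -/
lemma roundsOrder_mul_utilityOrder (hn : 0 < n) (hm : 0 < m) (hd : 0 < d) (hL : 0 < L)
    (hG : 0 < G) (hω : 0 ≤ ω) (hε : 0 < ε) (hδ : 0 < δ) (hδ1 : δ < 1) :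
    roundsOrder n m d L G ω ε δ * utilityOrder n m d L G ω ε δ
      = L * (1 + √(tau ω n)) ^ 2 := by
  have hΛ : 0 < Real.log (1 / δ) := Real.log_pos (one_lt_one_div hδ hδ1)
  have hn' : (0 : ℝ) < n := by exact_mod_cast hn
  have hm' : (0 : ℝ) < m := by exact_mod_cast hm
  have hd' : (0 : ℝ) < d := by exact_mod_cast hd
  unfold roundsOrder utilityOrder
  rw [show (1 + ω) * L * d * Real.log (1 / δ) = L * ((1 + ω) * d * Real.log (1 / δ)) by ring,
    Real.sqrt_mul hL.le, Real.sqrt_mul hn'.le]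
  set q := √((1 + ω) * d * Real.log (1 / δ)) with hq
  have hq0 : 0 < q := by positivity
  have hl : √L * √L = L := Real.mul_self_sqrt hL.le
  have hn0 : 0 < √(n : ℝ) := by positivity
  field_simp
  rw [show √L ^ 2 = L by rw [sq, hl]]

/-- The last factor is the averaged Gaussian variance without `c T`; one power of the utility is
then traded against `T` by `roundsOrder_mul_utilityOrder`. -/
lemma utilityOrder_sq (hn : 0 < n) (hm : 0 < m) (hd : 0 < d) (hL : 0 < L)
    (hω : 0 ≤ ω) (hδ : 0 < δ) (hδ1 : δ < 1) (hε : 0 < ε) :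
    utilityOrder n m d L G ω ε δ ^ 2 = L * (1 + √(tau ω n)) ^ 2 *
      ((1 + ω) / n * (G ^ 2 * Real.log (1 / δ) / (m ^ 2 * ε ^ 2) * d)) := by
  have hΛ : 0 < Real.log (1 / δ) := Real.log_pos (one_lt_one_div hδ hδ1)
  have hn' : (0 : ℝ) < n := by exact_mod_cast hn
  have hm' : (0 : ℝ) < m := by exact_mod_cast hm
  unfold utilityOrder
  rw [mul_pow, div_pow, mul_pow, mul_pow, mul_pow, Real.sq_sqrt (by positivity),
    Real.sq_sqrt (by positivity)]
  field_simp

/-- The variance of the minibatch estimator is dominated by the utility. -/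
lemma minibatch_variance_le (hn : 0 < n) (hm : 0 < m) (hd : 0 < d) (hL : 0 < L) (hG : 0 < G)
    (hω : 0 ≤ ω) (hε : 0 < ε) (hδ : 0 < δ) (hδ1 : δ < 1) {b : ℝ}
    (hb : b = sgdBatch n m d L G ω ε δ ∨ b = m) :
    (1 + ω) / n * ((1 - b / m) * (G ^ 2 / b)) ≤ 2 * utilityOrder n m d L G ω ε δ := by
  have hΛ : 0 < Real.log (1 / δ) := Real.log_pos (one_lt_one_div hδ hδ1)
  have hn' : (0 : ℝ) < n := by exact_mod_cast hn
  have hm' : (0 : ℝ) < m := by exact_mod_cast hm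
  have hd' : (0 : ℝ) < d := by exact_mod_cast hd
  have hU := utilityOrder_pos hn hm hd hL hG hω hε hδ hδ1
  have hτ := tau_pos hω hn
  have hβ := beta_pos hω hn
  have hfull : b = m → (1 + ω) / n * ((1 - b / m) * (G ^ 2 / b))
      ≤ 2 * utilityOrder n m d L G ω ε δ := by
    rintro rfl
    rw [div_self hm'.ne']
    simp only [sub_self, zero_mul, mul_zero]
    positivity
  rcases hb with hb | hb
  · rw [sgdBatch] at hb
    rcases min_choice (m * ε * G * √(beta ω n) / √((1 + ω) * L * d * Real.log (1 / δ))) (m : ℝ)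
      with h | h
    · rw [h] at hb
      set q := √((1 + ω) * L * d * Real.log (1 / δ)) with hq
      have hq0 : 0 < q := by positivity
      have hb0 : 0 < b := by rw [hb]; positivity
      have hsb : 0 < √(beta ω n) := by positivity
      -- Since `n β τ = (1 + ω)² / 2`, already `2 √(n β τ) = √2 (1 + ω)` suffices; the sum `1 + √τ`
      -- is inserted to match `utilityOrder`.
      have key : 1 + ω ≤ 2 * (√(n : ℝ) * √(beta ω n)) * (1 + √(tau ω n)) := by
        have h1 : 1 + ω ≤ 2 * (√(n : ℝ) * √(beta ω n)) * √(tau ω n) := by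
          refine abs_le_of_sq_le_sq' ?_ (by positivity) |>.2
          rw [mul_pow, mul_pow, mul_pow, Real.sq_sqrt hn'.le, Real.sq_sqrt hβ.le,
            Real.sq_sqrt hτ.le, beta]
          have h2 : 2 ^ 2 * (n * (tau ω n / (2 * (1 + ω)))) * tau ω n
              = 2 * (n * tau ω n ^ 2 / (1 + ω)) := by
            field_simp
          rw [h2, tau_sq hω n]
          have h3 : (n : ℝ) * ((1 + ω) ^ 3 / n) / (1 + ω) = (1 + ω) ^ 2 := by field_simp
          rw [h3]
          nlinarith [sq_nonneg (1 + ω)]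
        refine h1.trans ?_
        gcongr
        linarith
      calc (1 + ω) / n * ((1 - b / m) * (G ^ 2 / b))
          ≤ (1 + ω) / n * (1 * (G ^ 2 / b)) := by
            gcongr
            have : 0 ≤ b / m := by positivity
            linarith
        _ = (1 + ω) * (G * q / (n * m * ε * √(beta ω n))) := by
            rw [hb]
            field_simp
        _ ≤ 2 * (√(n : ℝ) * √(beta ω n)) * (1 + √(tau ω n))
              * (G * q / (n * m * ε * √(beta ω n))) := by gcongr
        _ = 2 * utilityOrder n m d L G ω ε δ := by
            rw [utilityOrder, ← hq]
            have hs : (n : ℝ) = √(n : ℝ) ^ 2 := (Real.sq_sqrt hn'.le).symm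
            have hsn : 0 < √(n : ℝ) := by positivity
            nth_rewrite 2 [hs]
            field_simp
    · exact hfull (hb.trans h)
  · exact hfull hb

lemma sgdBatch_pos (hn : 0 < n) (hm : 0 < m) (hd : 0 < d) (hL : 0 < L) (hG : 0 < G)
    (hω : 0 ≤ ω) (hε : 0 < ε) (hδ : 0 < δ) (hδ1 : δ < 1) : 0 < sgdBatch n m d L G ω ε δ := by
  have hΛ : 0 < Real.log (1 / δ) := Real.log_pos (one_lt_one_div hδ hδ1)
  have hm' : (0 : ℝ) < m := by exact_mod_cast hm
  have hd' : (0 : ℝ) < d := by exact_mod_cast hd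
  have hβ := beta_pos hω hn
  unfold sgdBatch
  refine lt_min ?_ hm'
  positivity

/-- The bound of the convergence analysis in terms of the parameters of the theorem. -/
lemma utility_bound (hn : 0 < n) (hm : 0 < m) (hd : 0 < d) (hL : 0 < L) (hG : 0 < G)
    (hω : 0 ≤ ω) (hε : 0 < ε) (hδ : 0 < δ) (hδ1 : δ < 1) {b η c r Φ X σ : ℝ} (hη : 0 < η)
    (hc : 0 < c) (hr : 0 < r) (hΦ : 0 ≤ Φ)
    (hb : b = sgdBatch n m d L G ω ε δ ∨ b = m) {T : ℕ} (hT : 0 < T)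
    (hTr : (T : ℝ) = r * roundsOrder n m d L G ω ε δ)
    (hσ : σ = √(c * (G ^ 2 * T * Real.log (1 / δ) / (m ^ 2 * ε ^ 2))))
    (hX : η / 2 * X ≤ Φ + T * (3 / 2 * ((1 + ω) / n * noiseLevel m d G b σ)
      / (L * (1 + 2 * tau ω n)))) :
    1 / (T : ℝ) * X ≤ (6 + 3 * c) * (1 + r + Φ / r) * (1 / (η * ((1 + 2 * tau ω n) * L)))
      * utilityOrder n m d L G ω ε δ := by
  have hΛ : 0 < Real.log (1 / δ) := Real.log_pos (one_lt_one_div hδ hδ1)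
  have hT0 : (0 : ℝ) < T := by exact_mod_cast hT
  have hn' : (0 : ℝ) < n := by exact_mod_cast hn
  have hm' : (0 : ℝ) < m := by exact_mod_cast hm
  have hτ := tau_pos hω hn
  have hU := utilityOrder_pos hn hm hd hL hG hω hε hδ hδ1
  have hTU : T * utilityOrder n m d L G ω ε δ = r * (L * (1 + √(tau ω n)) ^ 2) := by
    rw [hTr, mul_assoc, roundsOrder_mul_utilityOrder hn hm hd hL hG hω hε hδ hδ1]
  have hUsq := utilityOrder_sq (G := G) hn hm hd hL hω hδ hδ1 hε
  have hmini := minibatch_variance_le hn hm hd hL hG hω hε hδ hδ1 hb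
  set Uo := utilityOrder n m d L G ω ε δ with hUo
  set a := 1 + 2 * tau ω n with ha
  set s := (1 + √(tau ω n)) ^ 2 with hs
  have ha0 : 0 < a := by positivity
  have hs0 : 0 < s := by positivity
  -- Allows the factor `1 + 2τ` of the stepsize bound to be absorbed by the `(1 + √τ)²` in `T` times
  -- the utility.
  have has : a ≤ 2 * s := by
    have h1 := Real.sqrt_nonneg (tau ω n)
    have h2 := Real.sq_sqrt hτ.le
    rw [ha, hs]
    nlinarith
  have hσ2 : σ ^ 2 = c * (G ^ 2 * T * Real.log (1 / δ) / (m ^ 2 * ε ^ 2)) := by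
    rw [hσ, Real.sq_sqrt (by positivity)]
  -- The noise variance grows linearly in `T`, which is where the summand `r` in the bound comes
  -- from.
  have hgauss : (1 + ω) / n * (σ ^ 2 * d) = c * r * Uo := by
    have h1 : (1 + ω) / n * (σ ^ 2 * d) * (L * s) = c * r * Uo * (L * s) := by
      calc (1 + ω) / n * (σ ^ 2 * d) * (L * s) = c * T * Uo ^ 2 := by
            rw [hUsq, hσ2]
            field_simp
        _ = c * Uo * (T * Uo) := by ring
        _ = _ := by rw [hTU]; ring
    exact mul_right_cancel₀ (by positivity) h1
  have hnoise : (1 + ω) / n * noiseLevel m d G b σ ≤ 2 * Uo + c * r * Uo := by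
    rw [noiseLevel, mul_add, hgauss]
    linarith
  have hLT : a * L / T ≤ 2 * Uo / r := by
    rw [div_le_div_iff₀ hT0 hr]
    calc a * L * r ≤ 2 * s * L * r := by gcongr
      _ = 2 * (r * (L * s)) := by ring
      _ = 2 * Uo * T := by rw [← hTU]; ring
  have h1 : 1 / (T : ℝ) * X ≤ 1 / (η * (a * L)) * (2 * Φ * (a * L / T)
      + 3 * ((1 + ω) / n * noiseLevel m d G b σ)) := by
    have h2 : 1 / (η * (a * L)) * (2 * Φ * (a * L / T)
        + 3 * ((1 + ω) / n * noiseLevel m d G b σ))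
        = 2 / (η * T) * (Φ + T * (3 / 2 * ((1 + ω) / n * noiseLevel m d G b σ) / (L * a))) := by
      field_simp
    rw [h2]
    calc 1 / (T : ℝ) * X = 2 / (η * T) * (η / 2 * X) := by field_simp
      _ ≤ _ := by gcongr
  refine h1.trans ?_
  have h3 : 2 * Φ * (a * L / T) + 3 * ((1 + ω) / n * noiseLevel m d G b σ)
      ≤ (6 + 3 * c) * (1 + r + Φ / r) * Uo := by
    -- The initial gap gives `4Φ/r`, the minibatch `6` and the Gaussian noise `3 c r`; all three are
    -- below `(6 + 3c)(1 + r + Φ/r)`.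
    calc _ ≤ 2 * Φ * (2 * Uo / r) + 3 * (2 * Uo + c * r * Uo) := by gcongr
      _ = (4 * (Φ / r) + 6 + 3 * c * r) * Uo := by field_simp; ring
      _ ≤ (6 + 3 * c) * (1 + r + Φ / r) * Uo := by
        gcongr
        have h4 : 0 ≤ Φ / r := by positivity
        nlinarith [mul_nonneg hc.le h4]
  calc _ ≤ 1 / (η * (a * L)) * ((6 + 3 * c) * (1 + r + Φ / r) * Uo) := by gcongr
    _ = _ := by ring

end Parameters

end SoteriaFL

theorem corollary1 (A : ℝ) (hA : 0 < A) :
    ∃ c > (0 : ℝ), ∃ c' > (0 : ℝ), ∃ C > (0 : ℝ),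
      ∀ (n m d : ℕ) (_ : 0 < n) (_ : 0 < m) (_ : 0 < d)
        (Z : Type u) (loss : Z → SoteriaFL.Vec d → ℝ)
        (L G : ℝ) (_ : 0 < L) (_ : 0 < G)
        (_ : ∀ z, SoteriaFL.IsSmooth L (loss z))
        (_ : ∀ z, SoteriaFL.HasBoundedGradient G (loss z))
        (U : Type v) (_ : MeasurableSpace U) (ν : ℕ → Fin n → Measure U)
        (_ : ∀ t i, IsProbabilityMeasure (ν t i))
        (K : ℕ → Fin n → U → SoteriaFL.Vec d → SoteriaFL.Vec d)
        (ω : ℝ) (_ : 0 ≤ ω)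
        (_ : ∀ t i, SoteriaFL.IsCompressionOperator (ν t i) (K t i) ω)
        (ε δ : ℝ) (_ : 0 < ε) (_ : 0 < δ) (_ : δ < 1)
        (x₀ : SoteriaFL.Vec d)
        (η : ℝ) (_ : 0 < η) (_ : η ≤ 1 / ((1 + 2 * √((1 + ω) ^ 3 / n)) * L))
        (b : ℝ) (_ : b = SoteriaFL.sgdBatch n m d L G ω ε δ ∨ b = m)
        (T : ℕ) (_ : 0 < T)
        (P : SoteriaFL.Params d)
        (_ : P = { x₀ := x₀, η := η, γ := SoteriaFL.shiftStepsize ω,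
                   σ := √(c * (G ^ 2 * T * Real.log (1 / δ) / (m ^ 2 * ε ^ 2))), b := b }),
        (ε ≤ A * Real.log (1 / δ) → ε < c' * (b ^ 2 * T / m ^ 2) →
          SoteriaFL.AlgorithmIsLDP m loss P ν K T ε δ) ∧
        (∀ D : Fin n → Fin m → Z, BddBelow (Set.range (SoteriaFL.objective loss D)) →
          ∀ r > (0 : ℝ), (T : ℝ) = r * SoteriaFL.roundsOrder n m d L G ω ε δ →
            (∀ t < T, Integrable (SoteriaFL.gradNormSq loss P K D t)
              (SoteriaFL.seedLaw m P ν)) ∧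
            (1 / (T : ℝ)) * ∑ t ∈ Finset.range T,
                ∫ ρ, SoteriaFL.gradNormSq loss P K D t ρ ∂(SoteriaFL.seedLaw m P ν)
              ≤ C * (1 + r + SoteriaFL.initialPotential loss D L ω x₀ / r)
                  * (1 / (η * ((1 + 2 * SoteriaFL.tau ω n) * L)))
                  * SoteriaFL.utilityOrder n m d L G ω ε δ) := by
  -- The witnesses come from `algorithmIsLDP` (the noise constant and the validity of the moment
  -- bounds) and from `utility_bound`, where `C = 6 + 3c`.
  refine ⟨SoteriaFL.noiseConst A, SoteriaFL.noiseConst_pos hA,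
    SoteriaFL.noiseConst A / (256 * (A + 1)),
    div_pos (SoteriaFL.noiseConst_pos hA) (by positivity), 6 + 3 * SoteriaFL.noiseConst A,
    by linarith [SoteriaFL.noiseConst_pos hA], ?_⟩
  intro n m d hn hm hd Z loss L G hL0 hG0 hL hG U _ ν _ K ω hω hK ε δ hε hδ hδ1 x₀ η hη hηL b hb
    T hT P hP
  have hm' : (0 : ℝ) < m := by exact_mod_cast hm
  have hb0 : 0 < b := by
    rcases hb with h | h
    · rw [h]
      exact SoteriaFL.sgdBatch_pos hn hm hd hL0 hG0 hω hε hδ hδ1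
    · rwa [h]
  have hbm : b ≤ m := by
    rcases hb with h | h
    · rw [h]
      exact min_le_right _ _
    · exact h.le
  have hKm := fun t i => (hK t i).measurable
  have hPb : P.b = b := by rw [hP]
  have hPη : P.η = η := by rw [hP]
  rw [SoteriaFL.sqrt_eq_tau hω hn] at hηL
  have hPb0 : 0 < P.b := by rwa [hPb]
  have hPbm : P.b ≤ m := by rwa [hPb]
  refine ⟨fun h1 h2 => ?_, fun D hbdd r hr hTr => ⟨fun t _ => ?_, ?_⟩⟩
  · exact SoteriaFL.algorithmIsLDP hd hm
      (fun z => SoteriaFL.measurable_gradient_of_isSmooth (hL z)) P hPb0 hPbm ν hKm hA hG0 hG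
      hε hδ hδ1 hT (by rw [hP]) h1 (by rwa [hPb])
  · exact SoteriaFL.integrable_gradNormSq hn hm hL hG P hPb0.le hPbm ν hKm D t
  · have hτ := SoteriaFL.tau_pos hω hn
    have hmain := SoteriaFL.sum_integral_gradNormSq_le hn hm hL0 hL hG hbdd hω hτ
      (SoteriaFL.tau_sq hω n) P (by rwa [hPη]) (by rwa [hPη]) (by rw [hP]) hPb0 hPbm ν hK T
    have hpot := SoteriaFL.potential_le_initialPotential loss D hL0 hω hn x₀
    have hw : 0 ≤ SoteriaFL.shiftWeight L ω (SoteriaFL.tau ω n) := by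
      unfold SoteriaFL.shiftWeight
      positivity
    -- Nonnegativity of the smaller potential gives `0 ≤ Φ₀`, as `utility_bound` requires.
    have hpot0 := SoteriaFL.potential_nonneg hbdd hw x₀ fun _ : Fin n => (0 : SoteriaFL.Vec d)
    refine SoteriaFL.utility_bound hn hm hd hL0 hG0 hω hε hδ hδ1 hη (SoteriaFL.noiseConst_pos hA)
      hr (hpot0.trans hpot) hb hT hTr rfl ?_
    have hPx : P.x₀ = x₀ := by rw [hP]
    have hPσ : P.σ = √(SoteriaFL.noiseConst A *
      (G ^ 2 * T * Real.log (1 / δ) / (m ^ 2 * ε ^ 2))) := by rw [hP]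
    rw [hPx, hPη, hPb, hPσ] at hmain
    exact hmain.trans (by gcongr)
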